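/- Let atoms carry a fixed bias, positive or negative. A non-atomic formula is positive if it is of the form $A\otimes B$, $A\oslash B$, $B\mathbin{⦸} A$, and negative if it is of the form $A\oplus B$, $A\backslash B$, $B/A$. **The calculus fLG.** Input structures are built from formulas labelled by variables, $x:A$, output structures from formulas labelled by covariables, $\alpha:A$, by the structural connectives $X\cdot\otimes\cdot X'$, $X\cdot\oslash\cdot Y$, $Y\cdot\mathbin{⦸}\cdot X$ (input) and $Y\cdot\oplus\cdot Y'$, $X\cdot\backslash\cdot Y$, $Y\cdot/\cdot X$ (output), with $X,X'$ input and $Y,Y'$ output. Distinct formula occurrences of a sequent carry distinct labels. There are three judgements, $X\vdash[v:A]$ ($v$ a value), $[e:A]\vdash Y$ ($e$ a context), $C:(X\vdash Y)$ ($C$ a command), and the cut-free rules are: * axioms $x:A\vdash[x:A]$ ($A$ positive) and $[\alpha:A]\vdash\alpha:A$ ($A$ negative); * focusing: from $X\vdash[V:A]$ infer $\langle V\upharpoonright\alpha\rangle:(X\vdash\alpha:A)$ ($A$ positive); from $[E:A]\vdash Y$ infer $\langle x\upharpoonleft E\rangle:(x:A\vdash Y)$ ($A$ negative); * defocusing: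 from $C:(x:A\vdash Y)$ infer $[\tilde\mu x.C:A]\vdash Y$ ($A$ positive); from $C:(X\vdash\alpha:A)$ infer $X\vdash[\mu\alpha.C:A]$ ($A$ negative); * invertible rules, replacing a displayed structural connective between two labelled formulas by the logical one and $C$ by an extended command $\frac{a\ b}{m}.C$, where $a,b$ are the labels of the two formulas and $m$ is the label of the new one; e.g. from $C:(x:A\cdot\otimes\cdot y:B\vdash Y)$ infer $\frac{x\ y}{z}.C:(z:A\otimes B\vdash Y)$; likewise for $\oslash,\mathbin{⦸}$ on the left and $\oplus,\backslash,/$ on the right. No requirement is imposed that all invertible rules be applied before focusing; * non-invertible rules, e.g. from $X\vdash[v_1:A]$ and $X'\vdash[v_2:B]$ infer $X\cdot\otimes\cdot X'\vdash[v_1\otimes v_2:A\otimes B]$, and from $[e:B]\vdash Y$ and $X\vdash[v:A]$ infer $[e/v:B/A]\vdash Y\cdot/\cdot X$; similarly $v\oslash e$, $e\mathbin{⦸} v$ on the right and $e_1\oplus e_2$, $v\backslash e$ on the left; * structural rules on commands, not changing the term: the display postulates ($X\cdot\otimes\cdot Y\vdash Z$ iff $X\vdash Z\cdot/\cdot Y$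 iff $Y\vdash X\cdot\backslash\cdot Z$; and $Z\vdash Y\cdot\oplus\cdot X$ iff $Y\cdot\mathbin{⦸}\cdot Z\vdash X$ iff $Z\cdot\oslash\cdot X\vdash Y$), and the distributivity postulates, by which $X\cdot\otimes\cdot Y\vdash Z\cdot\oplus\cdot W$ yields each of $Z\cdot\mathbin{⦸}\cdot X\vdash W\cdot/\cdot Y$, $Z\cdot\mathbin{⦸}\cdot Y\vdash X\cdot\backslash\cdot W$, $Y\cdot\oslash\cdot W\vdash X\cdot\backslash\cdot Z$, $X\cdot\oslash\cdot W\vdash Z\cdot/\cdot Y$. **Proof nets.** A proof structure is a finite set of vertices labelled by formulas together with a set of links, each vertex being at most once a premiss and at most once a conclusion of a link. Each connective has a left link and a right link. Writing premisses $\Rightarrow$ conclusions in left-to-right order, the left links are $A\otimes B\Rightarrow A,B$; $\;A/B,B\Rightarrow A$; $\;A,A\backslash B\Rightarrow B$; $\;A\oplus B\Rightarrow A,B$; $\;A\oslash B,B\Rightarrow A$; $\;A,A\mathbin{⦸} B\Rightarrow B$; the right links are obtained by exchanging premisses and conclusions. The compound formula is the main formula, the other two are active. Right links of $\otimes,\oslash,\mathbin{⦸}$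 and left links of $\oplus,\backslash,/$ are tensor links, the others are cotensor links. A hypothesis (conclusion) is a vertex that is not a conclusion (premiss) of a link. A proof structure is a proof net if, after its formulas are erased, it converts to a tree (connected, acyclic, without cotensor links) by steps of two kinds. (i) Contraction: a tensor and a cotensor link of opposite premiss/conclusion shape that share the two active vertices of the cotensor link, in matching positions, so that apart from these they have one upper vertex $h$ and one lower vertex $c\neq h$, at the same position, one of them being the main vertex of the cotensor link, are replaced by a single vertex. (ii) Grishin interaction: tensor links $x,y\Rightarrow m$ and $m\Rightarrow v,w$ are replaced by one of the four pairs $(x\Rightarrow v,u;\ u,y\Rightarrow w)$, $(x\Rightarrow u,w;\ u,y\Rightarrow v)$, $(y\Rightarrow u,w;\ x,u\Rightarrow v)$, $(y\Rightarrow v,u;\ x,u\Rightarrow w)$. It is cut-free if no vertex is the main vertex of two links. **Term computation.** Let $P$ be a cut-free proof net with a designated conclusion $d$. Every vertex is expanded into an axiom link with an upper end (as a hypothesis, or as a conclusion of the link above) and a lower end (as a conclusion of $P$, or as a premiss of the link below). Each end is of sort value or context: hypotheses and the lower end of $d$ are values, the other conclusions are contexts; in each link the main formula is a value if it is positive and a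 context if it is negative, and the active formulas have the sorts they have in the terms $v_1\otimes v_2$, $v\oslash e$, $e\mathbin{⦸} v$, $e_1\oplus e_2$, $v\backslash e$, $e/v$. An axiom link is a substitution link if both ends have the same sort, a command link if a value is above a context, and a $\mu/\tilde\mu$ link if a context is above a value. Assume that the bias is respected: the formula of a substitution link is positive if the link joins two values, and negative if it joins two contexts. Let a bijection (pairing) between the command links and the $\mu/\tilde\mu$ links of $P$ be given. Terms are computed as follows. Hypotheses and active vertices of cotensor links carry atomic terms (as do conclusions other than $d$), substitution links identify the terms at their ends, and tensor links build the complex term of their main formula from the terms of their active formulas. From the term computed at a command link of a formula $A$ one forms $\langle x\upharpoonleft E\rangle$ if $A$ is negative and $\langle V\upharpoonright\alpha\rangle$ if $A$ is positive. Then one passes cotensor links both of whose active labels $a,b$ are free in the current command $C$, forming $\frac{a\ b}{m}.C$ with $m$ the label of the main formula; this is repeated any number of times (in particular it may be repeated until no such link is left). Then one follows the $\mu/\tilde\mu$ link paired with the command link, whose (co)variable has to be free in $C$: if its formula is negative the value at its lower end becomes $\mu\alpha.C$ (and $\alpha$ is the context at its upper end), if its formula is positive the context at its upper end becomes $\tilde\mu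 x.C$ (and $x$ is the value at its lower end). A value $v$ at $d$ is *calculated for $P$ with this pairing* if it is obtained in this way and the computation has visited all links of $P$, all command links and all $\mu/\tilde\mu$ links. **Lemma.** If $v$ is a term calculated for $P$ with the given pairing, then there is a proof in fLG of a sequent $X\vdash[v:A]$, where $A$ is the formula of $d$ and the labelled formulas of $X$ are, each occurring exactly once, the hypotheses of $P$ (labelled by their variables) and the conclusions of $P$ other than $d$ (labelled by their covariables). -/

import Mathlib

namespace LG

/-! ### Formulas, polarities -/

/-- Polarity of a formula. -/
inductive Pol : Type
  | pos
  | neg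

/-- The two sorts of labels: `val` for values (variables, input structures) and `ctx` for
contexts (covariables, output structures). -/
inductive Srt : Type
  | val
  | ctx

/-- The six connectives `⊗`, `⊘`, `⦸`, `⊕`, `\` (`ldiv`), `/` (`rdiv`) of the Lambek-Grishin calculus. -/
inductive Conn : Type
  | tensor
  | oslash
  | obslash
  | plus
  | ldiv
  | rdiv

namespace Conn

/-- `A ⊗ B`, `A ⊘ B`, `B ⦸ A` are positive, `A ⊕ B`, `A \ B`, `B / A` are negative. -/
def pol : Conn → Pol
  | tensor | oslash | obslash => .pos
  | plus | ldiv | rdiv => .neg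

/-- Sort of the label of the main formula in the links of a connective. -/
def srt : Conn → Srt
  | tensor | oslash | obslash => .val
  | plus | ldiv | rdiv => .ctx

/-- Sort of the label of the left immediate subformula. -/
def fstSrt : Conn → Srt
  | tensor | oslash | ldiv => .val
  | obslash | plus | rdiv => .ctx

/-- Sort of the label of the right immediate subformula. -/
def sndSrt : Conn → Srt
  | tensor | obslash | rdiv => .val
  | oslash | plus | ldiv => .ctx

end Conn

/-- Formulas; `bin c A B` is the formula `A c B`. -/
inductive Form (Atom : Type*) : Type _
  | atom : Atom → Form Atom
  | bin : Conn → Form Atom → Form Atom → Form Atom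

/-- Polarity of a formula, relative to a bias of the atoms. -/
def Form.pol {Atom : Type*} (bias : Atom → Pol) : Form Atom → Pol
  | .atom p => bias p
  | .bin c _ _ => c.pol

/-! ### Terms -/

/-- The three kinds of expressions: values, contexts and (extended) commands. -/
inductive Kind : Type
  | val
  | ctx
  | cmd

/-- Terms over a set `N` of names. Each name yields a variable and, independently, a covariable.
* `cmdL x e` is the command `⟨x ↿ e⟩`, `cmdR v α` is the command `⟨v ↾ α⟩`.
* `frac c a b m C` is the extended command `(a b / m). C` for the connective `c`; whether `a`, `b`,
  `m` stand for variables or covariables is determined by `c`: `x y / z` for `⊗`, `x β / z` for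
  `⊘`, `β x / z` for `⦸`, `α β / γ` for `⊕`, `x β / γ` for `\`, `β x / γ` for `/`. -/
inductive Tm (N : Type*) : Kind → Type _
  | var (x : N) : Tm N .val
  | mu (α : N) (C : Tm N .cmd) : Tm N .val
  | tensor (v₁ v₂ : Tm N .val) : Tm N .val
  | oslash (v : Tm N .val) (e : Tm N .ctx) : Tm N .val
  | obslash (e : Tm N .ctx) (v : Tm N .val) : Tm N .val
  | covar (α : N) : Tm N .ctx
  | comu (x : N) (C : Tm N .cmd) : Tm N .ctx
  | plus (e₁ e₂ : Tm N .ctx) : Tm N .ctx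
  | ldiv (v : Tm N .val) (e : Tm N .ctx) : Tm N .ctx
  | rdiv (e : Tm N .ctx) (v : Tm N .val) : Tm N .ctx
  | cmdL (x : N) (e : Tm N .ctx) : Tm N .cmd
  | cmdR (v : Tm N .val) (α : N) : Tm N .cmd
  | frac (c : Conn) (a b m : N) (C : Tm N .cmd) : Tm N .cmd

/-- Free variables `(x, val)` and free covariables `(α, ctx)` of a term. -/
def Tm.fv {N : Type*} : {k : Kind} → Tm N k → Set (N × Srt)
  | _, .var x => {(x, .val)}
  | _, .mu α C => C.fv \ {(α, .ctx)}
  | _, .tensor v₁ v₂ => v₁.fv ∪ v₂.fv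
  | _, .oslash v e => v.fv ∪ e.fv
  | _, .obslash e v => e.fv ∪ v.fv
  | _, .covar α => {(α, .ctx)}
  | _, .comu x C => C.fv \ {(x, .val)}
  | _, .plus e₁ e₂ => e₁.fv ∪ e₂.fv
  | _, .ldiv v e => v.fv ∪ e.fv
  | _, .rdiv e v => e.fv ∪ v.fv
  | _, .cmdL x e => {(x, .val)} ∪ e.fv
  | _, .cmdR v α => v.fv ∪ {(α, .ctx)}
  | _, .frac c a b m C => (C.fv \ {(a, c.fstSrt), (b, c.sndSrt)}) ∪ {(m, c.srt)}

/-! ### The focused display calculus -/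

/-- Structures with labelled formulas: `Str N Atom .val` are the input structures (formulas labelled
by variables), `Str N Atom .ctx` the output structures (formulas labelled by covariables). -/
inductive Str (N Atom : Type*) : Srt → Type _
  | leaf (s : Srt) (x : N) (A : Form Atom) : Str N Atom s
  | tensor (X Y : Str N Atom .val) : Str N Atom .val
  | oslash (X : Str N Atom .val) (Y : Str N Atom .ctx) : Str N Atom .val
  | obslash (Y : Str N Atom .ctx) (X : Str N Atom .val) : Str N Atom .val
  | plus (X Y : Str N Atom .ctx) : Str N Atom .ctx
  | ldiv (X : Str N Atom .val) (Y : Str N Atom .ctx) : Str N Atom .ctx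
  | rdiv (Y : Str N Atom .ctx) (X : Str N Atom .val) : Str N Atom .ctx

/-- The labelled formulas of a structure, from left to right, with the sort of their labels. -/
def Str.leaves {N Atom : Type*} : {s : Srt} → Str N Atom s → List (N × Srt × Form Atom)
  | _, .leaf s x A => [(x, s, A)]
  | _, .tensor X Y => X.leaves ++ Y.leaves
  | _, .oslash X Y => X.leaves ++ Y.leaves
  | _, .obslash Y X => Y.leaves ++ X.leaves
  | _, .plus X Y => X.leaves ++ Y.leaves
  | _, .ldiv X Y => X.leaves ++ Y.leaves
  | _, .rdiv Y X => Y.leaves ++ X.leaves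

/-- The labels (variables and covariables) of a structure. -/
def Str.names {N Atom : Type*} {s : Srt} (X : Str N Atom s) : List (N × Srt) :=
  X.leaves.map fun l => (l.1, l.2.1)

/-- The three types of judgements: `val X v A` is `X ⊢ [v : A]`, `ctx e A Y` is `[e : A] ⊢ Y`, and
`cmd C X Y` is `C : (X ⊢ Y)`. -/
inductive Judg (N Atom : Type*) : Type _
  | val (X : Str N Atom .val) (v : Tm N .val) (A : Form Atom)
  | ctx (e : Tm N .ctx) (A : Form Atom) (Y : Str N Atom .ctx)
  | cmd (C : Tm N .cmd) (X : Str N Atom .val) (Y : Str N Atom .ctx)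

open Str in
/-- Derivability in the cut-free focused calculus fLG. The side conditions on names are the usual
convention that distinct formula occurrences of a sequent carry distinct labels. The polarity
conditions exclude `cmdL x e` with `e` of the form `comu` and `cmdR v α` with `v` of the form
`mu`. -/
inductive FLG {N Atom : Type*} (bias : Atom → Pol) : Judg N Atom → Prop
  -- axioms
  | ax (x : N) (A : Form Atom) : A.pol bias = .pos →
      FLG bias (.val (leaf .val x A) (.var x) A)
  | coax (α : N) (A : Form Atom) : A.pol bias = .neg →
      FLG bias (.ctx (.covar α) A (leaf .ctx α A))
  -- focusing
  | muStar {X V A} (α : N) : A.pol bias = .pos → (α, Srt.ctx) ∉ X.names →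
      FLG bias (.val X V A) → FLG bias (.cmd (.cmdR V α) X (leaf .ctx α A))
  | comuStar {Y E A} (x : N) : A.pol bias = .neg → (x, Srt.val) ∉ Y.names →
      FLG bias (.ctx E A Y) → FLG bias (.cmd (.cmdL x E) (leaf .val x A) Y)
  -- defocusing
  | comu {Y C A} (x : N) : A.pol bias = .pos →
      FLG bias (.cmd C (leaf .val x A) Y) → FLG bias (.ctx (.comu x C) A Y)
  | mu {X C A} (α : N) : A.pol bias = .neg →
      FLG bias (.cmd C X (leaf .ctx α A)) → FLG bias (.val X (.mu α C) A)
  -- invertible rules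
  | tensorL {x y z : N} {A B C Y} : (z, Srt.val) ∉ Y.names →
      FLG bias (.cmd C (tensor (leaf .val x A) (leaf .val y B)) Y) →
      FLG bias (.cmd (.frac .tensor x y z C) (leaf .val z (.bin .tensor A B)) Y)
  | oslashL {x β z : N} {A B C Y} : (z, Srt.val) ∉ Y.names →
      FLG bias (.cmd C (oslash (leaf .val x A) (leaf .ctx β B)) Y) →
      FLG bias (.cmd (.frac .oslash x β z C) (leaf .val z (.bin .oslash A B)) Y)
  | obslashL {β x z : N} {B A C Y} : (z, Srt.val) ∉ Y.names →
      FLG bias (.cmd C (obslash (leaf .ctx β B) (leaf .val x A)) Y) →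
      FLG bias (.cmd (.frac .obslash β x z C) (leaf .val z (.bin .obslash B A)) Y)
  | plusR {α β γ : N} {A B C X} : (γ, Srt.ctx) ∉ X.names →
      FLG bias (.cmd C X (plus (leaf .ctx α A) (leaf .ctx β B))) →
      FLG bias (.cmd (.frac .plus α β γ C) X (leaf .ctx γ (.bin .plus A B)))
  | ldivR {x β γ : N} {A B C X} : (γ, Srt.ctx) ∉ X.names →
      FLG bias (.cmd C X (ldiv (leaf .val x A) (leaf .ctx β B))) →
      FLG bias (.cmd (.frac .ldiv x β γ C) X (leaf .ctx γ (.bin .ldiv A B)))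
  | rdivR {β x γ : N} {B A C X} : (γ, Srt.ctx) ∉ X.names →
      FLG bias (.cmd C X (rdiv (leaf .ctx β B) (leaf .val x A))) →
      FLG bias (.cmd (.frac .rdiv β x γ C) X (leaf .ctx γ (.bin .rdiv B A)))
  -- non-invertible rules
  | tensorR {X Y v₁ v₂ A B} : X.names.Disjoint Y.names →
      FLG bias (.val X v₁ A) → FLG bias (.val Y v₂ B) →
      FLG bias (.val (tensor X Y) (.tensor v₁ v₂) (.bin .tensor A B))
  | oslashR {X Y v e A B} : X.names.Disjoint Y.names →
      FLG bias (.val X v A) → FLG bias (.ctx e B Y) →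
      FLG bias (.val (oslash X Y) (.oslash v e) (.bin .oslash A B))
  | obslashR {Y X e v B A} : Y.names.Disjoint X.names →
      FLG bias (.ctx e B Y) → FLG bias (.val X v A) →
      FLG bias (.val (obslash Y X) (.obslash e v) (.bin .obslash B A))
  | plusL {Y X e₁ e₂ B A} : Y.names.Disjoint X.names →
      FLG bias (.ctx e₁ B Y) → FLG bias (.ctx e₂ A X) →
      FLG bias (.ctx (.plus e₁ e₂) (.bin .plus B A) (plus Y X))
  | ldivL {X Y v e A B} : X.names.Disjoint Y.names →
      FLG bias (.val X v A) → FLG bias (.ctx e B Y) →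
      FLG bias (.ctx (.ldiv v e) (.bin .ldiv A B) (ldiv X Y))
  | rdivL {Y X e v B A} : Y.names.Disjoint X.names →
      FLG bias (.ctx e B Y) → FLG bias (.val X v A) →
      FLG bias (.ctx (.rdiv e v) (.bin .rdiv B A) (rdiv Y X))
  -- display postulates
  | rp₁ {C X Y Z} : FLG bias (.cmd C X (rdiv Z Y)) → FLG bias (.cmd C (tensor X Y) Z)
  | rp₂ {C X Y Z} : FLG bias (.cmd C (tensor X Y) Z) → FLG bias (.cmd C X (rdiv Z Y))
  | rp₃ {C X Y Z} : FLG bias (.cmd C (tensor X Y) Z) → FLG bias (.cmd C Y (ldiv X Z))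
  | rp₄ {C X Y Z} : FLG bias (.cmd C Y (ldiv X Z)) → FLG bias (.cmd C (tensor X Y) Z)
  | drp₁ {C X Y Z} : FLG bias (.cmd C (obslash Y Z) X) → FLG bias (.cmd C Z (plus Y X))
  | drp₂ {C X Y Z} : FLG bias (.cmd C Z (plus Y X)) → FLG bias (.cmd C (obslash Y Z) X)
  | drp₃ {C X Y Z} : FLG bias (.cmd C Z (plus Y X)) → FLG bias (.cmd C (oslash Z X) Y)
  | drp₄ {C X Y Z} : FLG bias (.cmd C (oslash Z X) Y) → FLG bias (.cmd C Z (plus Y X))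
  -- distributivity postulates
  | g₁ {C X Y Z W} : FLG bias (.cmd C (tensor X Y) (plus Z W)) →
      FLG bias (.cmd C (obslash Z X) (rdiv W Y))
  | g₂ {C X Y Z W} : FLG bias (.cmd C (tensor X Y) (plus Z W)) →
      FLG bias (.cmd C (obslash Z Y) (ldiv X W))
  | g₃ {C X Y Z W} : FLG bias (.cmd C (tensor X Y) (plus Z W)) →
      FLG bias (.cmd C (oslash Y W) (ldiv X Z))
  | g₄ {C X Y Z W} : FLG bias (.cmd C (tensor X Y) (plus Z W)) →
      FLG bias (.cmd C (oslash X W) (rdiv Z Y))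

/-! ### Abstract proof structures, conversions, trees -/

/-- Unlabelled links: the lists of premisses and conclusions and, for a cotensor link, the main
vertex; `main = none` for a tensor link. -/
structure ALink (V : Type*) where
  prems : List V
  concls : List V
  main : Option V

/-- Abstract proof structures on vertices taken from `V`. The formulas attached to hypotheses and
conclusions play no role in conversions and are not recorded. -/
structure APS (V : Type*) where
  verts : Set V
  links : Set (ALink V)

/-- Renaming of the vertices of a link. -/
def ALink.map {V W : Type*} (f : V → W) (l : ALink V) : ALink W :=
  ⟨l.prems.map f, l.concls.map f, l.main.map f⟩

open Classical in
/-- The map that sends `c` to `h` and fixes every other vertex. -/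
noncomputable def merge {V : Type*} (c h : V) (v : V) : V := if v = c then h else v

/-- `Redex t k h c i j`: the tensor link `t` and the cotensor link `k` form the left hand side of a
contraction with upper vertex `h`, lower vertex `c` and internal vertices `i`, `j`. -/
inductive Redex {V : Type*} : ALink V → ALink V → V → V → V → V → Prop
  | rdivR (h c i j : V) : Redex ⟨[h, i], [j], none⟩ ⟨[j], [c, i], some c⟩ h c i j
  | tensorL (h c i j : V) : Redex ⟨[i, j], [c], none⟩ ⟨[h], [i, j], some h⟩ h c i j
  | ldivR (h c i j : V) : Redex ⟨[i, h], [j], none⟩ ⟨[j], [i, c], some c⟩ h c i j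
  | oslashL (h c i j : V) : Redex ⟨[j], [c, i], none⟩ ⟨[h, i], [j], some h⟩ h c i j
  | plusR (h c i j : V) : Redex ⟨[h], [i, j], none⟩ ⟨[i, j], [c], some c⟩ h c i j
  | obslashL (h c i j : V) : Redex ⟨[j], [i, c], none⟩ ⟨[i, h], [j], some h⟩ h c i j

/-- `Interaction x y m v w l₁ l₂`: the tensor links from `x, y` to `m` and from `m` to `v, w` may be
replaced by the tensor links `l₁`, `l₂` (whose internal vertex is again called `m`). -/
inductive Interaction {V : Type*} (x y m v w : V) : ALink V → ALink V → Prop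
  | g₁ : Interaction x y m v w ⟨[x], [v, m], none⟩ ⟨[m, y], [w], none⟩
  | g₂ : Interaction x y m v w ⟨[x], [m, w], none⟩ ⟨[m, y], [v], none⟩
  | g₃ : Interaction x y m v w ⟨[y], [m, w], none⟩ ⟨[x, m], [v], none⟩
  | g₄ : Interaction x y m v w ⟨[y], [v, m], none⟩ ⟨[x, m], [w], none⟩

/-- One conversion step. -/
inductive Step {V : Type*} : APS V → APS V → Prop
  /-- A contraction: the redex is replaced by a single vertex, which is called `h` again. -/
  | contract {A : APS V} {t k : ALink V} {h c i j : V} : Redex t k h c i j → [h, c, i, j].Nodup →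
      t ∈ A.links → k ∈ A.links →
      Step A ⟨A.verts \ {c, i, j}, ALink.map (merge c h) '' (A.links \ {t, k})⟩
  /-- A Grishin interaction. -/
  | interact {A : APS V} {x y m v w : V} {l₁ l₂ : ALink V} : Interaction x y m v w l₁ l₂ →
      [x, y, m, v, w].Nodup → ⟨[x, y], [m], none⟩ ∈ A.links → ⟨[m], [v, w], none⟩ ∈ A.links →
      Step A ⟨A.verts, (A.links \ {⟨[x, y], [m], none⟩, ⟨[m], [v, w], none⟩}) ∪ {l₁, l₂}⟩

/-- The incidence graph of an abstract proof structure: its nodes are the vertices and the links,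
and a vertex is joined to the links of which it is a premiss or a conclusion. -/
def APS.incidence {V : Type*} (A : APS V) : SimpleGraph (A.verts ⊕ A.links) :=
  SimpleGraph.fromRel fun a b => match a, b with
    | .inl v, .inr l => v.1 ∈ l.1.prems ∨ v.1 ∈ l.1.concls
    | _, _ => False

/-- A tree: acyclic, connected and without cotensor links. (A link that touches a vertex twice would
be a cycle that the simple incidence graph does not show.) -/
def APS.IsTree {V : Type*} (A : APS V) : Prop :=
  (∀ l ∈ A.links, l.main = none) ∧ (∀ l ∈ A.links, (l.prems ++ l.concls).Nodup) ∧
    A.incidence.IsTree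

/-! ### Proof structures and proof nets -/

/-- Left and right links. -/
inductive Side : Type
  | left
  | right

/-- The link for the connective `conn` on the given side, with main vertex `main` (labelled `A c B`)
and with `fst`, `snd` the vertices labelled `A`, `B`. -/
structure Link (V : Type*) where
  conn : Conn
  side : Side
  main : V
  fst : V
  snd : V

namespace Link

variable {V : Type*}

/-- Tensor links are the right links of the positive and the left links of the negative
connectives; the other links are cotensor links. -/
def IsTensor (l : Link V) : Prop :=
  match l.conn.pol, l.side with
  | .pos, .right => True
  | .neg, .left => True
  | _, _ => False

/-- The group of tentacles that contains the main vertex, in left-to-right order, with the sorts of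
the labels of the term-labelled links. -/
def outer (l : Link V) : List (V × Srt) :=
  match l.conn with
  | .tensor => [(l.main, .val)]
  | .oslash => [(l.main, .val), (l.snd, .ctx)]
  | .obslash => [(l.fst, .ctx), (l.main, .val)]
  | .plus => [(l.main, .ctx)]
  | .ldiv => [(l.fst, .val), (l.main, .ctx)]
  | .rdiv => [(l.main, .ctx), (l.snd, .val)]

/-- The remaining tentacles. -/
def inner (l : Link V) : List (V × Srt) :=
  match l.conn with
  | .tensor => [(l.fst, .val), (l.snd, .val)]
  | .oslash => [(l.fst, .val)]
  | .obslash => [(l.snd, .val)]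
  | .plus => [(l.fst, .ctx), (l.snd, .ctx)]
  | .ldiv => [(l.snd, .ctx)]
  | .rdiv => [(l.fst, .ctx)]

/-- Premisses with their sorts: the main vertex of a left link is a premiss. -/
def prems (l : Link V) : List (V × Srt) :=
  match l.side with
  | .left => l.outer
  | .right => l.inner

/-- Conclusions with their sorts: the main vertex of a right link is a conclusion. -/
def concls (l : Link V) : List (V × Srt) :=
  match l.side with
  | .left => l.inner
  | .right => l.outer

/-- Premisses, as vertices. -/
def premVerts (l : Link V) : List V := l.prems.map Prod.fst

/-- Conclusions, as vertices. -/
def conclVerts (l : Link V) : List V := l.concls.map Prod.fst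

open Classical in
/-- The underlying unlabelled link. -/
noncomputable def toALink (l : Link V) : ALink V :=
  ⟨l.premVerts, l.conclVerts, if l.IsTensor then none else some l.main⟩

end Link

/-- A proof structure whose set of formula occurrences is `V`. -/
structure ProofStructure (Atom V : Type*) where
  /-- The formula at a vertex. -/
  form : V → Form Atom
  /-- The links. -/
  links : Set (Link V)
  form_main : ∀ l ∈ links, form l.main = .bin l.conn (form l.fst) (form l.snd)
  prem_unique : ∀ l ∈ links, ∀ l' ∈ links, ∀ v, v ∈ l.premVerts → v ∈ l'.premVerts → l = l'
  concl_unique : ∀ l ∈ links, ∀ l' ∈ links, ∀ v, v ∈ l.conclVerts → v ∈ l'.conclVerts → l = l'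
  prem_nodup : ∀ l ∈ links, l.premVerts.Nodup
  concl_nodup : ∀ l ∈ links, l.conclVerts.Nodup

namespace ProofStructure

variable {Atom V : Type*} (P : ProofStructure Atom V)

/-- Hypotheses: not the conclusion of any link. -/
def IsHyp (v : V) : Prop := ∀ l ∈ P.links, v ∉ l.conclVerts

/-- Conclusions: not the premiss of any link. -/
def IsConcl (v : V) : Prop := ∀ l ∈ P.links, v ∉ l.premVerts

/-- The underlying abstract proof structure. -/
noncomputable def toAPS : APS V := ⟨Set.univ, Link.toALink '' P.links⟩

/-- A proof net is a proof structure that converts to a tree. -/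
def IsProofNet : Prop := ∃ T : APS V, Relation.ReflTransGen Step P.toAPS T ∧ T.IsTree

/-- No cut formulas: no vertex is the main vertex of two links. -/
def CutFree : Prop := ∀ l ∈ P.links, ∀ l' ∈ P.links, l.main = l'.main → l = l'

/-! ### Composition graph

Every vertex is expanded into an axiom link, whose upper end is a hypothesis or a conclusion of the
link above, and whose lower end is a conclusion or a premiss of the link below. The variable and the
covariable at the ends of the axiom link of `v` are both named `v`. The vertex `d` is the designated
conclusion, at which a value is computed. -/

/-- Sort of the upper end of the axiom link of `v`. -/
def TopSrt (v : V) (s : Srt) : Prop :=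
  (P.IsHyp v ∧ s = .val) ∨ ∃ l ∈ P.links, (v, s) ∈ l.concls

/-- Sort of the lower end of the axiom link of `v`. -/
def BotSrt (d v : V) (s : Srt) : Prop :=
  (P.IsConcl v ∧ ((v = d ∧ s = .val) ∨ (v ≠ d ∧ s = .ctx))) ∨ ∃ l ∈ P.links, (v, s) ∈ l.prems

/-- The axiom link of `v` is a substitution link joining two ends of sort `s`. -/
def IsSubst (d v : V) (s : Srt) : Prop := P.TopSrt v s ∧ P.BotSrt d v s

/-- The axiom link of `v` is a command link: a value above a context. -/
def IsCommand (d v : V) : Prop := P.TopSrt v .val ∧ P.BotSrt d v .ctx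

/-- The axiom link of `v` is a `μ/μ̃` link: a context above a value. -/
def IsMu (d v : V) : Prop := P.TopSrt v .ctx ∧ P.BotSrt d v .val

/-- Substitution links respect the bias: those that join two values carry a positive formula, those
that join two contexts a negative one. -/
def RespectsBias (bias : Atom → Pol) (d : V) : Prop :=
  ∀ v, (P.IsSubst d v .val → (P.form v).pol bias = .pos) ∧
    (P.IsSubst d v .ctx → (P.form v).pol bias = .neg)

/-- The upper end of the axiom link of `v` carries a variable: `v` is a hypothesis, or an active
conclusion of a cotensor link. -/
def TopVar (v : V) : Prop :=
  P.IsHyp v ∨ ∃ l ∈ P.links, ¬ l.IsTensor ∧ (v, Srt.val) ∈ l.concls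

/-- The lower end of the axiom link of `v` carries a covariable: `v` is a conclusion other than `d`,
or an active premiss of a cotensor link. -/
def BotCovar (d v : V) : Prop :=
  (P.IsConcl v ∧ v ≠ d) ∨ ∃ l ∈ P.links, ¬ l.IsTensor ∧ (v, Srt.ctx) ∈ l.prems

/-- What the term computation marks as visited: links of the net, and axiom links. -/
inductive Mark (V : Type*) : Type _
  | link (l : Link V)
  | axm (v : V)

/-- The computation of terms, relative to a pairing of the command links with the `μ/μ̃` links.
`Calc k v t W` says that `t` is computed, with visited links `W`, as
* (`k = val`) the value at `v`,
* (`k = ctx`) the context at `v`,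
* (`k = cmd`) a command, possibly extended, started at the command link of `v`.

The bias determines the direction (`μ` or `μ̃`) in which a `μ/μ̃` link is passed, and whether a
command link yields `⟨x ↿ E⟩` or `⟨V ↾ α⟩`. A `μ/μ̃` link can only be followed from a command in which
its (co)variable is free. A cotensor link can be passed when both its active vertices are attached
to the command, that is, when their labels are free in it. The computation may, but need not, pass
all such cotensor links before it follows a `μ/μ̃` link; so the terms computed with the maximal
choice are included. -/
inductive Calc (bias : Atom → Pol) (d : V)
    (pair : {v // P.IsCommand d v} ≃ {v // P.IsMu d v}) :
    (k : Kind) → V → Tm V k → Set (Mark V) → Prop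
  -- atomic values and contexts
  | var {v : V} : P.TopVar v → Calc bias d pair .val v (.var v) ∅
  | covar {v : V} : P.BotCovar d v → Calc bias d pair .ctx v (.covar v) ∅
  | muVar {v : V} : P.IsMu d v → (P.form v).pol bias = .pos →
      Calc bias d pair .val v (.var v) ∅
  | muCovar {v : V} : P.IsMu d v → (P.form v).pol bias = .neg →
      Calc bias d pair .ctx v (.covar v) ∅
  -- tensor links
  | tensorR {m a b : V} {v₁ v₂ W₁ W₂} : ⟨.tensor, .right, m, a, b⟩ ∈ P.links →
      Calc bias d pair .val a v₁ W₁ → Calc bias d pair .val b v₂ W₂ →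
      Calc bias d pair .val m (.tensor v₁ v₂)
        ({.link ⟨.tensor, .right, m, a, b⟩} ∪ W₁ ∪ W₂)
  | oslashR {m a b : V} {v e W₁ W₂} : ⟨.oslash, .right, m, a, b⟩ ∈ P.links →
      Calc bias d pair .val a v W₁ → Calc bias d pair .ctx b e W₂ →
      Calc bias d pair .val m (.oslash v e)
        ({.link ⟨.oslash, .right, m, a, b⟩} ∪ W₁ ∪ W₂)
  | obslashR {m a b : V} {e v W₁ W₂} : ⟨.obslash, .right, m, a, b⟩ ∈ P.links →
      Calc bias d pair .ctx a e W₁ → Calc bias d pair .val b v W₂ →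
      Calc bias d pair .val m (.obslash e v)
        ({.link ⟨.obslash, .right, m, a, b⟩} ∪ W₁ ∪ W₂)
  | plusL {m a b : V} {e₁ e₂ W₁ W₂} : ⟨.plus, .left, m, a, b⟩ ∈ P.links →
      Calc bias d pair .ctx a e₁ W₁ → Calc bias d pair .ctx b e₂ W₂ →
      Calc bias d pair .ctx m (.plus e₁ e₂)
        ({.link ⟨.plus, .left, m, a, b⟩} ∪ W₁ ∪ W₂)
  | ldivL {m a b : V} {v e W₁ W₂} : ⟨.ldiv, .left, m, a, b⟩ ∈ P.links →
      Calc bias d pair .val a v W₁ → Calc bias d pair .ctx b e W₂ →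
      Calc bias d pair .ctx m (.ldiv v e)
        ({.link ⟨.ldiv, .left, m, a, b⟩} ∪ W₁ ∪ W₂)
  | rdivL {m a b : V} {e v W₁ W₂} : ⟨.rdiv, .left, m, a, b⟩ ∈ P.links →
      Calc bias d pair .ctx a e W₁ → Calc bias d pair .val b v W₂ →
      Calc bias d pair .ctx m (.rdiv e v)
        ({.link ⟨.rdiv, .left, m, a, b⟩} ∪ W₁ ∪ W₂)
  -- command links
  | cmdL {v : V} {E W} : P.IsCommand d v → (P.form v).pol bias = .neg →
      Calc bias d pair .ctx v E W →
      Calc bias d pair .cmd v (.cmdL v E) ({.axm v} ∪ W)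
  | cmdR {v : V} {U W} : P.IsCommand d v → (P.form v).pol bias = .pos →
      Calc bias d pair .val v U W →
      Calc bias d pair .cmd v (.cmdR U v) ({.axm v} ∪ W)
  -- cotensor links
  | frac {v : V} {C W} (l : Link V) : l ∈ P.links → ¬ l.IsTensor →
      Calc bias d pair .cmd v C W →
      (l.fst, l.conn.fstSrt) ∈ C.fv → (l.snd, l.conn.sndSrt) ∈ C.fv →
      Calc bias d pair .cmd v (.frac l.conn l.fst l.snd l.main C) ({.link l} ∪ W)
  -- `μ/μ̃` links
  | mu {C W} (c : {v // P.IsCommand d v}) : (P.form (pair c).1).pol bias = .neg →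
      Calc bias d pair .cmd c.1 C W → ((pair c).1, Srt.ctx) ∈ C.fv →
      Calc bias d pair .val (pair c).1 (.mu (pair c).1 C) ({.axm (pair c).1} ∪ W)
  | comu {C W} (c : {v // P.IsCommand d v}) : (P.form (pair c).1).pol bias = .pos →
      Calc bias d pair .cmd c.1 C W → ((pair c).1, Srt.val) ∈ C.fv →
      Calc bias d pair .ctx (pair c).1 (.comu (pair c).1 C) ({.axm (pair c).1} ∪ W)

/-- `v` is a term calculated for the net: the value computed at the designated conclusion `d`, when
all links, all command links and all `μ/μ̃` links have been visited. -/
def Calculated (bias : Atom → Pol) (d : V)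
    (pair : {v // P.IsCommand d v} ≃ {v // P.IsMu d v}) (v : Tm V .val) : Prop :=
  ∃ W : Set (Mark V), P.Calc bias d pair .val d v W ∧ (∀ l ∈ P.links, Mark.link l ∈ W) ∧
    ∀ u, P.IsCommand d u ∨ P.IsMu d u → Mark.axm u ∈ W

end ProofStructure

end LG

/-! A net is read as a graph: each vertex becomes a wire from a source (sort `val`) to a sink (sort
`ctx`), whose two ends are named independently, and each link becomes an item attached to such ends.
A calculated term prescribes how this graph is assembled link by link (`Calc.trav`). In a cut-free
net the assembly is linear: a vertex met twice would produce a cycle in the order in which terms are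
asked for, and a computation that terminates has no such cycle (`Trav.acc`, `Trav.conv`).

The term fixes an order in which cotensor links are passed, while the conversion of the net to a
tree contracts them in an order of its own, mixed with Grishin interactions. The heart of the proof
is that the two orders can be reconciled. `Conv` relates a term to the graphs in which some of its
cotensor links have been contracted, each one inside the graph of the command at which the term
passes it. This relation survives interactions (`Conv.inter`) and contractions (`Conv.contraction`).
So the conversion of the net can be followed step by step (`Conv.steps`) and ends in a graph without
cotensor links that is still related to the same term.

The hard case is a contraction inside a tensor link's operand. The graph of an operand is attached
to the rest at a single end, and a redex that interactions of the whole graph form around one of its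
cotensor links can already be formed inside the operand (`contr_local`). For `⊗` and `⊕`, whose
active vertices have the same sort, interactions never create a redex at all
(`core_pullback_of_eq`). For the other connectives the tensor link of the redex lies on a directed
chain between the two active ends. Traced backwards through an interaction, a chain remains a chain
between the same ends, possibly with more items (`Chain.pullback`), and a chain with both ends in
the operand cannot leave it through a single end (`Chain.local`). A rank function rules out directed
cycles (`Conv.ranked`).

A graph that represents a sequent is that sequent without a chosen display. The display postulates
move the displayed wire and leave the graph alone (`Cut.recut`), the distributivity postulates are
the interactions (`Cut.inter`), and a contraction is an invertible rule. So a related graph without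
cotensor links yields a derivation (`Conv.der`). Its labels are the ends to which no link is
attached (`Conv.ends_eq`), which are the hypotheses and the conclusions other than `d`
(`Trav.mem_label_iff`). -/

namespace LG

variable {Atom V : Type*}

/-! ### Items: wires, tensor links and cotensor links with named ends -/

/-- The opposite sort. -/
def Srt.op : Srt → Srt
  | .val => .ctx
  | .ctx => .val

@[simp] theorem Srt.op_val : Srt.op .val = .ctx := rfl
@[simp] theorem Srt.op_ctx : Srt.op .ctx = .val := rfl
@[simp] theorem Srt.op_op (s : Srt) : s.op.op = s := by cases s <;> rfl
theorem Srt.eq_or_eq_op (s s' : Srt) : s = s' ∨ s = s'.op := by cases s <;> cases s' <;> simp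

/-- A graph is a multiset of items. A wire leads from a source down to a sink; sources and sinks are
named independently. `fuse x y m` and `split m v w` are tensor links, from the sinks `x`, `y` to
the source `m` and from the sink `m` to the sources `v`, `w`. `cot c m a b` is a cotensor link of
the connective `c` with main vertex `m` and active vertices `a`, `b`. -/
inductive Item (V : Type*) : Type _
  | wire (s p : V)
  | fuse (x y m : V)
  | split (m v w : V)
  | cot (c : Conn) (m a b : V)

namespace Item

/-- The two ends of a wire: a source is of sort `val`, a sink of sort `ctx`. -/
def ends : Item V → Multiset (V × Srt)
  | wire s p => {(s, .val)} + {(p, .ctx)}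
  | _ => 0

/-- The ends of wires to which a link is attached. -/
def ports : Item V → Multiset (V × Srt)
  | wire _ _ => 0
  | fuse x y m => {(x, .ctx)} + {(y, .ctx)} + {(m, .val)}
  | split m v w => {(m, .ctx)} + {(v, .val)} + {(w, .val)}
  | cot c m a b => {(a, c.fstSrt)} + {(b, c.sndSrt)} + {(m, c.srt.op)}

/-- The tensor link of a connective. -/
def ten : Conn → V → V → V → Item V
  | .tensor, m, a, b => fuse a b m
  | .oslash, m, a, b => split a m b
  | .obslash, m, a, b => split b a m
  | .plus, m, a, b => split m a b
  | .ldiv, m, a, b => fuse a m b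
  | .rdiv, m, a, b => fuse m b a

/-- The wire with an end `q` of sort `s` and the other end `a`. -/
def wireS : Srt → V → V → Item V
  | .val, q, a => wire q a
  | .ctx, q, a => wire a q

theorem ports_wire (s p : V) : (wire s p).ports = 0 := rfl

theorem ends_wire (s p : V) : (wire s p).ends = {(s, .val)} + {(p, .ctx)} := rfl

theorem ports_cot (c : Conn) (m a b : V) :
    (cot c m a b).ports = {(a, c.fstSrt)} + {(b, c.sndSrt)} + {(m, c.srt.op)} := rfl

theorem ends_cot (c : Conn) (m a b : V) : (cot c m a b).ends = 0 := rfl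

theorem ports_ten (c : Conn) (m a b : V) :
    (ten c m a b).ports = {(a, c.fstSrt.op)} + {(b, c.sndSrt.op)} + {(m, c.srt)} := by
  cases c <;> simp only [ten, ports, Conn.fstSrt, Conn.sndSrt, Conn.srt, Srt.op] <;>
    abel

theorem ends_ten (c : Conn) (m a b : V) : (ten c m a b).ends = 0 := by
  cases c <;> rfl

theorem ends_wireS (s : Srt) (q a : V) : (wireS s q a).ends = {(q, s)} + {(a, s.op)} := by
  cases s
  · rfl
  · exact add_comm _ _

theorem ports_wireS (s : Srt) (q a : V) : (wireS s q a).ports = 0 := by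
  cases s <;> rfl

theorem wireS_op (s : Srt) (q a : V) : wireS s.op q a = wireS s a q := by
  cases s <;> rfl

theorem wireS_self (s : Srt) (q : V) : wireS s q q = wire q q := by
  cases s <;> rfl

theorem ten_ne_wire (c : Conn) (m a b s p : V) : ten c m a b ≠ wire s p := by
  cases c <;> simp [ten]

theorem ten_ne_wireS (c : Conn) (m a b : V) (t : Srt) (s p : V) : ten c m a b ≠ wireS t s p := by
  cases c <;> cases t <;> simp [ten, wireS]

theorem ten_ne_cot (c c' : Conn) (m a b m' a' b' : V) : ten c m a b ≠ cot c' m' a' b' := by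
  cases c <;> simp [ten]

theorem cot_ne_wireS (c : Conn) (m a b : V) (t : Srt) (s p : V) : cot c m a b ≠ wireS t s p := by
  cases t <;> simp [wireS]

theorem wireS_inj {t : Srt} {s p s' p' : V} (h : wireS t s p = wireS t s' p') : s = s' ∧ p = p' := by
  cases t <;> simp [wireS] at h <;> tauto

/-- An end of a wire determines the wire, given the other end. -/
theorem eq_wireS_of_mem_ends {N : Item V} {x : V} {s : Srt} (h : (x, s) ∈ N.ends) :
    ∃ y, N = wireS s x y := by
  cases N with
  | wire a b =>
    simp [ends] at h
    rcases h with ⟨rfl, rfl⟩ | ⟨rfl, rfl⟩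
    · exact ⟨b, rfl⟩
    · exact ⟨a, rfl⟩
  | _ => simp [ends] at h

end Item

open Item

/-! ### Ends, attachments and well-formed graphs -/

/-- All ends of wires of a graph. -/
def ends (G : Multiset (Item V)) : Multiset (V × Srt) := G.bind Item.ends

/-- All attachments of links of a graph. -/
def ports (G : Multiset (Item V)) : Multiset (V × Srt) := G.bind Item.ports

@[simp] theorem ends_add (G H : Multiset (Item V)) : ends (G + H) = ends G + ends H :=
  Multiset.add_bind _ _ _
@[simp] theorem ports_add (G H : Multiset (Item V)) : ports (G + H) = ports G + ports H :=
  Multiset.add_bind _ _ _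
@[simp] theorem ends_singleton (N : Item V) : ends {N} = N.ends := Multiset.singleton_bind _ _
@[simp] theorem ports_singleton (N : Item V) : ports {N} = N.ports := Multiset.singleton_bind _ _

@[simp] theorem ends_cons (N : Item V) (G : Multiset (Item V)) :
    ends (N ::ₘ G) = N.ends + ends G := Multiset.cons_bind _ _ _
theorem mem_ends {G : Multiset (Item V)} {x} : x ∈ ends G ↔ ∃ N ∈ G, x ∈ N.ends :=
  Multiset.mem_bind
theorem mem_ports {G : Multiset (Item V)} {x} : x ∈ ports G ↔ ∃ N ∈ G, x ∈ N.ports :=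
  Multiset.mem_bind

theorem exists_eq_singleton_add {α : Type*} {a : α} {s : Multiset α} (h : a ∈ s) :
    ∃ t, s = {a} + t := by
  obtain ⟨t, rfl⟩ := Multiset.exists_cons_of_mem h
  exact ⟨t, (Multiset.singleton_add _ _).symm⟩

theorem not_mem_of_nodup_add {α : Type*} {s t : Multiset α} (h : (s + t).Nodup) {a : α}
    (ha : a ∈ s) : a ∉ t := fun hb =>
  Multiset.disjoint_left.1 (Multiset.nodup_add.1 h).2.2 ha hb

/-- Two different members would contribute `x` twice. Identifying items by a common end or a common
port rests on this. -/
theorem eq_of_mem_bind_nodup {α β : Type*} {f : α → Multiset β} {s : Multiset α}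
    (h : (s.bind f).Nodup) {a b : α} (ha : a ∈ s) (hb : b ∈ s) {x : β} (hxa : x ∈ f a)
    (hxb : x ∈ f b) : a = b := by
  by_contra hne
  obtain ⟨t, rfl⟩ := Multiset.exists_cons_of_mem ha
  rw [Multiset.cons_bind] at h
  have hb' : b ∈ t := by
    rcases Multiset.mem_cons.1 hb with h | h
    · exact absurd h.symm hne
    · exact h
  exact not_mem_of_nodup_add h hxa (Multiset.mem_bind.2 ⟨b, hb', hxb⟩)

/-- Distinct wires have distinct ends, and every link is attached to ends of wires, distinct links
to distinct ends. -/
structure Good (G : Multiset (Item V)) : Prop where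
  nodup : (ends G).Nodup
  le : ports G ≤ ends G

namespace Good

variable {G : Multiset (Item V)}

theorem ports_nodup (h : Good G) : (ports G).Nodup := Multiset.nodup_of_le h.le h.nodup

theorem eq_of_port (h : Good G) {N N' : Item V} (hN : N ∈ G) (hN' : N' ∈ G) {x}
    (hx : x ∈ N.ports) (hx' : x ∈ N'.ports) : N = N' :=
  eq_of_mem_bind_nodup h.ports_nodup hN hN' hx hx'

theorem eq_of_end (h : Good G) {N N' : Item V} (hN : N ∈ G) (hN' : N' ∈ G) {x}
    (hx : x ∈ N.ends) (hx' : x ∈ N'.ends) : N = N' :=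
  eq_of_mem_bind_nodup h.nodup hN hN' hx hx'

theorem exists_wireS (h : Good G) {x : V} {s : Srt} (hx : (x, s) ∈ ports G) :
    ∃ y, wireS s x y ∈ G := by
  obtain ⟨N, hN, hx⟩ := mem_ends.1 (Multiset.mem_of_le h.le hx)
  obtain ⟨y, rfl⟩ := eq_wireS_of_mem_ends hx
  exact ⟨y, hN⟩

end Good

/-! ### Grishin interactions on graphs -/

/-- The four pairs that may replace `fuse x y m` and `split m' v w`, where a wire leads from `m`
to `m'`. -/
inductive Swap (x y m m' v w : V) : Item V → Item V → Prop
  | g₁ : Swap x y m m' v w (split x v m) (fuse m' y w)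
  | g₂ : Swap x y m m' v w (split x m w) (fuse m' y v)
  | g₃ : Swap x y m m' v w (split y m w) (fuse x m' v)
  | g₄ : Swap x y m m' v w (split y v m) (fuse x m' w)

/-- A Grishin interaction. -/
inductive Inter : Multiset (Item V) → Multiset (Item V) → Prop
  | mk {x y m m' v w : V} {S M : Item V} (G : Multiset (Item V)) : Swap x y m m' v w S M →
      Inter ({fuse x y m} + {wire m m'} + {split m' v w} + G) ({S} + {wire m m'} + {M} + G)

/-- Sequences of Grishin interactions. -/
abbrev Inters (G H : Multiset (Item V)) : Prop := Relation.ReflTransGen Inter G H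

/-- The same six attachments are merely redistributed over the two links. With `Swap.ends_eq` this
makes `ends` and `ports` invariant under interactions, so `Good` persists. -/
theorem Swap.ports_eq {x y m m' v w : V} {S M : Item V} (h : Swap x y m m' v w S M) :
    S.ports + M.ports = (fuse x y m).ports + (split m' v w).ports := by
  cases h <;> simp only [Item.ports] <;> abel

theorem Swap.ends_eq {x y m m' v w : V} {S M : Item V} (h : Swap x y m m' v w S M) :
    S.ends = 0 ∧ M.ends = 0 := by
  cases h <;> exact ⟨rfl, rfl⟩

theorem Inter.ends_eq {G H : Multiset (Item V)} (h : Inter G H) : ends H = ends G := by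
  cases h with
  | mk G h => simp only [ends_add, ends_singleton, h.ends_eq.1, h.ends_eq.2]; rfl

theorem Inter.ports_eq {G H : Multiset (Item V)} (h : Inter G H) : ports H = ports G := by
  cases h with
  | @mk _ _ _ _ _ _ S _ G h =>
    have := h.ports_eq
    simp only [ports_add, ports_singleton]
    rw [add_right_comm S.ports, this]
    abel

theorem Inters.ends_eq {G H : Multiset (Item V)} (h : Inters G H) : ends H = ends G := by
  induction h with
  | refl => rfl
  | tail _ h ih => rw [h.ends_eq, ih]

theorem Inters.ports_eq {G H : Multiset (Item V)} (h : Inters G H) : ports H = ports G := by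
  induction h with
  | refl => rfl
  | tail _ h ih => rw [h.ports_eq, ih]

theorem Inter.good {G H : Multiset (Item V)} (h : Inter G H) (hG : Good G) : Good H :=
  ⟨h.ends_eq ▸ hG.1, by rw [h.ends_eq, h.ports_eq]; exact hG.2⟩

theorem Inters.good {G H : Multiset (Item V)} (h : Inters G H) (hG : Good G) : Good H :=
  ⟨h.ends_eq ▸ hG.1, by rw [h.ends_eq, h.ports_eq]; exact hG.2⟩

theorem Inter.add_right {G H : Multiset (Item V)} (h : Inter G H) (K : Multiset (Item V)) :
    Inter (G + K) (H + K) := by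
  cases h with
  | mk G h => simpa only [add_assoc] using Inter.mk (G + K) h

theorem Inter.add_left {G H : Multiset (Item V)} (h : Inter G H) (K : Multiset (Item V)) :
    Inter (K + G) (K + H) := by
  rw [add_comm K, add_comm K]; exact h.add_right K

theorem Inters.add_right {G H : Multiset (Item V)} (h : Inters G H) (K : Multiset (Item V)) :
    Inters (G + K) (H + K) :=
  Relation.ReflTransGen.lift (· + K) (fun _ _ h => Inter.add_right h K) _ _ h

theorem Inters.add_left {G H : Multiset (Item V)} (h : Inters G H) (K : Multiset (Item V)) :
    Inters (K + G) (K + H) := by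
  rw [add_comm K, add_comm K]; exact h.add_right K

theorem Swap.ne {x y m m' v w : V} {S M : Item V} (h : Swap x y m m' v w S M) :
    (∀ s p, S ≠ wire s p) ∧ (∀ s p, M ≠ wire s p) ∧ S ≠ M ∧ (∀ c m a b, S ≠ cot c m a b) ∧
      (∀ c m a b, M ≠ cot c m a b) := by
  cases h <;> simp

/-- In all four replacements the internal wire still leads from a conclusion of `S` to a premiss of
`M`. So both of its ends stay attached to tensor links, never to a cotensor link. -/
theorem Swap.mem_ports {x y m m' v w : V} {S M : Item V} (h : Swap x y m m' v w S M) :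
    (m, .val) ∈ S.ports ∧ (m', .ctx) ∈ M.ports := by
  cases h <;> simp [Item.ports]

/-- Interactions leave the cotensor links alone. -/
theorem Inter.cot_mem_iff {G H : Multiset (Item V)} (h : Inter G H) (c : Conn) (m a b : V) :
    cot c m a b ∈ G ↔ cot c m a b ∈ H := by
  cases h with
  | mk G h =>
    have h1 := (h.ne.2.2.2.1 c m a b).symm
    have h2 := (h.ne.2.2.2.2 c m a b).symm
    simp [h1, h2]

theorem Inters.cot_mem_iff {G H : Multiset (Item V)} (h : Inters G H) (c : Conn) (m a b : V) :
    cot c m a b ∈ G ↔ cot c m a b ∈ H := by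
  induction h with
  | refl => rfl
  | tail _ h ih => rw [ih, h.cot_mem_iff]

/-- An item takes no part in interactions with `G`: it is a cotensor link, or a wire one of whose
ends is not attached to a tensor link of `G`. -/
def Inert (N : Item V) (G : Multiset (Item V)) : Prop :=
  (∃ c m a b, N = cot c m a b) ∨
    ∃ s q a, N = wireS s q a ∧ ∀ M ∈ G, (∀ c m a b, M ≠ cot c m a b) → (q, s) ∉ M.ports

/-- An interaction uses two tensor links and a wire both of whose ends they occupy, so an inert item
lies in the untouched context. It stays inert because the new links have the same ports as the old
ones. -/
theorem Inter.of_inert {N : Item V} {G H : Multiset (Item V)} (h : Inter ({N} + G) H)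
    (hN : Inert N G) : ∃ H', H = {N} + H' ∧ Inter G H' ∧ Inert N H' := by
  generalize hK : {N} + G = K at h
  cases h with
  | @mk x y m m' v w S M K h =>
    have key : N ∈ K := by
      have hmem : N ∈ {fuse x y m} + {wire m m'} + {split m' v w} + K := by rw [← hK]; simp
      simp only [Multiset.mem_add, Multiset.mem_singleton] at hmem
      rcases hmem with ((hm | hm) | hm) | hm
      · rcases hN with ⟨_, _, _, _, rfl⟩ | ⟨s, _, _, rfl, _⟩
        · simp at hm
        · cases s <;> simp [wireS] at hm
      · rcases hN with ⟨_, _, _, _, rfl⟩ | ⟨s, q, a, rfl, hq⟩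
        · simp at hm
        · exfalso
          have hG : G = {fuse x y m} + {split m' v w} + K := by
            apply Multiset.add_right_inj (s := {wireS s q a}) |>.1
            rw [hK, hm]; abel
          cases s with
          | val =>
            simp [wireS] at hm
            exact hq (fuse x y m) (by simp [hG]) (by simp) (by simp [Item.ports, hm.1])
          | ctx =>
            simp [wireS] at hm
            exact hq (split m' v w) (by simp [hG]) (by simp) (by simp [Item.ports, hm.2])
      · rcases hN with ⟨_, _, _, _, rfl⟩ | ⟨s, _, _, rfl, _⟩
        · simp at hm
        · cases s <;> simp [wireS] at hm
      · exact hm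
    obtain ⟨K', rfl⟩ := exists_eq_singleton_add key
    have hG : G = {fuse x y m} + {wire m m'} + {split m' v w} + K' := by
      apply Multiset.add_right_inj (s := {N}) |>.1
      rw [hK]; abel
    refine ⟨{S} + {wire m m'} + {M} + K', by abel, hG ▸ Inter.mk K' h, ?_⟩
    rcases hN with hN | ⟨s, q, a, rfl, hq⟩
    · exact .inl hN
    · refine .inr ⟨s, q, a, rfl, fun L hL hc hx => ?_⟩
      subst hG
      have h1 := hq (fuse x y m) (by simp) (by simp)
      have h2 := hq (split m' v w) (by simp) (by simp)
      have h3 : (q, s) ∉ S.ports + M.ports := by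
        rw [h.ports_eq]; simp only [Multiset.mem_add, not_or]; exact ⟨h1, h2⟩
      simp only [Multiset.mem_add, not_or] at h3
      simp only [Multiset.mem_add, Multiset.mem_singleton] at hL
      rcases hL with ((rfl | rfl) | rfl) | hL
      · exact h3.1 hx
      · simp [Item.ports] at hx
      · exact h3.2 hx
      · exact hq L (by simp [hL]) hc hx

theorem Inters.of_inert {N : Item V} {G H : Multiset (Item V)} (h : Inters ({N} + G) H)
    (hN : Inert N G) : ∃ H', H = {N} + H' ∧ Inters G H' ∧ Inert N H' := by
  induction h with
  | refl => exact ⟨G, rfl, .refl, hN⟩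
  | tail _ h ih =>
    obtain ⟨H', rfl, h1, h2⟩ := ih
    obtain ⟨H'', rfl, h3, h4⟩ := h.of_inert h2
    exact ⟨H'', rfl, h1.tail h3, h4⟩


/-! ### Chains of tensor links -/

/-- `Node N p q`: the tensor link `N` can be passed downwards from its premiss `p` to its
conclusion `q`. -/
inductive Node : Item V → V → V → Prop
  | fuse_left (x y m : V) : Node (fuse x y m) x m
  | fuse_right (x y m : V) : Node (fuse x y m) y m
  | split_left (m v w : V) : Node (split m v w) m v
  | split_right (m v w : V) : Node (split m v w) m w

theorem Node.mem_ports {N : Item V} {p q : V} (h : Node N p q) :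
    (p, .ctx) ∈ N.ports ∧ (q, .val) ∈ N.ports := by
  cases h <;> simp [Item.ports]

theorem Node.ne_wire {N : Item V} {p q : V} (h : Node N p q) (a b : V) : N ≠ wire a b := by
  cases h <;> simp

theorem Node.ne_cot {N : Item V} {p q : V} (h : Node N p q) (c : Conn) (m a b : V) :
    N ≠ cot c m a b := by
  cases h <;> simp

/-- Directed chains from a source down to a sink. -/
inductive Chain : V → V → Multiset (Item V) → Prop
  | nil (q j : V) : Chain q j {wire q j}
  | cons {q p q' j : V} {N : Item V} {C : Multiset (Item V)} : Node N p q' → Chain q' j C →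
      Chain q j ({wire q p} + {N} + C)

/-- A function that is constant on wires and increases from the premisses to the conclusions of
tensor links. It excludes directed cycles. -/
def Ranked (f : V × Srt → ℤ) (G : Multiset (Item V)) : Prop :=
  ∀ N ∈ G, (∀ s p, N = wire s p → f (s, .val) = f (p, .ctx)) ∧
    ∀ p q, Node N p q → f (p, .ctx) < f (q, .val)

theorem Ranked.mono {f : V × Srt → ℤ} {G H : Multiset (Item V)} (h : Ranked f H) (hG : G ≤ H) :
    Ranked f G := fun N hN => h N (Multiset.mem_of_le hG hN)

theorem Ranked.add {f : V × Srt → ℤ} {G H : Multiset (Item V)} (hG : Ranked f G)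
    (hH : Ranked f H) : Ranked f (G + H) := fun N hN =>
  (Multiset.mem_add.1 hN).elim (hG N) (hH N)

theorem Swap.node_fst {x y m m' v w p q : V} {S M : Item V} (h : Swap x y m m' v w S M)
    (hn : Node S p q) : (p = x ∨ p = y) ∧ (q = m ∨ q = v ∨ q = w) := by
  cases h <;> cases hn <;> simp

theorem Swap.node_snd {x y m m' v w p q : V} {S M : Item V} (h : Swap x y m m' v w S M)
    (hn : Node M p q) : (p = m' ∨ p = x ∨ p = y) ∧ (q = v ∨ q = w) := by
  cases h <;> cases hn <;> simp

theorem Swap.rank {x y m m' v w : V} {S M : Item V} (_h : Swap x y m m' v w S M)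
    {f : V × Srt → ℤ} {G : Multiset (Item V)}
    (hf : Ranked f ({fuse x y m} + {wire m m'} + {split m' v w} + G)) :
    f (x, .ctx) < f (m, .val) ∧ f (y, .ctx) < f (m, .val) ∧ f (m, .val) = f (m', .ctx) ∧
      f (m', .ctx) < f (v, .val) ∧ f (m', .ctx) < f (w, .val) := by
  have h1 := (hf (fuse x y m) (by simp)).2
  have h2 := (hf (wire m m') (by simp)).1
  have h3 := (hf (split m' v w) (by simp)).2
  exact ⟨h1 _ _ (.fuse_left _ _ _), h1 _ _ (.fuse_right _ _ _), h2 _ _ rfl,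
    h3 _ _ (.split_left _ _ _), h3 _ _ (.split_right _ _ _)⟩

/-- The old ranks still work: `x` and `y` lie strictly below the internal wire, `v` and `w` strictly
above it, and every passage through a new link goes upwards in this order. -/
theorem Inter.ranked {f : V × Srt → ℤ} {G H : Multiset (Item V)} (h : Inter G H)
    (hf : Ranked f G) : Ranked f H := by
  cases h with
  | @mk x y m m' v w S M G h =>
    obtain ⟨h1, h2, h3, h4, h5⟩ := h.rank hf
    intro N hN
    simp only [Multiset.mem_add, Multiset.mem_singleton] at hN
    rcases hN with ((rfl | rfl) | rfl) | hN
    · refine ⟨fun s p e => absurd e (h.ne.1 s p), fun p q hn => ?_⟩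
      rcases h.node_fst hn with ⟨rfl | rfl, rfl | rfl | rfl⟩ <;> omega
    · exact hf _ (by simp)
    · refine ⟨fun s p e => absurd e (h.ne.2.1 s p), fun p q hn => ?_⟩
      rcases h.node_snd hn with ⟨rfl | rfl | rfl, rfl | rfl⟩ <;> omega
    · exact hf _ (by simp [hN])

theorem Inters.ranked {f : V × Srt → ℤ} {G H : Multiset (Item V)} (h : Inters G H)
    (hf : Ranked f G) : Ranked f H := by
  induction h with
  | refl => exact hf
  | tail _ h ih => exact h.ranked ih

/-- Along a chain the rank does not fall below its value at the start. -/
theorem Chain.rank_le {f : V × Srt → ℤ} {q j : V} {C : Multiset (Item V)} (h : Chain q j C)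
    (hf : Ranked f C) : ∀ N ∈ C, (∃ p q', Node N p q' ∧ f (q, .val) ≤ f (p, .ctx)) ∨
      ∃ s p, N = wire s p ∧ f (q, .val) ≤ f (s, .val) := by
  induction h with
  | nil q j =>
    intro N hN
    exact .inr ⟨q, j, Multiset.mem_singleton.1 hN, le_rfl⟩
  | @cons q p q' j N₀ C hn hc ih =>
    intro N hN
    have h1 := (hf (wire q p) (by simp)).1 _ _ rfl
    have h2 := (hf N₀ (by simp)).2 _ _ hn
    simp only [Multiset.mem_add, Multiset.mem_singleton] at hN
    rcases hN with (rfl | rfl) | hN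
    · exact .inr ⟨_, _, rfl, le_rfl⟩
    · exact .inl ⟨_, _, hn, h1.le⟩
    · rcases ih (hf.mono (Multiset.le_add_left _ _)) N hN with ⟨p', q'', h3, h4⟩ | ⟨s, p', h3, h4⟩
      · exact .inl ⟨p', q'', h3, by omega⟩
      · exact .inr ⟨s, p', h3, by omega⟩

theorem Swap.node_left {x y m p : V} (hp : p = x ∨ p = y) : Node (fuse x y m) p m := by
  rcases hp with rfl | rfl
  · exact .fuse_left _ _ _
  · exact .fuse_right _ _ _

theorem Swap.node_right {m v w q : V} (hq : q = v ∨ q = w) : Node (split m v w) m q := by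
  rcases hq with rfl | rfl
  · exact .split_left _ _ _
  · exact .split_right _ _ _

theorem eq_of_mem_port_of_nodup {G : Multiset (Item V)} (h : (ports G).Nodup) {N N' : Item V}
    (hN : N ∈ G) (hN' : N' ∈ G) {x} (hx : x ∈ N.ports) (hx' : x ∈ N'.ports) : N = N' :=
  eq_of_mem_bind_nodup h hN hN' hx hx'

/-- A chain in the result of an interaction comes from a chain in the original graph: either the
interaction takes place off the chain, or it takes place on the chain, and some of its items leave
the chain. -/
theorem Chain.pullback {x y m m' v w : V} {S M : Item V} (hs : Swap x y m m' v w S M)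
    {f : V × Srt → ℤ} {q j : V} {C' : Multiset (Item V)} (hc : Chain q j C') :
    ∀ {G Z' : Multiset (Item V)}, {S} + {wire m m'} + {M} + G = C' + Z' →
      (ports ({S} + {wire m m'} + {M} + G)).Nodup → (ends ({S} + {wire m m'} + {M} + G)).Nodup →
      Ranked f ({fuse x y m} + {wire m m'} + {split m' v w} + G) → q ≠ m → j ≠ m' →
      ∃ C, Chain q j C ∧
        ((C = C' ∧ ∃ Z, {fuse x y m} + {wire m m'} + {split m' v w} + G = C + Z ∧ Inter Z Z') ∨
          ∃ Y Z, {fuse x y m} + {wire m m'} + {split m' v w} + G = C + Z ∧ Inter C (C' + Y) ∧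
            Z' = Y + Z) := by
  induction hc with
  | nil q j =>
    intro G Z' he hp hends hf hq hj
    have hmem : wire q j ∈ {S} + {wire m m'} + {M} + G := by rw [he]; simp
    simp only [Multiset.mem_add, Multiset.mem_singleton] at hmem
    rcases hmem with ((h | h) | h) | h
    · exact absurd h.symm (hs.ne.1 _ _)
    · simp [hq] at h
    · exact absurd h.symm (hs.ne.2.1 _ _)
    · obtain ⟨G, rfl⟩ := exists_eq_singleton_add h
      have hZ : Z' = {S} + {wire m m'} + {M} + G := by
        apply Multiset.add_right_inj (s := {wire q j}) |>.1
        rw [← he]; abel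
      exact ⟨_, .nil q j, .inl ⟨rfl, _, by abel, hZ ▸ Inter.mk G hs⟩⟩
  | @cons q p q' j N C₁ hn hc ih =>
    intro G Z' he hp hends hf hq hj
    have hmem : wire q p ∈ {S} + {wire m m'} + {M} + G := by rw [he]; simp
    have hmem' : N ∈ {S} + {wire m m'} + {M} + G := by rw [he]; simp
    obtain ⟨r1, r2, r3, r4, r5⟩ := hs.rank hf
    have hf' := (Inter.mk G hs).ranked hf
    have hf₁ : Ranked f C₁ := hf'.mono (by
      rw [he, add_assoc _ C₁]; exact (Multiset.le_add_right _ _).trans (Multiset.le_add_left _ _))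
    -- items of rank at most that of the interaction cannot occur later on the chain
    have hlow : ∀ N', (N' = S ∨ N' = wire m m' ∨ N' = M) → (q' = v ∨ q' = w) → N' ∉ C₁ := by
      intro N' hN' hq' hmem
      have hr : f (m, .val) < f (q', .val) := by rcases hq' with rfl | rfl <;> omega
      rcases hc.rank_le hf₁ N' hmem with ⟨p', q'', h1, h2⟩ | ⟨s, p', h1, h2⟩
      · rcases hN' with rfl | rfl | rfl
        · rcases (hs.node_fst h1).1 with rfl | rfl <;> omega
        · exact h1.ne_wire _ _ rfl
        · rcases (hs.node_snd h1).1 with rfl | rfl | rfl <;> omega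
      · rcases hN' with rfl | rfl | rfl
        · exact hs.ne.1 _ _ h1
        · simp at h1; rw [← h1.1] at h2; omega
        · exact hs.ne.2.1 _ _ h1
    simp only [Multiset.mem_add, Multiset.mem_singleton] at hmem
    rcases hmem with ((h | h) | h) | h
    · exact absurd h.symm (hs.ne.1 _ _)
    · simp [hq] at h
    · exact absurd h.symm (hs.ne.2.1 _ _)
    obtain ⟨G, rfl⟩ := exists_eq_singleton_add h
    have he₁ : {S} + {wire m m'} + {M} + G = {N} + C₁ + Z' := by
      apply Multiset.add_right_inj (s := {wire q p}) |>.1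
      calc _ = {S} + {wire m m'} + {M} + ({wire q p} + G) := by abel
        _ = _ := by rw [he]; abel
    by_cases hNS : N = S
    · subst hNS
      have hpx := (hs.node_fst hn).1
      have he₂ : {wire m m'} + {M} + G = C₁ + Z' := by
        apply Multiset.add_right_inj (s := {N}) |>.1
        rw [← add_assoc {N} C₁, ← he₁]; abel
      by_cases hq' : q' = m
      · subst hq'
        -- the chain passes both links
        have hfst : ∀ p', wire q' p' ∈ C₁ → p' = m' := by
          intro p' h'
          have h1 : wire q' p' ∈ {N} + {wire q' m'} + {M} + ({wire q p} + G) := by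
            rw [he]; simp [h']
          have := eq_of_mem_bind_nodup hends h1 (b := wire q' m') (by simp) (x := (q', .val))
            (by simp [Item.ends]) (by simp [Item.ends])
          simpa using this
        cases hc with
        | nil => exact absurd (hfst j (by simp)) hj
        | @cons _ p₁ q₁ _ N₁ C₂ hn₁ hc₂ =>
          obtain rfl := hfst p₁ (by simp)
          have hNM : N₁ = M := by
            refine eq_of_mem_port_of_nodup hp (x := (p₁, .ctx)) ?_ (by simp) hn₁.mem_ports.1
              hs.mem_ports.2
            rw [he]; simp
          subst hNM
          have hG : G = C₂ + Z' := by
            apply Multiset.add_right_inj (s := {wire q' p₁} + {N₁}) |>.1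
            rw [he₂]; abel
          subst hG
          refine ⟨{wire q p} + {fuse x y q'} + ({wire q' p₁} + {split p₁ v w} + C₂),
            .cons (Swap.node_left hpx) (.cons (Swap.node_right (hs.node_snd hn₁).2) hc₂),
            .inr ⟨0, Z', by abel, ?_, by simp⟩⟩
          have := Inter.mk ({wire q p} + C₂) hs
          convert this using 1 <;> abel
      -- The chain leaves `S` directly at `v` or `w`. Its preimage is longer: it runs through the
      -- `fuse`, the internal wire and the `split`. The internal wire and `M` are what the
      -- interaction throws off, and they form `Y`.
      · have hq'' : q' = v ∨ q' = w := by
          rcases (hs.node_fst hn).2 with h | h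
          · exact absurd h hq'
          · exact h
        have hW : wire m m' ∈ C₁ + Z' := by rw [← he₂]; simp
        have hM : M ∈ C₁ + Z' := by rw [← he₂]; simp
        have hW' := (Multiset.mem_add.1 hW).resolve_left (hlow _ (by simp) hq'')
        have hM' := (Multiset.mem_add.1 hM).resolve_left (hlow _ (by simp) hq'')
        obtain ⟨Z₁, rfl⟩ := exists_eq_singleton_add hW'
        have hM'' : M ∈ Z₁ := by
          simpa [hs.ne.2.1] using hM'
        obtain ⟨Z, rfl⟩ := exists_eq_singleton_add hM''
        have hG : G = C₁ + Z := by
          apply Multiset.add_right_inj (s := {wire m m'} + {M}) |>.1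
          rw [he₂]; abel
        subst hG
        refine ⟨{wire q p} + {fuse x y m} + ({wire m m'} + {split m' v w} + C₁),
          .cons (Swap.node_left hpx) (.cons (Swap.node_right hq'') hc),
          .inr ⟨{wire m m'} + {M}, Z, by abel, ?_, by abel⟩⟩
        have := Inter.mk ({wire q p} + C₁) hs
        convert this using 1 <;> abel
    by_cases hNM : N = M
    · subst hNM
      obtain ⟨hpx, hq''⟩ := hs.node_snd hn
      -- The chain cannot enter `M` at `m'`, since the wire into `m'` starts at `m` and the chain
      -- starts elsewhere.
      have hpx : p = x ∨ p = y := by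
        rcases hpx with rfl | h
        · have h1 := eq_of_mem_bind_nodup hends (a := wire q p) (b := wire m p) (by simp) (by simp)
            (x := (p, .ctx)) (by simp [Item.ends]) (by simp [Item.ends])
          simp [hq] at h1
        · exact h
      have he₂ : {S} + {wire m m'} + G = C₁ + Z' := by
        apply Multiset.add_right_inj (s := {N}) |>.1
        rw [← add_assoc {N} C₁, ← he₁]; abel
      have hW : wire m m' ∈ C₁ + Z' := by rw [← he₂]; simp
      have hS : S ∈ C₁ + Z' := by rw [← he₂]; simp
      have hW' := (Multiset.mem_add.1 hW).resolve_left (hlow _ (by simp) hq'')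
      have hS' := (Multiset.mem_add.1 hS).resolve_left (hlow _ (by simp) hq'')
      obtain ⟨Z₁, rfl⟩ := exists_eq_singleton_add hW'
      have hS'' : S ∈ Z₁ := by
        simpa [hs.ne.1] using hS'
      obtain ⟨Z, rfl⟩ := exists_eq_singleton_add hS''
      have hG : G = C₁ + Z := by
        apply Multiset.add_right_inj (s := {S} + {wire m m'}) |>.1
        rw [he₂]; abel
      subst hG
      refine ⟨{wire q p} + {fuse x y m} + ({wire m m'} + {split m' v w} + C₁),
        .cons (Swap.node_left hpx) (.cons (Swap.node_right hq'') hc),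
        .inr ⟨{S} + {wire m m'}, Z, by abel, ?_, by abel⟩⟩
      have := Inter.mk ({wire q p} + C₁) hs
      convert this using 1 <;> abel
    -- the first link of the chain takes no part in the interaction
    have hNG : N ∈ G := by
      simp only [Multiset.mem_add, Multiset.mem_singleton, hNS, hNM, hn.ne_wire, false_or] at hmem'
      exact hmem'
    obtain ⟨G, rfl⟩ := exists_eq_singleton_add hNG
    -- The source `m` is attached to `S`, and `N` is a different link. So the rest of the chain
    -- again does not start at the internal wire, as the induction requires.
    have hq' : q' ≠ m := by
      rintro rfl
      exact hNS (eq_of_mem_port_of_nodup hp hmem' (by simp) hn.mem_ports.2 hs.mem_ports.1)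
    have hle : ∀ A : Multiset (Item V), A + G ≤ A + ({wire q p} + ({N} + G)) := fun A => by
      gcongr
      rw [← add_assoc]
      exact Multiset.le_add_left _ _
    have hle' := hle ({S} + {wire m m'} + {M})
    obtain ⟨K, hK⟩ := Multiset.le_iff_exists_add.1 hle'
    rw [hK, ports_add] at hp
    rw [hK, ends_add] at hends
    obtain ⟨C, hC, h⟩ := ih (G := G) (Z' := Z') (by
        apply Multiset.add_right_inj (s := {N}) |>.1
        rw [← add_assoc {N} C₁, ← he₁]; abel)
      (Multiset.nodup_add.1 hp).1 (Multiset.nodup_add.1 hends).1 (hf.mono (hle _)) hq' hj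
    refine ⟨_, .cons hn hC, ?_⟩
    have hadd : ∀ A : Multiset (Item V), A + ({wire q p} + ({N} + G)) =
      {wire q p} + {N} + (A + G) := fun A => by abel
    rcases h with ⟨rfl, Z, h1, h2⟩ | ⟨Y, Z, h1, h2, h3⟩
    · exact .inl ⟨rfl, Z, by rw [hadd, h1]; abel, h2⟩
    · refine .inr ⟨Y, Z, by rw [hadd, h1]; abel, ?_, h3⟩
      rw [add_assoc _ C₁]
      exact h2.add_left _

/-- The sequence is traced from its last interaction to its first, and the items thrown off the
chain collect in `Y`. In this way the interactions on the chain are done first and the others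
afterwards. The ends `q` and `j` belong to a cotensor link, which interactions preserve, so they are
never ends of an internal wire. -/
theorem Chain.pullback_inters {f : V × Srt → ℤ} {c : Conn} {m a b q j : V}
    {C' Z' H : Multiset (Item V)} (hc : Chain q j C') (h : Inters H (C' + Z')) (hH : Good H)
    (hf : Ranked f H) (hcot : cot c m a b ∈ H) (hq : (q, .val) ∈ (cot c m a b).ports)
    (hj : (j, .ctx) ∈ (cot c m a b).ports) :
    ∃ C Z Y, Chain q j C ∧ H = C + Z ∧ Inters C (C' + Y) ∧ Inters (Y + Z) Z' := by
  generalize hK : C' + Z' = K at h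
  induction h using Relation.ReflTransGen.head_induction_on with
  | refl =>
    exact ⟨C', Z', 0, hc, hK.symm, by rw [add_zero], by rw [zero_add]⟩
  | head h h' ih =>
    obtain ⟨C, Z, Y, h1, h2, h3, h4⟩ := ih (h.good hH) (h.ranked hf) ((h.cot_mem_iff _ _ _ _).1 hcot)
    have hH₁ := h.good hH
    have hcot₁ := (h.cot_mem_iff _ _ _ _).1 hcot
    cases h with
    | @mk x y i i' v w S M G hs =>
      have hqi : q ≠ i := by
        rintro rfl
        exact hs.ne.2.2.2.1 _ _ _ _ (hH₁.eq_of_port (by simp) hcot₁ hs.mem_ports.1 hq)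
      have hji : j ≠ i' := by
        rintro rfl
        exact hs.ne.2.2.2.2 _ _ _ _ (hH₁.eq_of_port (by simp) hcot₁ hs.mem_ports.2 hj)
      obtain ⟨C₀, hC₀, h⟩ := h1.pullback hs h2 hH₁.ports_nodup hH₁.nodup hf hqi hji
      rcases h with ⟨rfl, Z₀, h5, h6⟩ | ⟨Y₀, Z₀, h5, h6, h7⟩
      · exact ⟨_, Z₀, Y, hC₀, h5, h3, (Relation.ReflTransGen.single (h6.add_left _)).trans h4⟩
      · subst h7
        refine ⟨_, Z₀, Y + Y₀, hC₀, h5, ?_, ?_⟩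
        · rw [← add_assoc]
          exact (Relation.ReflTransGen.single h6).trans (h3.add_right _)
        · rwa [add_assoc]

/-! ### The tensor part of a contraction -/

/-- The tensor link of the connective `c` with main end `p`, with wires to the active vertices `a`,
`b` of a cotensor link: together with that cotensor link it forms a redex. -/
def core (c : Conn) (p a b a' b' : V) : Multiset (Item V) :=
  {ten c p a' b'} + {wireS c.fstSrt a a'} + {wireS c.sndSrt b b'}

theorem ports_core (c : Conn) (p a b a' b' : V) : ports (core c p a b a' b') =
    {(a', c.fstSrt.op)} + {(b', c.sndSrt.op)} + {(p, c.srt)} := by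
  simp only [core, ports_add, ports_singleton, ports_ten, ports_wireS, add_zero]

theorem ends_core (c : Conn) (p a b a' b' : V) : ends (core c p a b a' b') =
    {(a, c.fstSrt)} + {(a', c.fstSrt.op)} + ({(b, c.sndSrt)} + {(b', c.sndSrt.op)}) := by
  simp only [core, ends_add, ends_singleton, ends_ten, ends_wireS, zero_add]

/-- When the active sorts differ, one active end is a source, the other a sink, and the tensor link
of the redex leads from the first down to the second. For `⊗` and `⊕` there is no such directed
path, which is why they are treated separately. -/
theorem core_eq_chain {c : Conn} (h : c.fstSrt ≠ c.sndSrt) (p a b a' b' m : V) :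
    ∃ q j, Chain q j (core c p a b a' b') ∧ (q, .val) ∈ (cot c m a b).ports ∧
      (j, .ctx) ∈ (cot c m a b).ports := by
  cases c with
  | tensor => simp [Conn.fstSrt, Conn.sndSrt] at h
  | plus => simp [Conn.fstSrt, Conn.sndSrt] at h
  | oslash =>
    refine ⟨a, b, ?_, by simp [Item.ports, Conn.fstSrt], by simp [Item.ports, Conn.sndSrt]⟩
    have := Chain.cons (q := a) (Node.split_right a' p b') (.nil b' b)
    convert this using 1
    simp only [core, ten, wireS, Conn.fstSrt, Conn.sndSrt]; abel
  | obslash =>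
    refine ⟨b, a, ?_, by simp [Item.ports, Conn.sndSrt], by simp [Item.ports, Conn.fstSrt]⟩
    have := Chain.cons (q := b) (Node.split_left b' a' p) (.nil a' a)
    convert this using 1
    simp only [core, ten, wireS, Conn.fstSrt, Conn.sndSrt]; abel
  | ldiv =>
    refine ⟨a, b, ?_, by simp [Item.ports, Conn.fstSrt], by simp [Item.ports, Conn.sndSrt]⟩
    have := Chain.cons (q := a) (Node.fuse_left a' p b') (.nil b' b)
    convert this using 1
    simp only [core, ten, wireS, Conn.fstSrt, Conn.sndSrt]; abel
  | rdiv =>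
    refine ⟨b, a, ?_, by simp [Item.ports, Conn.sndSrt], by simp [Item.ports, Conn.fstSrt]⟩
    have := Chain.cons (q := b) (Node.fuse_right p b' a') (.nil a' a)
    convert this using 1
    simp only [core, ten, wireS, Conn.fstSrt, Conn.sndSrt]; abel

/-- If both active vertices of a cotensor link are of the same sort, then no interaction can bring
them together. -/
theorem core_pullback_of_eq {c : Conn} (hc : c.fstSrt = c.sndSrt) {p a b a' b' m : V}
    {Z' H : Multiset (Item V)} (h : Inter H (core c p a b a' b' + Z')) (hH : Good H)
    (hcot : cot c m a b ∈ H) : ∃ Z, H = core c p a b a' b' + Z ∧ Inter Z Z' := by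
  have hH₁ := h.good hH
  have hcot₁ := (h.cot_mem_iff _ _ _ _).1 hcot
  generalize hK : core c p a b a' b' + Z' = K at h hH₁ hcot₁
  cases h with
  | @mk x y i i' v w S M G hs =>
    -- The active ends carry the cotensor link, while the ends of the internal wire carry the tensor
    -- links `S` and `M`.
    have hsort : ∀ z s, ((z = a ∧ s = c.fstSrt) ∨ (z = b ∧ s = c.sndSrt)) →
        (s = .val → z ≠ i) ∧ (s = .ctx → z ≠ i') := by
      intro z s hz
      have hport : (z, s) ∈ (cot c m a b).ports := by
        rcases hz with ⟨rfl, rfl⟩ | ⟨rfl, rfl⟩ <;> simp [Item.ports]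
      constructor
      · rintro rfl rfl
        exact hs.ne.2.2.2.1 _ _ _ _ (hH₁.eq_of_port (by simp) hcot₁ hs.mem_ports.1 hport)
      · rintro rfl rfl
        exact hs.ne.2.2.2.2 _ _ _ _ (hH₁.eq_of_port (by simp) hcot₁ hs.mem_ports.2 hport)
    have ha := hsort a _ (.inl ⟨rfl, rfl⟩)
    have hb := hsort b _ (.inr ⟨rfl, rfl⟩)
    have hW : wire i i' ∈ {S} + {wire i i'} + {M} + G := by simp
    have hmem : ∀ N ∈ core c p a b a' b', N ∈ {S} + {wire i i'} + {M} + G := fun N hN => by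
      rw [← hK]; exact Multiset.mem_add.2 (.inl hN)
    have h1 := hmem (ten c p a' b') (by simp [core])
    have h2 := hmem (wireS c.fstSrt a a') (by simp [core])
    have h3 := hmem (wireS c.sndSrt b b') (by simp [core])
    -- For `⊗` the only new link of the right shape is `M`. It has the premiss `i'`, and the wire
    -- into `i'` comes from `i`, which would then be an active vertex. For `⊕` the same argument
    -- applies to `S` and the conclusion `i`.
    have key : ten c p a' b' ∈ G ∧ wireS c.fstSrt a a' ∈ G ∧ wireS c.sndSrt b b' ∈ G := by
      have h4 := fun (x : V × Srt) hx hx' => hH₁.eq_of_end h2 hW (x := x) hx hx'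
      have h5 := fun (x : V × Srt) hx hx' => hH₁.eq_of_end h3 hW (x := x) hx hx'
      cases c with
      | tensor =>
        simp only [Conn.fstSrt, Conn.sndSrt, wireS, ten] at *
        have ha' : a' ≠ i' := by
          rintro rfl
          have := h4 (a', .ctx) (by simp [Item.ends]) (by simp [Item.ends])
          simp [ha] at this
        have hb' : b' ≠ i' := by
          rintro rfl
          have := h5 (b', .ctx) (by simp [Item.ends]) (by simp [Item.ends])
          simp [hb] at this
        cases hs <;> simp_all
      | plus =>
        simp only [Conn.fstSrt, Conn.sndSrt, wireS, ten] at *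
        have ha' : a' ≠ i := by
          rintro rfl
          have := h4 (a', .val) (by simp [Item.ends]) (by simp [Item.ends])
          simp [ha] at this
        have hb' : b' ≠ i := by
          rintro rfl
          have := h5 (b', .val) (by simp [Item.ends]) (by simp [Item.ends])
          simp [hb] at this
        cases hs <;> simp_all
      | _ => simp [Conn.fstSrt, Conn.sndSrt] at hc
    have hnd : (core c p a b a' b' : Multiset (Item V)).Nodup := by
      have h6 : (ends (core c p a b a' b')).Nodup := by
        have := hH₁.nodup
        rw [← hK, ends_add] at this
        exact (Multiset.nodup_add.1 this).1
      have h7 : wireS c.fstSrt a a' ≠ wireS c.sndSrt b b' := by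
        intro e
        rw [ends_core] at h6
        rw [← hc] at e h6
        rw [(wireS_inj e).1] at h6
        simp at h6
      simp only [core, Multiset.singleton_add, Multiset.cons_add, Multiset.nodup_cons,
        Multiset.mem_cons, Multiset.mem_singleton, Multiset.nodup_singleton, not_or, and_true]
      exact ⟨⟨ten_ne_wireS _ _ _ _ _ _ _, ten_ne_wireS _ _ _ _ _ _ _⟩, h7⟩
    have hle : core c p a b a' b' ≤ G := by
      rw [Multiset.le_iff_subset hnd]
      intro N hN
      simp only [core, Multiset.mem_add, Multiset.mem_singleton] at hN
      rcases hN with (rfl | rfl) | rfl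
      exacts [key.1, key.2.1, key.2.2]
    obtain ⟨G, rfl⟩ := Multiset.le_iff_exists_add.1 hle
    have hZ : Z' = {S} + {wire i i'} + {M} + G := by
      apply Multiset.add_right_inj (s := core c p a b a' b') |>.1
      rw [hK]; abel
    exact ⟨{fuse x y i} + {wire i i'} + {split i' v w} + G, by abel, hZ ▸ Inter.mk G hs⟩

/-- With equal active sorts the core is present from the start, and nothing is thrown off it. With
different sorts the core is a chain, and `C` is the chain from which it arises. -/
theorem core_pullback {f : V × Srt → ℤ} {c : Conn} {p a b a' b' m : V}
    {Z' H : Multiset (Item V)} (h : Inters H (core c p a b a' b' + Z')) (hH : Good H)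
    (hf : Ranked f H) (hcot : cot c m a b ∈ H) :
    ∃ C Z Y, H = C + Z ∧ Inters C (core c p a b a' b' + Y) ∧ Inters (Y + Z) Z' ∧
      ((C = core c p a b a' b' ∧ c.fstSrt = c.sndSrt) ∨ ∃ q j, Chain q j C ∧
        (q, .val) ∈ (cot c m a b).ports ∧ (j, .ctx) ∈ (cot c m a b).ports) := by
  by_cases hc : c.fstSrt = c.sndSrt
  · have : ∃ Z, H = core c p a b a' b' + Z ∧ Inters Z Z' := by
      clear hf
      generalize hK : core c p a b a' b' + Z' = K at h
      induction h using Relation.ReflTransGen.head_induction_on with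
      | refl => exact ⟨Z', hK.symm, .refl⟩
      | head h h' ih =>
        obtain ⟨Z, rfl, h1⟩ := ih (h.good hH) ((h.cot_mem_iff _ _ _ _).1 hcot)
        obtain ⟨Z₀, rfl, h2⟩ := core_pullback_of_eq hc h hH hcot
        exact ⟨Z₀, rfl, h1.head h2⟩
    obtain ⟨Z, h1, h2⟩ := this
    exact ⟨_, Z, 0, h1, by rw [add_zero], by rwa [zero_add], .inl ⟨rfl, hc⟩⟩
  · obtain ⟨q, j, h1, h2, h3⟩ := core_eq_chain hc p a b a' b' m
    obtain ⟨C, Z, Y, h4, h5, h6, h7⟩ := h1.pullback_inters h hH hf hcot h2 h3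
    exact ⟨C, Z, Y, h5, h6, h7, .inr ⟨q, j, h4, h2, h3⟩⟩

/-! ### Locality -/

theorem Item.exists_mem (N : Item V) : ∃ x, x ∈ N.ends + N.ports := by
  cases N with
  | wire s p => exact ⟨(s, .val), by simp [Item.ends]⟩
  | fuse x y m => exact ⟨(x, .ctx), by simp [Item.ports]⟩
  | split m v w => exact ⟨(m, .ctx), by simp [Item.ports]⟩
  | cot c m a b => exact ⟨(a, c.fstSrt), by simp [Item.ports]⟩

/-- Every item has an end or a port, which a repeated item would repeat. -/
theorem Good.items_nodup {G : Multiset (Item V)} (h : Good G) : G.Nodup := by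
  rw [Multiset.nodup_iff_le]
  intro N hN
  have h1 : {N} + {N} ≤ G := hN
  obtain ⟨K, rfl⟩ := Multiset.le_iff_exists_add.1 h1
  obtain ⟨x, hx⟩ := N.exists_mem
  have h2 := h.nodup
  have h3 := h.ports_nodup
  simp only [ends_add, ports_add, ends_singleton, ports_singleton] at h2 h3
  rcases Multiset.mem_add.1 hx with hx | hx
  · exact not_mem_of_nodup_add (Multiset.nodup_add.1 h2).1 hx hx
  · exact not_mem_of_nodup_add (Multiset.nodup_add.1 h3).1 hx hx

theorem mem_left_of_end {G H : Multiset (Item V)} (h : (ends (G + H)).Nodup) {N : Item V}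
    (hN : N ∈ G + H) {x} (hx : x ∈ N.ends) (hG : x ∈ ends G) : N ∈ G := by
  rcases Multiset.mem_add.1 hN with hN | hN
  · exact hN
  · rw [ends_add] at h
    exact absurd (mem_ends.2 ⟨N, hN, hx⟩) (not_mem_of_nodup_add h hG)

/-- A chain that starts and ends in a part of a graph that is attached to the rest at one end
only lies in that part. -/
theorem Chain.local {G H C : Multiset (Item V)} (hGH : (ends (G + H)).Nodup) (hG : Good G)
    {r : V × Srt} (hr : ∀ x ∈ ports H, x ∈ ends G → x = r) {q j : V} (hc : Chain q j C)
    (hle : ∀ N ∈ C, N ∈ G + H) (hq : (q, .val) ∈ ends G) (hj : (j, .ctx) ∈ ends G) :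
    ∀ N ∈ C, N ∈ G := by
  obtain ⟨r, s⟩ := r
  -- A chain is followed in the direction in which it cannot leave `G`. If the exceptional end is a
  -- source, no link of `H` hangs on a sink of `G`, and the chain is followed downwards from `q`. If
  -- it is a sink, the chain is followed upwards from `j`.
  cases s with
  | val =>
    clear hj
    induction hc with
    | nil q j =>
      intro N hN
      refine mem_left_of_end hGH (hle N hN) ?_ hq
      simp [Multiset.mem_singleton.1 hN, Item.ends]
    | @cons q p q' j N C hn hc ih =>
      have h1 : wire q p ∈ G :=
        mem_left_of_end hGH (hle _ (by simp)) (by simp [Item.ends]) hq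
      have h2 : (p, Srt.ctx) ∈ ends G := mem_ends.2 ⟨_, h1, by simp [Item.ends]⟩
      have h3 : N ∈ G := by
        rcases Multiset.mem_add.1 (hle N (by simp)) with h | h
        · exact h
        · have := hr _ (mem_ports.2 ⟨N, h, hn.mem_ports.1⟩) h2
          simp at this
      have h4 : (q', Srt.val) ∈ ends G :=
        Multiset.mem_of_le hG.le (mem_ports.2 ⟨N, h3, hn.mem_ports.2⟩)
      intro N' hN'
      simp only [Multiset.mem_add, Multiset.mem_singleton] at hN'
      rcases hN' with (rfl | rfl) | hN'
      · exact h1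
      · exact h3
      · exact ih (fun N hN => hle N (by simp [hN])) h4 N' hN'
  | ctx =>
    suffices h : (∀ N ∈ C, N ∈ G) ∧ (q, .val) ∈ ends G from h.1
    clear hq
    induction hc with
    | nil q j =>
      have h : ∀ N ∈ ({wire q j} : Multiset (Item V)), N ∈ G := by
        intro N hN
        refine mem_left_of_end hGH (hle N hN) ?_ hj
        simp [Multiset.mem_singleton.1 hN, Item.ends]
      exact ⟨h, mem_ends.2 ⟨_, h _ (Multiset.mem_singleton_self _), by simp [Item.ends]⟩⟩
    | @cons q p q' j N C hn hc ih =>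
      obtain ⟨h1, h2⟩ := ih (fun N hN => hle N (by simp [hN])) hj
      have h3 : N ∈ G := by
        rcases Multiset.mem_add.1 (hle N (by simp)) with h | h
        · exact h
        · have := hr _ (mem_ports.2 ⟨N, h, hn.mem_ports.2⟩) h2
          simp at this
      have h4 : (p, Srt.ctx) ∈ ends G :=
        Multiset.mem_of_le hG.le (mem_ports.2 ⟨N, h3, hn.mem_ports.1⟩)
      have h5 : wire q p ∈ G :=
        mem_left_of_end hGH (hle _ (by simp)) (by simp [Item.ends]) h4
      refine ⟨fun N' hN' => ?_, mem_ends.2 ⟨_, h5, by simp [Item.ends]⟩⟩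
      simp only [Multiset.mem_add, Multiset.mem_singleton] at hN'
      rcases hN' with (rfl | rfl) | hN'
      · exact h5
      · exact h3
      · exact h1 N' hN'

/-- The items `C` from which the core arises lie in `H`, because a chain with both ends in `H`
cannot leave it and return through the single end `r`. Hence the interactions on `C` are
interactions of `H`, and all others can be postponed until the core has been formed. -/
theorem core_local {f : V × Srt → ℤ} {c : Conn} {p a b a' b' m : V}
    {Z' H R : Multiset (Item V)} (h : Inters (H + R) (core c p a b a' b' + Z'))
    (hHR : Good (H + R)) (hH : Good H) {r : V × Srt} (hr : ∀ x ∈ ports R, x ∈ ends H → x = r)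
    (hf : Ranked f (H + R)) (hcot : cot c m a b ∈ H) :
    ∃ Q, Inters H (core c p a b a' b' + Q) ∧ Inters (Q + R) Z' := by
  obtain ⟨C, Z, Y, h1, h2, h3, h4⟩ := core_pullback h hHR hf (Multiset.mem_add.2 (.inl hcot))
  have hcotH : ∀ x ∈ (cot c m a b).ports, x ∈ ends H := fun x hx =>
    Multiset.mem_of_le hH.le (mem_ports.2 ⟨_, hcot, hx⟩)
  have hmem : ∀ N ∈ C, N ∈ H + R := fun N hN => by rw [h1]; exact Multiset.mem_add.2 (.inl hN)
  have hC : ∀ N ∈ C, N ∈ H := by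
    rcases h4 with ⟨rfl, hc⟩ | ⟨q, j, h5, h6, h7⟩
    · have ha : wireS c.fstSrt a a' ∈ H :=
        mem_left_of_end hHR.nodup (hmem _ (by simp [core])) (x := (a, c.fstSrt))
          (by simp [ends_wireS]) (hcotH _ (by simp [Item.ports]))
      have hb : wireS c.sndSrt b b' ∈ H :=
        mem_left_of_end hHR.nodup (hmem _ (by simp [core])) (x := (b, c.sndSrt))
          (by simp [ends_wireS]) (hcotH _ (by simp [Item.ports]))
      have ha' : (a', c.fstSrt.op) ∈ ends H := mem_ends.2 ⟨_, ha, by simp [ends_wireS]⟩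
      have hb' : (b', c.sndSrt.op) ∈ ends H := mem_ends.2 ⟨_, hb, by simp [ends_wireS]⟩
      have ht : ten c p a' b' ∈ H := by
        rcases Multiset.mem_add.1 (hmem (ten c p a' b') (by simp [core])) with h | h
        · exact h
        -- A tensor link in `R` would be attached to `H` at both `a'` and `b'`, but only one such
        -- end is available.
        · exfalso
          have e1 := hr _ (mem_ports.2 ⟨_, h, by simp [ports_ten]⟩) ha'
          have e2 := hr _ (mem_ports.2 ⟨_, h, by simp [ports_ten]⟩) hb'
          have h8 := hHR.ports_nodup
          rw [h1, ports_add, ports_core, e1, e2] at h8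
          have := (Multiset.nodup_add.1 (Multiset.nodup_add.1 (Multiset.nodup_add.1 h8).1).1).2.2
          simp at this
      intro N hN
      simp only [core, Multiset.mem_add, Multiset.mem_singleton] at hN
      rcases hN with (rfl | rfl) | rfl
      exacts [ht, ha, hb]
    · exact h5.local hHR.nodup hH hr hmem (hcotH _ h6) (hcotH _ h7)
  have hnd : C.Nodup := by
    have := hHR.items_nodup
    rw [h1] at this
    exact (Multiset.nodup_add.1 this).1
  obtain ⟨Q, rfl⟩ := Multiset.le_iff_exists_add.1 ((Multiset.le_iff_subset hnd).2 hC)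
  obtain rfl : Z = Q + R := by
    apply Multiset.add_right_inj (s := C) |>.1
    rw [← h1, add_assoc]
  refine ⟨Y + Q, ?_, ?_⟩
  · rw [← add_assoc]; exact h2.add_right Q
  · rwa [add_assoc]


/-! ### Typed terms together with the graphs that their nets convert to -/

/-- The kind of the terms of a sort. -/
def Srt.kind : Srt → Kind
  | .val => .val
  | .ctx => .ctx

/-- The complex term of a tensor link. -/
def Tm.mk {N : Type*} : (c : Conn) → Tm N c.fstSrt.kind → Tm N c.sndSrt.kind → Tm N c.srt.kind
  | .tensor => .tensor
  | .oslash => .oslash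
  | .obslash => .obslash
  | .plus => .plus
  | .ldiv => .ldiv
  | .rdiv => .rdiv

/-- The end at which the value or context of a judgement is computed. -/
def root : Kind → V → Multiset (V × Srt)
  | .val, v => {(v, .ctx)}
  | .ctx, v => {(v, .val)}
  | .cmd, _ => 0

theorem root_kind (s : Srt) (v : V) : root s.kind v = {(v, s.op)} := by
  cases s <;> rfl

/-- `Conv form bias k v t Δ G`: the term `t`, with labels `Δ`, is built according to fLG up to
structural rules, and `G` is a graph to which its net converts if the cotensor links are contracted
in the order in which they are passed by `t`. Not all cotensor links need to be contracted. -/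
inductive Conv (form : V → Form Atom) (bias : Atom → Pol) : (k : Kind) → V → Tm V k →
    Multiset (V × Srt) → Multiset (Item V) → Prop
  | var (v : V) : (form v).pol bias = .pos →
      Conv form bias .val v (.var v) {(v, .val)} {wire v v}
  | covar (v : V) : (form v).pol bias = .neg →
      Conv form bias .ctx v (.covar v) {(v, .ctx)} {wire v v}
  | ten {c : Conn} {m a b t₁ t₂ Δ₁ Δ₂ G₁ G₂ G} : form m = .bin c (form a) (form b) →
      Conv form bias c.fstSrt.kind a t₁ Δ₁ G₁ → Conv form bias c.sndSrt.kind b t₂ Δ₂ G₂ →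
      (ends (G₁ + G₂ + ({ten c m a b} + {wire m m}))).Nodup →
      Inters (G₁ + G₂ + ({ten c m a b} + {wire m m})) G →
      Conv form bias c.srt.kind m (Tm.mk c t₁ t₂) (Δ₁ + Δ₂) G
  | cmdL {v E Δ G} : (form v).pol bias = .neg → Conv form bias .ctx v E Δ G →
      Conv form bias .cmd v (.cmdL v E) (Δ + {(v, .val)}) G
  | cmdR {v U Δ G} : (form v).pol bias = .pos → Conv form bias .val v U Δ G →
      Conv form bias .cmd v (.cmdR U v) (Δ + {(v, .ctx)}) G
  | mu {u α C Δ G} : (form α).pol bias = .neg → Conv form bias .cmd u C (Δ + {(α, .ctx)}) G →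
      Conv form bias .val α (.mu α C) Δ G
  | comu {u x C Δ G} : (form x).pol bias = .pos → Conv form bias .cmd u C (Δ + {(x, .val)}) G →
      Conv form bias .ctx x (.comu x C) Δ G
  | frac {u} {c : Conn} {m a b C Δ G} : form m = .bin c (form a) (form b) →
      Conv form bias .cmd u C (Δ + {(a, c.fstSrt)} + {(b, c.sndSrt)}) G →
      (ends (G + {wire m m})).Nodup →
      Conv form bias .cmd u (.frac c a b m C) (Δ + {(m, c.srt)})
        (G + ({cot c m a b} + {wire m m}))
  | contr {u} {c : Conn} {m a b p z a' b' C Δ Q} : form m = .bin c (form a) (form b) →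
      Conv form bias .cmd u C (Δ + {(a, c.fstSrt)} + {(b, c.sndSrt)})
        (core c p a b a' b' + {wireS c.srt p z} + Q) →
      (ends (core c p a b a' b' + {wireS c.srt p z} + Q + {wire m m})).Nodup →
      Conv form bias .cmd u (.frac c a b m C) (Δ + {(m, c.srt)}) ({wireS c.srt m z} + Q)

/-! ### Contraction, and invariants of `Conv` -/

/-- Contraction of a redex. -/
inductive Contr : Multiset (Item V) → Multiset (Item V) → Prop
  | mk (c : Conn) (m a b p a' b' y z : V) (Z : Multiset (Item V)) :
      Contr (core c p a b a' b' + {cot c m a b} + {wireS c.srt p z} + {wireS c.srt.op m y} + Z)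
        ({wireS c.srt y z} + Z)

theorem ends_wire_self (s : Srt) (m : V) : ends {wire m m} = {(m, s)} + {(m, s.op)} := by
  rw [← wireS_self s, ends_singleton, ends_wireS]

theorem Contr.ends_le {G H : Multiset (Item V)} (h : Contr G H) : ends H ≤ ends G := by
  cases h with
  | mk c m a b p a' b' y z Z =>
    refine Multiset.le_iff_exists_add.2 ⟨ends (core c p a b a' b') + {(p, c.srt)} +
      {(m, c.srt.op)}, ?_⟩
    simp only [ends_add, ends_singleton, ends_wireS, ends_cot, Srt.op_op]
    abel

namespace Conv

variable {form : V → Form Atom} {bias : Atom → Pol} {k : Kind} {v : V} {t : Tm V k}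
  {Δ : Multiset (V × Srt)} {G : Multiset (Item V)}

/-- Each rule keeps the balance between ends that carry a link and ends that are free for a label or
for the root. Through this balance labels are displayed later, and `Δ` is recognised in the derived
sequent. -/
theorem ends_eq (h : Conv form bias k v t Δ G) : ends G = ports G + Δ + root k v := by
  induction h with
  | var v _ => simp only [ends_singleton, ports_singleton, ends_wire, ports_wire, root, zero_add]
  | covar v _ =>
    simp only [ends_singleton, ports_singleton, ends_wire, ports_wire, root, zero_add]; abel
  | @ten c m a b t₁ t₂ Δ₁ Δ₂ G₁ G₂ G hform h1 h2 hnd hG ih1 ih2 =>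
    rw [hG.ends_eq, hG.ports_eq]
    simp only [ends_add, ports_add, ports_singleton, ends_singleton (Item.ten _ _ _ _), ih1, ih2,
      root_kind, ends_ten, ports_ten, ends_wire_self c.srt, ports_wire]
    abel
  | cmdL _ _ ih => rw [ih]; simp only [root, add_zero, add_assoc]
  | cmdR _ _ ih => rw [ih]; simp only [root, add_zero, add_assoc]
  | mu _ _ ih => rw [ih]; simp only [root, add_zero, add_assoc]
  | comu _ _ ih => rw [ih]; simp only [root, add_zero, add_assoc]
  | @frac u c m a b C Δ G hform h hnd ih =>
    simp only [ends_add, ports_add, ports_singleton, ends_singleton (cot _ _ _ _), ih, root,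
      ends_wire_self c.srt, ports_wire, ports_cot, ends_cot]
    abel
  | @contr u c m a b p z a' b' C Δ Q hform h hnd ih =>
    simp only [ends_add, ports_add, ports_singleton, ends_singleton, ends_core, ports_core, root,
      ends_wireS, ports_wireS, add_zero, zero_add] at ih ⊢
    have : {(z, c.srt.op)} + ends Q = ports Q + Δ := by
      apply Multiset.add_right_inj (s := {(a, c.fstSrt)} + {(a', c.fstSrt.op)} +
        ({(b, c.sndSrt)} + {(b', c.sndSrt.op)}) + {(p, c.srt)}) |>.1
      rw [← add_assoc, add_assoc _ {(p, c.srt)}, ih]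
      abel
    rw [add_assoc, this]
    abel

theorem nodup (h : Conv form bias k v t Δ G) : (ends G).Nodup := by
  induction h with
  | var v _ => simp [Item.ends]
  | covar v _ => simp [Item.ends]
  | ten _ _ _ hnd hG _ _ => rw [hG.ends_eq]; exact hnd
  | cmdL _ _ ih => exact ih
  | cmdR _ _ ih => exact ih
  | mu _ _ ih => exact ih
  | comu _ _ ih => exact ih
  | @frac u c m a b C Δ G hform h hnd ih =>
    simpa only [ends_add, ends_singleton (cot _ _ _ _), Item.ends, zero_add] using hnd
  | @contr u c m a b p z a' b' C Δ Q hform h hnd ih =>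
    refine Multiset.nodup_of_le ?_ hnd
    refine Multiset.le_iff_exists_add.2 ⟨ends (core c p a b a' b') + {(p, c.srt)} +
      {(m, c.srt.op)}, ?_⟩
    simp only [ends_add, ends_singleton (wireS _ _ _), ends_wireS, ends_wire_self c.srt]
    abel

theorem good (h : Conv form bias k v t Δ G) : Good G :=
  ⟨h.nodup, by rw [h.ends_eq, add_assoc]; exact Multiset.le_add_right _ _⟩

theorem not_mem_ports (h : Conv form bias k v t Δ G) {x : V × Srt} (hx : x ∈ Δ) : x ∉ ports G := by
  have := h.nodup
  rw [h.ends_eq] at this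
  exact fun hp => not_mem_of_nodup_add (Multiset.nodup_add.1 this).1 hp hx

theorem _root_.LG.Inter.exists_fuse {G H : Multiset (Item V)} (h : Inter G H) :
    ∃ x y m, fuse x y m ∈ G := by
  cases h with
  | @mk x y m m' v w S M G h => exact ⟨x, y, m, by simp⟩

/-- At a tensor link the rule itself absorbs interactions. At `frac` the new cotensor link and its
wire are inert. At `contr` the merged wire is inert, because its end `m` is a free label. So in the
last two cases the interaction already takes place in the graph of the premise. -/
theorem inter (h : Conv form bias k v t Δ G) :
    ∀ {H}, Inter G H → Conv form bias k v t Δ H := by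
  induction h with
  | var v _ => intro H hi; simpa using hi.exists_fuse
  | covar v _ => intro H hi; simpa using hi.exists_fuse
  | ten hf h1 h2 hnd hG _ _ => intro H hi; exact .ten hf h1 h2 hnd (hG.tail hi)
  | cmdL hp _ ih => intro H hi; exact .cmdL hp (ih hi)
  | cmdR hp _ ih => intro H hi; exact .cmdR hp (ih hi)
  | mu hp _ ih => intro H hi; exact .mu hp (ih hi)
  | comu hp _ ih => intro H hi; exact .comu hp (ih hi)
  | @frac u c m a b C Δ G hform h hnd ih =>
    intro H hi
    have hgood := (Conv.frac hform h hnd).good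
    have e : G + ({cot c m a b} + {wire m m}) = {cot c m a b} + ({wire m m} + G) := by abel
    rw [e] at hi hgood
    obtain ⟨H₁, rfl, hi, -⟩ := hi.of_inert (.inl ⟨_, _, _, _, rfl⟩)
    have hin : Inert (wire m m) G := by
      refine .inr ⟨c.srt.op, m, m, (wireS_self _ _).symm, fun N hN hc hx => ?_⟩
      refine hc c m a b (hgood.eq_of_port (by simp [hN]) (by simp) hx (by simp [Item.ports]))
    obtain ⟨H₂, rfl, hi, -⟩ := hi.of_inert hin
    have := Conv.frac hform (ih hi) (by
      rw [ends_add, hi.ends_eq, ← ends_add]; exact hnd)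
    convert this using 1
    abel
  | @contr u c m a b p z a' b' C Δ Q hform h hnd ih =>
    intro H hi
    have hnp := (Conv.contr hform h hnd).not_mem_ports (x := (m, c.srt)) (by simp)
    have hin : Inert (wireS c.srt m z) Q := by
      refine .inr ⟨c.srt, m, z, rfl, fun N hN _ hx => hnp ?_⟩
      exact mem_ports.2 ⟨N, by simp [hN], hx⟩
    obtain ⟨Q', rfl, hi, -⟩ := hi.of_inert hin
    refine .contr hform (ih (hi.add_left _)) ?_
    simp only [ends_add, hi.ends_eq] at hnd ⊢
    exact hnd

theorem inters (h : Conv form bias k v t Δ G) {H} (hi : Inters G H) :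
    Conv form bias k v t Δ H := by
  induction hi with
  | refl => exact h
  | tail _ hi ih => exact ih.inter hi

theorem _root_.LG.Ranked.congr {f g : V × Srt → ℤ} {G : Multiset (Item V)} (hG : Good G)
    (h : Ranked f G) (n : ℤ) (hfg : ∀ x ∈ ends G, g x = f x + n) : Ranked g G := by
  intro N hN
  constructor
  · intro s p e
    rw [hfg _ (mem_ends.2 ⟨N, hN, by simp [e, Item.ends]⟩),
      hfg _ (mem_ends.2 ⟨N, hN, by simp [e, Item.ends]⟩), (h N hN).1 s p e]
  · intro p q hn
    rw [hfg _ (Multiset.mem_of_le hG.le (mem_ports.2 ⟨N, hN, hn.mem_ports.1⟩)),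
      hfg _ (Multiset.mem_of_le hG.le (mem_ports.2 ⟨N, hN, hn.mem_ports.2⟩))]
    have := (h N hN).2 p q hn
    omega

theorem _root_.LG.Ranked.wire_self {f : V × Srt → ℤ} {s p : V}
    (h : f (s, .val) = f (p, .ctx)) : Ranked f {wire s p} := by
  intro N hN
  rw [Multiset.mem_singleton.1 hN]
  refine ⟨fun s' p' e => ?_, fun p q hn => absurd rfl (hn.ne_wire _ _)⟩
  simp only [wire.injEq] at e
  rw [← e.1, ← e.2, h]

theorem _root_.LG.Ranked.wireS {f : V × Srt → ℤ} {s : Srt} {q p : V} :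
    Ranked f {wireS s q p} ↔ f (q, s) = f (p, s.op) := by
  constructor
  · intro h
    have := (h _ (Multiset.mem_singleton_self _)).1
    cases s
    · exact this _ _ rfl
    · exact (this _ _ rfl).symm
  · intro h
    cases s
    · exact .wire_self h
    · exact .wire_self h.symm

-- A tensor link joins two disjoint graphs, each at one end, so their ranks can be shifted
-- independently to fit. A cotensor link imposes no condition, and after a contraction `m` takes
-- over the rank of `p`.
open Classical in
theorem ranked (h : Conv form bias k v t Δ G) : ∃ f, Ranked f G := by
  induction h with
  | var v _ => exact ⟨fun _ => 0, .wire_self rfl⟩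
  | covar v _ => exact ⟨fun _ => 0, .wire_self rfl⟩
  | cmdL _ _ ih => exact ih
  | cmdR _ _ ih => exact ih
  | mu _ _ ih => exact ih
  | comu _ _ ih => exact ih
  | @ten c m a b t₁ t₂ Δ₁ Δ₂ G₁ G₂ G hform h1 h2 hnd hG ih1 ih2 =>
    obtain ⟨f₁, hf₁⟩ := ih1
    obtain ⟨f₂, hf₂⟩ := ih2
    have ha : (a, c.fstSrt.op) ∈ ends G₁ := by rw [h1.ends_eq, root_kind]; simp
    have hb : (b, c.sndSrt.op) ∈ ends G₂ := by rw [h2.ends_eq, root_kind]; simp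
    rw [ends_add, ends_add] at hnd
    obtain ⟨hnd₁, hnd₂, hnd₃⟩ := Multiset.nodup_add.1 hnd
    have hm : ∀ s, (m, s) ∉ ends G₁ + ends G₂ := by
      intro s hs
      refine Multiset.disjoint_left.1 hnd₃ hs ?_
      cases s <;> simp [Item.ends]
    have hd : ∀ x ∈ ends G₂, x ∉ ends G₁ := fun x h2 h1 => not_mem_of_nodup_add hnd₁ h1 h2
    -- The premisses of the new link get rank `-1` and its conclusions rank `1`. Each operand is
    -- shifted so that its root has the prescribed value.
    let σ : Srt → ℤ := fun s => match s with | .val => 1 | .ctx => -1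
    let f : V × Srt → ℤ := fun x =>
      if x ∈ ends G₁ then f₁ x + (σ c.fstSrt.op - f₁ (a, c.fstSrt.op))
      else if x ∈ ends G₂ then f₂ x + (σ c.sndSrt.op - f₂ (b, c.sndSrt.op))
      else σ c.srt
    have fa : f (a, c.fstSrt.op) = σ c.fstSrt.op := by simp [f, ha]
    have fb : f (b, c.sndSrt.op) = σ c.sndSrt.op := by simp [f, hb, hd _ hb]
    have fm : ∀ s, f (m, s) = σ c.srt := by
      intro s
      have := hm s
      simp only [Multiset.mem_add, not_or] at this
      simp [f, this]
    refine ⟨f, hG.ranked (Ranked.add (Ranked.add ?_ ?_) (Ranked.add ?_ ?_))⟩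
    · exact hf₁.congr h1.good (σ c.fstSrt.op - f₁ (a, c.fstSrt.op)) (fun x hx => by simp [f, hx])
    · exact hf₂.congr h2.good (σ c.sndSrt.op - f₂ (b, c.sndSrt.op))
        (fun x hx => by simp [f, hx, hd x hx])
    · intro N hN
      rw [Multiset.mem_singleton.1 hN]
      refine ⟨fun s p e => absurd e (ten_ne_wire _ _ _ _ _ _), fun p q hn => ?_⟩
      have hσ : ∀ p s, (p, s) ∈ (Item.ten c m a b).ports → f (p, s) = σ s := by
        intro p s hp
        simp only [ports_ten, Multiset.mem_add, Multiset.mem_singleton, Prod.mk.injEq] at hp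
        rcases hp with (⟨rfl, rfl⟩ | ⟨rfl, rfl⟩) | ⟨rfl, rfl⟩
        exacts [fa, fb, fm _]
      rw [hσ _ _ hn.mem_ports.1, hσ _ _ hn.mem_ports.2]
      simp [σ]
    · exact .wire_self (by rw [fm, fm])
  | @frac u c m a b C Δ G hform h hnd ih =>
    obtain ⟨f, hf⟩ := ih
    rw [ends_add] at hnd
    let g : V × Srt → ℤ := fun x => if x ∈ ends G then f x else 0
    have hm : ∀ s, g (m, s) = 0 := by
      intro s
      have : (m, s) ∉ ends G := fun hs => by
        refine not_mem_of_nodup_add hnd hs ?_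
        cases s <;> simp [Item.ends]
      simp [g, this]
    refine ⟨g, (hf.congr h.good 0 fun x hx => by simp [g, hx]).add (Ranked.add ?_ ?_)⟩
    · intro N hN
      rw [Multiset.mem_singleton.1 hN]
      exact ⟨fun s p e => by simp at e, fun p q hn => absurd rfl (hn.ne_cot _ _ _ _)⟩
    · exact .wire_self (by rw [hm, hm])
  | @contr u c m a b p z a' b' C Δ Q hform h hnd ih =>
    obtain ⟨f, hf⟩ := ih
    have hgood := h.good
    rw [ends_add] at hnd
    generalize hG : core c p a b a' b' + {Item.wireS c.srt p z} + Q = G at *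
    let g : V × Srt → ℤ := fun x => if x ∈ ends G then f x else f (p, c.srt)
    have hg : Ranked g G := hf.congr hgood 0 fun x hx => by simp [g, hx]
    have hm : g (m, c.srt) = f (p, c.srt) := by
      have : (m, c.srt) ∉ ends G := fun hs => by
        refine not_mem_of_nodup_add hnd hs ?_
        cases c.srt <;> simp [Item.ends]
      simp [g, this]
    have hp : (p, c.srt) ∈ ends G := by
      rw [← hG]; simp [ends_wireS]
    have hgp : g (p, c.srt) = f (p, c.srt) := ite_self _
    subst hG
    have h1 : Ranked g {Item.wireS c.srt p z} :=
      hg.mono ((Multiset.le_add_left _ _).trans (Multiset.le_add_right _ _))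
    refine ⟨g, Ranked.add ?_ (hg.mono (Multiset.le_add_left _ _))⟩
    rw [Ranked.wireS] at h1 ⊢
    rw [hm, ← hgp, h1]

end Conv


/-! ### Local contraction, and stability of `Conv` under contraction -/

theorem Inter.wire_mem_iff {G H : Multiset (Item V)} (h : Inter G H) (s : Srt) (q p : V) :
    wireS s q p ∈ G ↔ wireS s q p ∈ H := by
  cases h with
  | mk G h =>
    have h1 : wireS s q p ≠ _ := (fun e => by cases s <;> exact (h.ne.1 _ _ e.symm))
    have h2 : wireS s q p ≠ _ := (fun e => by cases s <;> exact (h.ne.2.1 _ _ e.symm))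
    have h3 : ∀ x y m, wireS s q p ≠ fuse x y m := by cases s <;> simp [wireS]
    have h4 : ∀ x y m, wireS s q p ≠ split x y m := by cases s <;> simp [wireS]
    simp [h1, h2, h3, h4]

theorem Inters.wire_mem_iff {G H : Multiset (Item V)} (h : Inters G H) (s : Srt) (q p : V) :
    wireS s q p ∈ G ↔ wireS s q p ∈ H := by
  induction h with
  | refl => rfl
  | tail _ h ih => rw [ih, h.wire_mem_iff]

theorem cot_not_mem_core (c c' : Conn) (m a b p a₁ b₁ a' b' : V) :
    cot c' m a b ∉ core c p a₁ b₁ a' b' := by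
  simp [core, cot_ne_wireS, (ten_ne_cot _ _ _ _ _ _ _ _).symm]

theorem mem_right_of_nodup {α : Type*} {s t : Multiset α} (h : (s + t).Nodup) {a : α}
    (ha : a ∈ t) : a ∉ s := fun hs => not_mem_of_nodup_add h hs ha

/-- A redex that is formed by interactions can be formed and contracted locally. -/
theorem contr_local {f : V × Srt → ℤ} {c : Conn} {m a b p a' b' y z : V}
    {H R Z : Multiset (Item V)}
    (h : Inters (H + R) (core c p a b a' b' + {cot c m a b} + {wireS c.srt p z} +
      {wireS c.srt.op m y} + Z))
    (hHR : Good (H + R)) (hH : Good H) {r : V × Srt} (hr : ∀ x ∈ ports R, x ∈ ends H → x = r)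
    (hf : Ranked f (H + R)) (hcot : cot c m a b ∈ H) :
    ∃ H' K, Inters H H' ∧ Contr H' K ∧ Inters (K + R) ({wireS c.srt y z} + Z) := by
  have e : core c p a b a' b' + {cot c m a b} + {wireS c.srt p z} +
      {wireS c.srt.op m y} + Z = core c p a b a' b' + ({cot c m a b} + ({wireS c.srt p z} +
      ({wireS c.srt.op m y} + Z))) := by abel
  rw [e] at h
  obtain ⟨Q, h1, h2⟩ := core_local h hHR hH hr hf hcot
  have hgood := h.good hHR
  have hnd := hgood.items_nodup
  have hgood₁ : Good (core c p a b a' b' + Q + R) := (h1.add_right R).good hHR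
  have hQ := h1.good hH
  have hcotQ : cot c m a b ∈ Q :=
    (Multiset.mem_add.1 ((h1.cot_mem_iff _ _ _ _).1 hcot)).resolve_left (cot_not_mem_core _ _ _ _ _ _ _ _ _ _)
  -- The two outer wires of the redex are attached, at `p` and at `m`, to links of the local part.
  -- So they belong to that part as well.
  have hw : ∀ s q o, wireS s q o ∈ ({cot c m a b} + ({wireS c.srt p z} +
      ({wireS c.srt.op m y} + Z)) : Multiset (Item V)) →
      (q, s) ∈ ports (core c p a b a' b' + Q) → wireS s q o ∈ Q := by
    intro s q o hmem hport
    have h3 := (h2.wire_mem_iff s q o).2 hmem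
    have h4 : wireS s q o ∈ core c p a b a' b' + Q := by
      refine mem_left_of_end hgood₁.nodup ?_ (x := (q, s)) (by simp [ends_wireS])
        (Multiset.mem_of_le hQ.le hport)
      rw [add_assoc]; exact Multiset.mem_add.2 (.inr h3)
    exact (Multiset.mem_add.1 h4).resolve_left (mem_right_of_nodup hnd hmem)
  have hpp : (p, c.srt) ∈ ports (core c p a b a' b') := by rw [ports_core]; simp
  have hw1 := hw c.srt p z (by simp) (by rw [ports_add]; exact Multiset.mem_add.2 (.inl hpp))
  have hmp : (m, c.srt.op) ∈ (cot c m a b).ports := by simp [ports_cot]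
  have hw2 := hw c.srt.op m y (by simp)
    (mem_ports.2 ⟨_, Multiset.mem_add.2 (.inr hcotQ), hmp⟩)
  obtain ⟨Q, rfl⟩ := exists_eq_singleton_add hcotQ
  obtain ⟨Q, rfl⟩ := exists_eq_singleton_add (a := wireS c.srt p z) (s := Q) (by
    simpa [(cot_ne_wireS _ _ _ _ _ _ _).symm] using hw1)
  have hne : wireS c.srt.op m y ≠ wireS c.srt p z := by
    intro e
    have := (Multiset.nodup_add.1 (Multiset.nodup_add.1 (Multiset.nodup_add.1 hnd).2.1).2.1).2.2
    simp [e] at this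
  obtain ⟨Q, rfl⟩ := exists_eq_singleton_add (a := wireS c.srt.op m y) (s := Q) (by
    simpa [(cot_ne_wireS _ _ _ _ _ _ _).symm, hne] using hw2)
  -- The remaining interactions do not involve the rest of the redex. The cotensor link is inert. So
  -- is the wire at `p`, whose tensor link has been set aside with the core, and so is the wire at
  -- `m`, whose end `m` carries only the cotensor link. The three are stripped off one after the
  -- other.
  simp only [add_assoc] at h2
  obtain ⟨Z₁, hZ₁, h2, -⟩ := h2.of_inert (.inl ⟨_, _, _, _, rfl⟩)
  obtain rfl := Multiset.add_right_inj.1 hZ₁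
  obtain ⟨Z₁, hZ₁, h2, -⟩ := h2.of_inert (.inr ⟨_, _, _, rfl, fun N hN _ hx => by
    have h5 := hgood₁.ports_nodup
    simp only [add_assoc] at h5
    rw [ports_add] at h5
    refine not_mem_of_nodup_add h5 hpp (mem_ports.2 ⟨N, ?_, hx⟩)
    simp only [Multiset.mem_add] at hN ⊢
    tauto⟩)
  obtain rfl := Multiset.add_right_inj.1 hZ₁
  obtain ⟨Z₁, hZ₁, h2, -⟩ := h2.of_inert (.inr ⟨_, _, _, rfl, fun N hN hc hx => by
    refine hc c m a b (hgood₁.eq_of_port ?_ (by simp) hx hmp)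
    simp only [Multiset.mem_add] at hN ⊢
    tauto⟩)
  obtain rfl := Multiset.add_right_inj.1 hZ₁
  refine ⟨_, {wireS c.srt y z} + Q, h1, ?_, ?_⟩
  · have := Contr.mk c m a b p a' b' y z Q
    convert this using 1
    abel
  · rw [add_assoc]
    exact h2.add_left _

namespace Conv

variable {form : V → Form Atom} {bias : Atom → Pol} {k : Kind} {v : V} {t : Tm V k}
  {Δ : Multiset (V × Srt)} {G : Multiset (Item V)}

theorem _root_.LG.Contr.exists_cot {G H : Multiset (Item V)} (h : Contr G H) :
    ∃ c m a b, cot c m a b ∈ G := by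
  cases h with
  | mk c m a b p a' b' y z Z => exact ⟨c, m, a, b, by simp⟩

theorem _root_.LG.Inters.not_wire_to {w : Item V} {H K : Multiset (Item V)} (hw : ∃ s p, w = wire s p)
    (h : Inters {w} H) (hc : Contr H K) : False := by
  obtain ⟨s, p, rfl⟩ := hw
  obtain ⟨c, m, a, b, hmem⟩ := hc.exists_cot
  have := (h.cot_mem_iff c m a b).2 hmem
  simp at this

/-- Every wire of a redex has an end to which a link of the redex is attached. -/
theorem exists_port_of_mem_redex {c : Conn} {m a b p a' b' y z : V} {e : Item V}
    (he : e = wireS c.fstSrt a a' ∨ e = wireS c.sndSrt b b' ∨ e = wireS c.srt p z ∨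
      e = wireS c.srt.op m y) :
    ∃ x ∈ e.ends, x ∈ (Item.ten c p a' b').ports ∨ x ∈ (cot c m a b).ports := by
  rcases he with rfl | rfl | rfl | rfl
  · exact ⟨(a, c.fstSrt), by simp [ends_wireS], by simp [ports_cot]⟩
  · exact ⟨(b, c.sndSrt), by simp [ends_wireS], by simp [ports_cot]⟩
  · exact ⟨(p, c.srt), by simp [ends_wireS], by simp [ports_ten]⟩
  · exact ⟨(m, c.srt.op), by simp [ends_wireS], by simp [ports_cot]⟩

/-- The induction is on the term. Below a tensor link the redex's cotensor link lies in one operand,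
attached to the rest only at its root, and `contr_local` moves the contraction there. That may
require interactions inside the operand beforehand, hence the intermediate graph `G'`. At `frac`,
either the link just passed is contracted, and `contr` takes the place of `frac`, or an earlier one
is, and the induction hypothesis applies. At `contr` the new contraction is exchanged with the one
already made. -/
theorem contraction (h : Conv form bias k v t Δ G) :
    ∀ {G' H}, Inters G G' → Contr G' H → Conv form bias k v t Δ H := by
  induction h with
  | var v _ => intro G' H hi hc; exact (hi.not_wire_to ⟨_, _, rfl⟩ hc).elim
  | covar v _ => intro G' H hi hc; exact (hi.not_wire_to ⟨_, _, rfl⟩ hc).elim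
  | cmdL hp _ ih => intro G' H hi hc; exact .cmdL hp (ih hi hc)
  | cmdR hp _ ih => intro G' H hi hc; exact .cmdR hp (ih hi hc)
  | mu hp _ ih => intro G' H hi hc; exact .mu hp (ih hi hc)
  | comu hp _ ih => intro G' H hi hc; exact .comu hp (ih hi hc)
  | @ten c m a b t₁ t₂ Δ₁ Δ₂ G₁ G₂ G hform h1 h2 hnd hG ih1 ih2 =>
    intro G' H hi hc
    obtain ⟨f, hf⟩ := (Conv.ten hform h1 h2 hnd .refl).ranked
    have hgood := (Conv.ten hform h1 h2 hnd .refl).good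
    have hG : Inters _ _ := hG.trans hi
    have ha : (a, c.fstSrt.op) ∈ ends G₁ := by rw [h1.ends_eq, root_kind]; simp
    have hb : (b, c.sndSrt.op) ∈ ends G₂ := by rw [h2.ends_eq, root_kind]; simp
    have hnd' := hnd
    rw [ends_add, ends_add] at hnd
    obtain ⟨hnd₁, hnd₂, hnd₃⟩ := Multiset.nodup_add.1 hnd
    have hd : ∀ x ∈ ends G₁, x ∉ ends G₂ := fun x => not_mem_of_nodup_add hnd₁
    have hm : ∀ x ∈ ends G₁ + ends G₂, x ≠ (m, c.srt) := by
      rintro _ hs rfl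
      refine Multiset.disjoint_left.1 hnd₃ hs ?_
      rw [ends_add, ends_wire_self c.srt]; simp
    cases hc with
    | mk c' m' a₁ b₁ p a' b' y z Z =>
      have hcot := (hG.cot_mem_iff c' m' a₁ b₁).2 (by simp)
      have hcot : cot c' m' a₁ b₁ ∈ G₁ ∨ cot c' m' a₁ b₁ ∈ G₂ := by
        simpa [(ten_ne_cot _ _ _ _ _ _ _ _).symm] using hcot
      rcases hcot with hcot | hcot
      · have e : G₁ + G₂ + ({Item.ten c m a b} + {wire m m}) =
          G₁ + (G₂ + ({Item.ten c m a b} + {wire m m})) := by abel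
        rw [e] at hG hf hgood
        obtain ⟨H₁, K, h3, h4, h5⟩ := contr_local hG hgood h1.good (r := (a, c.fstSrt.op)) (by
          intro x hx hx'
          rw [ports_add, ports_add, ports_singleton, ports_singleton, ports_ten, ports_wire] at hx
          simp only [Multiset.mem_add, Multiset.mem_singleton, Multiset.notMem_zero,
            or_false] at hx
          rcases hx with hx | (rfl | rfl) | rfl
          · exact absurd (Multiset.mem_of_le h2.good.le hx) (hd x hx')
          · rfl
          · exact absurd hb (hd _ hx')
          · exact absurd rfl (hm _ (Multiset.mem_add.2 (.inl hx')))) hf hcot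
        refine .ten hform (ih1 h3 h4) h2 ?_ (by rwa [add_assoc])
        refine Multiset.nodup_of_le ?_ hnd
        simp only [ends_add]
        gcongr
        rw [← h3.ends_eq]
        exact h4.ends_le
      · have e : G₁ + G₂ + ({Item.ten c m a b} + {wire m m}) =
          G₂ + (G₁ + ({Item.ten c m a b} + {wire m m})) := by abel
        rw [e] at hG hf hgood
        obtain ⟨H₁, K, h3, h4, h5⟩ := contr_local hG hgood h2.good (r := (b, c.sndSrt.op)) (by
          intro x hx hx'
          rw [ports_add, ports_add, ports_singleton, ports_singleton, ports_ten, ports_wire] at hx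
          simp only [Multiset.mem_add, Multiset.mem_singleton, Multiset.notMem_zero,
            or_false] at hx
          rcases hx with hx | (rfl | rfl) | rfl
          · exact absurd hx' (hd x (Multiset.mem_of_le h1.good.le hx))
          · exact absurd hx' (hd _ ha)
          · rfl
          · exact absurd rfl (hm _ (Multiset.mem_add.2 (.inr hx')))) hf hcot
        refine .ten hform h1 (ih2 h3 h4) ?_ (by rwa [add_comm G₁, add_assoc])
        refine Multiset.nodup_of_le ?_ hnd
        simp only [ends_add]
        gcongr
        rw [← h3.ends_eq]
        exact h4.ends_le
  | @frac u c m a b C Δ G hform h hnd ih =>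
    intro G' H hi hc
    have hgood := (Conv.frac hform h hnd).good
    have hnp := (Conv.frac hform h hnd).not_mem_ports (x := (m, c.srt)) (by simp)
    have e : G + ({cot c m a b} + {wire m m}) = {cot c m a b} + ({wire m m} + G) := by abel
    rw [e] at hi hgood hnp
    have hgood' := hi.good hgood
    rw [← hi.ports_eq] at hnp
    obtain ⟨H₁, rfl, hi, -⟩ := hi.of_inert (.inl ⟨_, _, _, _, rfl⟩)
    obtain ⟨G'', rfl, hi₂, -⟩ := hi.of_inert (N := wire m m) (G := G) (by
      refine .inr ⟨c.srt.op, m, m, (wireS_self _ _).symm, fun N hN hc hx => ?_⟩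
      exact hc c m a b (hgood.eq_of_port (by simp [hN]) (by simp) hx (by simp [Item.ports])))
    have hnd' : (ends (G'' + {wire m m})).Nodup := by
      rw [ends_add, hi₂.ends_eq, ← ends_add]; exact hnd
    generalize hK : {cot c m a b} + ({wire m m} + G'') = K at hc hgood' hnp
    cases hc with
    | mk c' m' a₁ b₁ p a' b' y z Z =>
      by_cases hcc : cot c' m' a₁ b₁ = cot c m a b
      · simp only [cot.injEq] at hcc
        obtain ⟨rfl, rfl, rfl, rfl⟩ := hcc
        have hw : wireS c'.srt.op m' y = wire m' m' :=
          hgood'.eq_of_end (x := (m', c'.srt.op)) (by simp) (by rw [← hK]; simp)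
            (by simp [ends_wireS]) (by rw [← wireS_self c'.srt.op]; simp [ends_wireS])
        obtain rfl : y = m' := (wireS_inj (hw.trans (wireS_self _ _).symm)).2
        have hG'' : G'' = core c' p a₁ b₁ a' b' + {wireS c'.srt p z} + Z := by
          apply Multiset.add_right_inj (s := {cot c' y a₁ b₁} + {wire y y}) |>.1
          rw [add_assoc, hK, wireS_self]
          abel
        subst hG''
        exact .contr hform (h.inters hi₂) hnd'
      -- The new wire at `m` takes no part in the redex. One of its ends is a free label, and the
      -- other carries the cotensor link just passed, which is not the one being contracted.
      · have hwire : ∀ e', (e' = wireS c'.fstSrt a₁ a' ∨ e' = wireS c'.sndSrt b₁ b' ∨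
            e' = wireS c'.srt p z ∨ e' = wireS c'.srt.op m' y) → wire m m ≠ e' := by
          rintro _ he rfl
          obtain ⟨⟨x, s⟩, hx, hx'⟩ := exists_port_of_mem_redex he
          have hxm : x = m := by simp [Item.ends] at hx; tauto
          subst hxm
          rcases Srt.eq_or_eq_op s c.srt with rfl | rfl
          · rcases hx' with hx' | hx'
            · exact hnp (mem_ports.2 ⟨_, by simp [core], hx'⟩)
            · exact hnp (mem_ports.2 ⟨_, by simp, hx'⟩)
          · rcases hx' with hx' | hx'
            · exact absurd (hgood'.eq_of_port (by simp [core]) (by rw [← hK]; simp) hx'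
                (by simp [ports_cot])) (ten_ne_cot _ c _ _ _ x a b)
            · exact hcc (hgood'.eq_of_port (by simp) (by rw [← hK]; simp) hx'
                (by simp [ports_cot]))
        have hmemZ : wire m m ∈ Z := by
          have : wire m m ∈ core c' p a₁ b₁ a' b' + {cot c' m' a₁ b₁} + {wireS c'.srt p z} +
            {wireS c'.srt.op m' y} + Z := by rw [← hK]; simp
          simp only [core, Multiset.mem_add, Multiset.mem_singleton,
            (ten_ne_wire _ _ _ _ _ _).symm, hwire _ (.inl rfl), hwire _ (.inr (.inl rfl)),
            hwire _ (.inr (.inr (.inl rfl))), hwire _ (.inr (.inr (.inr rfl))), false_or,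
            reduceCtorEq] at this
          exact this
        obtain ⟨Z, rfl⟩ := exists_eq_singleton_add hmemZ
        have hmemZ : cot c m a b ∈ Z := by
          have : cot c m a b ∈ core c' p a₁ b₁ a' b' + {cot c' m' a₁ b₁} + {wireS c'.srt p z} +
            {wireS c'.srt.op m' y} + ({wire m m} + Z) := by rw [← hK]; simp
          simp only [Multiset.mem_add, Multiset.mem_singleton, cot_not_mem_core, Ne.symm hcc,
            cot_ne_wireS, false_or, reduceCtorEq] at this
          exact this
        obtain ⟨Z, rfl⟩ := exists_eq_singleton_add hmemZ
        have hG'' : G'' = core c' p a₁ b₁ a' b' + {cot c' m' a₁ b₁} + {wireS c'.srt p z} +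
            {wireS c'.srt.op m' y} + Z := by
          apply Multiset.add_right_inj (s := {cot c m a b} + {wire m m}) |>.1
          rw [add_assoc, hK]
          abel
        subst hG''
        have hc' := Contr.mk c' m' a₁ b₁ p a' b' y z Z
        have := Conv.frac hform (ih hi₂ hc') (Multiset.nodup_of_le (by
          rw [ends_add _ {wire m m}, ends_add _ {wire m m}]
          have := hc'.ends_le
          gcongr) hnd')
        convert this using 1
        abel
  | @contr u c m a b p₀ z₀ a₀ b₀ C Δ Q hform h hnd ih =>
    intro G' H hi hc
    have hnp := (Conv.contr hform h hnd).not_mem_ports (x := (m, c.srt)) (by simp)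
    rw [← hi.ports_eq] at hnp
    obtain ⟨Q', rfl, hi, -⟩ := hi.of_inert (N := wireS c.srt m z₀) (G := Q) (by
      refine .inr ⟨c.srt, m, z₀, rfl, fun N hN _ hx => hnp ?_⟩
      rw [hi.ports_eq]
      exact mem_ports.2 ⟨N, by simp [hN], hx⟩)
    have hi' := hi.add_left (core c p₀ a b a₀ b₀ + {wireS c.srt p₀ z₀})
    have hnd' : (ends (core c p₀ a b a₀ b₀ + {wireS c.srt p₀ z₀} + Q' + {wire m m})).Nodup := by
      rw [ends_add, hi'.ends_eq, ← ends_add]; exact hnd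
    -- a contraction of the graph of the command yields one after the contraction of `c`
    have main : ∀ z₁ Q₁ , Contr (core c p₀ a b a₀ b₀ + {wireS c.srt p₀ z₀} + Q')
        (core c p₀ a b a₀ b₀ + {wireS c.srt p₀ z₁} + Q₁) →
        Conv form bias .cmd u (.frac c a b m C) (Δ + {(m, c.srt)}) ({wireS c.srt m z₁} + Q₁) := by
      intro z₁ Q₁ hc'
      refine .contr hform (ih hi' hc') (Multiset.nodup_of_le ?_ hnd')
      rw [ends_add, ends_add (_ + Q')]
      have := hc'.ends_le
      gcongr
    generalize hK : {wireS c.srt m z₀} + Q' = K at hc hnp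
    cases hc with
    | mk c' m' a₁ b₁ p a' b' y z Z =>
      have hmem : wireS c.srt m z₀ ∈ core c' p a₁ b₁ a' b' + {cot c' m' a₁ b₁} +
        {wireS c'.srt p z} + {wireS c'.srt.op m' y} + Z := by rw [← hK]; simp
      have hends : ∀ s x y, wireS c.srt m z₀ = wireS s x y → (m, c.srt) = (x, s) ∨
          (m, c.srt) = (y, s.op) := by
        intro s x y e
        have : (m, c.srt) ∈ (wireS s x y).ends := by rw [← e]; simp [ends_wireS]
        simpa [ends_wireS] using this
      have hports : ∀ x, x ∈ (Item.ten c' p a' b').ports ∨ x ∈ (cot c' m' a₁ b₁).ports →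
          (m, c.srt) ≠ x := by
        rintro _ hx rfl
        rcases hx with hx | hx
        · exact hnp (mem_ports.2 ⟨_, by simp [core], hx⟩)
        · exact hnp (mem_ports.2 ⟨_, by simp, hx⟩)
      simp only [core, Multiset.mem_add, Multiset.mem_singleton] at hmem
      -- The end `m` of the merged wire carries no link. So this wire is either outside the redex or
      -- one of its two outer wires, with `m` at the far end. In the latter cases `z₀` is the vertex
      -- `p` or `m'` of the redex, and before the earlier contraction the same redex was present
      -- with the far end `p₀` in place of `m`.
      rcases hmem with ((((((hm | hm) | hm) | hm) | hm) | hm) | hm)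
      · exact absurd hm.symm (ten_ne_wireS _ _ _ _ _ _ _)
      · rcases hends _ _ _ hm with h | h
        · exact absurd h (hports _ (by simp [ports_cot]))
        · exact absurd h (hports _ (by simp [ports_ten]))
      · rcases hends _ _ _ hm with h | h
        · exact absurd h (hports _ (by simp [ports_cot]))
        · exact absurd h (hports _ (by simp [ports_ten]))
      · exact absurd hm.symm (cot_ne_wireS _ _ _ _ _ _ _)
      · rcases hends _ _ _ hm with h | h
        · exact absurd h (hports _ (by simp [ports_ten]))
        · obtain ⟨rfl, hs⟩ := Prod.mk.inj h
          have hz₀ : z₀ = p := by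
            rw [hs, wireS_op] at hm
            exact (wireS_inj hm).1
          subst hz₀
          have hQ : Q' = core c' z₀ a₁ b₁ a' b' + {cot c' m' a₁ b₁} +
              {wireS c'.srt.op m' y} + Z := by
            apply Multiset.add_right_inj (s := {wireS c.srt m z₀}) |>.1
            rw [hK, hm]; abel
          have := main y Z (by
            have := Contr.mk c' m' a₁ b₁ z₀ a' b' y p₀ (core c p₀ a b a₀ b₀ + Z)
            rw [hQ, hs, wireS_op]
            convert this using 1
            · abel
            · rw [wireS_op]; abel)
          rw [hs, wireS_op] at this
          rwa [hs]
      · rcases hends _ _ _ hm with h | h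
        · exact absurd h (hports _ (by simp [ports_cot]))
        · obtain ⟨rfl, hs⟩ := Prod.mk.inj h
          rw [Srt.op_op] at hs
          have hz₀ : z₀ = m' := by
            rw [hs, wireS_op] at hm
            exact (wireS_inj hm).2
          subst hz₀
          have hQ : Q' = core c' p a₁ b₁ a' b' + {cot c' z₀ a₁ b₁} + {wireS c'.srt p z} + Z := by
            apply Multiset.add_right_inj (s := {wireS c.srt m z₀}) |>.1
            rw [hK, hm]; abel
          have := main z Z (by
            have := Contr.mk c' z₀ a₁ b₁ p a' b' p₀ z (core c p₀ a b a₀ b₀ + Z)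
            rw [hQ, hs]
            rw [wireS_op] at this
            convert this using 1 <;> abel)
          rw [hs] at this
          rwa [hs]
      · obtain ⟨Z, rfl⟩ := exists_eq_singleton_add hm
        have hQ : Q' = core c' p a₁ b₁ a' b' + {cot c' m' a₁ b₁} + {wireS c'.srt p z} +
            {wireS c'.srt.op m' y} + Z := by
          apply Multiset.add_right_inj (s := {wireS c.srt m z₀}) |>.1
          rw [hK]; abel
        have := main z₀ ({wireS c'.srt y z} + Z) (by
          have := Contr.mk c' m' a₁ b₁ p a' b' y z
            (core c p₀ a b a₀ b₀ + {wireS c.srt p₀ z₀} + Z)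
          rw [hQ]
          convert this using 1 <;> abel)
        convert this using 1
        abel

end Conv


/-! ### Structures and sequents as graphs -/

/-- The structural connective of a logical one. -/
def Str.mk {N Atom : Type*} :
    (c : Conn) → Str N Atom c.fstSrt → Str N Atom c.sndSrt → Str N Atom c.srt
  | .tensor => .tensor
  | .oslash => .oslash
  | .obslash => .obslash
  | .plus => .plus
  | .ldiv => .ldiv
  | .rdiv => .rdiv

theorem Str.leaves_mk (c : Conn) (X : Str V Atom c.fstSrt) (Y : Str V Atom c.sndSrt) :
    (Str.mk c X Y).leaves = X.leaves ++ Y.leaves := by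
  cases c <;> rfl

theorem Str.names_mk (c : Conn) (X : Str V Atom c.fstSrt) (Y : Str V Atom c.sndSrt) :
    (Str.mk c X Y).names = X.names ++ Y.names := by
  simp [Str.names, Str.leaves_mk]

/-- The sequent with the structure `X` of sort `s` on one side and `Y` on the other. -/
def cutJudg : (s : Srt) → Tm V .cmd → Str V Atom s → Str V Atom s.op → Judg V Atom
  | .val, C, X, Y => .cmd C X Y
  | .ctx, C, X, Y => .cmd C Y X

/-- The judgement for a value or a context. -/
def focJudg : (s : Srt) → Str V Atom s → Tm V s.kind → Form Atom → Judg V Atom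
  | .val, X, v, A => .val X v A
  | .ctx, Y, e, A => .ctx e A Y

/-- `Rep form X q G`: the structure `X` is represented by the graph `G`, which is to be joined to
the rest of a sequent by a wire at `q`. -/
inductive Rep (form : V → Form Atom) : {s : Srt} → Str V Atom s → V → Multiset (Item V) → Prop
  | leaf (s : Srt) (x : V) : Rep form (.leaf s x (form x)) x 0
  | node (c : Conn) {X : Str V Atom c.fstSrt} {Y : Str V Atom c.sndSrt} {q₁ q₂ a b : V}
      {G₁ G₂ : Multiset (Item V)} (m : V) : Rep form X q₁ G₁ → Rep form Y q₂ G₂ →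
      Rep form (Str.mk c X Y) m (G₁ + G₂ + core c m q₁ q₂ a b)

variable {form : V → Form Atom} {bias : Atom → Pol}

namespace Rep

theorem congr {s : Srt} {X : Str V Atom s} {q : V} {G G' : Multiset (Item V)}
    (h : Rep form X q G) (e : G = G') : Rep form X q G' := e ▸ h

/-- Inversion with the sort equation kept as an explicit cast, so that it applies to structures
whose sort is not a variable. -/
theorem cases' {s : Srt} {X : Str V Atom s} {q : V} {G : Multiset (Item V)} (h : Rep form X q G) :
    (G = 0 ∧ X = .leaf s q (form q)) ∨ ∃ (c : Conn) (e : c.srt = s) (X₁ : Str V Atom c.fstSrt)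
      (X₂ : Str V Atom c.sndSrt) (q₁ q₂ a b : V) (G₁ G₂ : Multiset (Item V)),
      X = e ▸ Str.mk c X₁ X₂ ∧ G = G₁ + G₂ + core c q q₁ q₂ a b ∧ Rep form X₁ q₁ G₁ ∧
        Rep form X₂ q₂ G₂ := by
  cases h with
  | leaf => exact .inl ⟨rfl, rfl⟩
  | node c m h1 h2 => exact .inr ⟨c, rfl, _, _, _, _, _, _, _, _, rfl, rfl, h1, h2⟩

/-- The wire at `q` is not part of `G`. Its end on the side of the structure is the extra summand
`(q, s)`. -/
theorem names_eq {s : Srt} {X : Str V Atom s} {q : V} {G : Multiset (Item V)}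
    (h : Rep form X q G) : (X.names : Multiset (V × Srt)) + ports G = ends G + {(q, s)} := by
  induction h with
  | leaf s x => rfl
  | @node c X Y q₁ q₂ a b G₁ G₂ m h1 h2 ih1 ih2 =>
    rw [Str.names_mk, ← Multiset.coe_add]
    simp only [ports_add, ends_add, ports_core, ends_core]
    calc _ = ((X.names : Multiset _) + ports G₁) + ((Y.names : Multiset _) + ports G₂) +
          ({(a, c.fstSrt.op)} + {(b, c.sndSrt.op)} + {(m, c.srt)}) := by abel
      _ = _ := by rw [ih1, ih2]; abel

theorem form_eq {s : Srt} {X : Str V Atom s} {q : V} {G : Multiset (Item V)}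
    (h : Rep form X q G) : ∀ l ∈ X.leaves, l.2.2 = form l.1 := by
  induction h with
  | leaf s x => simp [Str.leaves]
  | node c m h1 h2 ih1 ih2 =>
    intro l hl
    rw [Str.leaves_mk, List.mem_append] at hl
    exact hl.elim (ih1 l) (ih2 l)

theorem eq_leaf {s : Srt} {X : Str V Atom s} {q : V} {G : Multiset (Item V)}
    (h : Rep form X q G) (hq : (q, s) ∉ ports G) : X = .leaf s q (form q) ∧ G = 0 := by
  rcases h.cases' with ⟨h1, h2⟩ | ⟨c, rfl, X₁, X₂, q₁, q₂, a, b, G₁, G₂, h1, rfl, h3, h4⟩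
  · exact ⟨h2, h1⟩
  · exact absurd (by simp [ports_core]) hq

end Rep

/-! ### Display postulates and distributivity postulates on graphs -/

/-- The command `C` is derivable for the sequent that is represented by `G` and displayed at the
wire from `q` to `p`. -/
def Cut (form : V → Form Atom) (bias : Atom → Pol) (C : Tm V .cmd) (s : Srt) (q p : V)
    (G : Multiset (Item V)) : Prop :=
  ∃ (X : Str V Atom s) (Y : Str V Atom s.op) (G₁ G₂ : Multiset (Item V)), Rep form X q G₁ ∧
    Rep form Y p G₂ ∧ G = G₁ + G₂ + {wireS s q p} ∧ FLG bias (cutJudg s C X Y)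

theorem Cut.symm {C : Tm V .cmd} {s : Srt} {q p : V} {G : Multiset (Item V)}
    (h : Cut form bias C s q p G) : Cut form bias C s.op p q G := by
  obtain ⟨X, Y, G₁, G₂, h1, h2, h3, h4⟩ := h
  rw [add_comm G₁] at h3
  cases s
  · exact ⟨Y, X, G₂, G₁, h2, h1, h3, h4⟩
  · exact ⟨Y, X, G₂, G₁, h2, h1, h3, h4⟩

/-- The structural connectives `⊗`, `\`, `/` share the link `fuse`, and `⊕`, `⊘`, `⦸` share `split`;
they differ only in which vertex is displayed. So residuation isolates `X` without changing the
graph. -/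
theorem display_fst {C : Tm V .cmd} {c : Conn} {X : Str V Atom c.fstSrt} {Y : Str V Atom c.sndSrt}
    {Z : Str V Atom c.srt.op} {q₂ a b m p : V} {G₂ G' : Multiset (Item V)}
    (hY : Rep form Y q₂ G₂) (hZ : Rep form Z p G') (h : FLG bias (cutJudg c.srt C (Str.mk c X Y) Z)) :
    ∃ Z' : Str V Atom c.fstSrt.op, FLG bias (cutJudg c.fstSrt C X Z') ∧
      Rep form Z' a (G₂ + G' + {ten c m a b} + {wireS c.sndSrt q₂ b} + {wireS c.srt m p}) := by
  cases c with
  | tensor =>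
    have := Rep.node .rdiv (a := m) (b := b) a hZ hY
    refine ⟨.rdiv Z Y, .rp₂ h, this.congr ?_⟩
    simp only [core, ten, wireS, Conn.fstSrt, Conn.sndSrt, Conn.srt]; abel
  | oslash =>
    have := Rep.node .plus (a := m) (b := b) a hZ hY
    refine ⟨.plus Z Y, .drp₄ h, this.congr ?_⟩
    simp only [core, ten, wireS, Conn.fstSrt, Conn.sndSrt, Conn.srt]; abel
  | obslash =>
    have := Rep.node .oslash (a := b) (b := m) a hY hZ
    refine ⟨.oslash Y Z, .drp₃ (.drp₁ h), this.congr ?_⟩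
    simp only [core, ten, wireS, Conn.fstSrt, Conn.sndSrt, Conn.srt]; abel
  | plus =>
    have := Rep.node .oslash (a := m) (b := b) a hZ hY
    refine ⟨.oslash Z Y, .drp₃ h, this.congr ?_⟩
    simp only [core, ten, wireS, Conn.fstSrt, Conn.sndSrt, Conn.srt]; abel
  | ldiv =>
    have := Rep.node .rdiv (a := b) (b := m) a hY hZ
    refine ⟨.rdiv Y Z, .rp₂ (.rp₄ h), this.congr ?_⟩
    simp only [core, ten, wireS, Conn.fstSrt, Conn.sndSrt, Conn.srt]; abel
  | rdiv =>
    have := Rep.node .tensor (a := m) (b := b) a hZ hY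
    refine ⟨.tensor Z Y, .rp₁ h, this.congr ?_⟩
    simp only [core, ten, wireS, Conn.fstSrt, Conn.sndSrt, Conn.srt]; abel

theorem display_snd {C : Tm V .cmd} {c : Conn} {X : Str V Atom c.fstSrt} {Y : Str V Atom c.sndSrt}
    {Z : Str V Atom c.srt.op} {q₁ a b m p : V} {G₁ G' : Multiset (Item V)}
    (hX : Rep form X q₁ G₁) (hZ : Rep form Z p G') (h : FLG bias (cutJudg c.srt C (Str.mk c X Y) Z)) :
    ∃ Z' : Str V Atom c.sndSrt.op, FLG bias (cutJudg c.sndSrt C Y Z') ∧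
      Rep form Z' b (G₁ + G' + {ten c m a b} + {wireS c.fstSrt q₁ a} + {wireS c.srt m p}) := by
  cases c with
  | tensor =>
    have := Rep.node .ldiv (a := a) (b := m) b hX hZ
    refine ⟨.ldiv X Z, .rp₃ h, this.congr ?_⟩
    simp only [core, ten, wireS, Conn.fstSrt, Conn.sndSrt, Conn.srt]; abel
  | oslash =>
    have := Rep.node .obslash (a := m) (b := a) b hZ hX
    refine ⟨.obslash Z X, .drp₂ (.drp₄ h), this.congr ?_⟩
    simp only [core, ten, wireS, Conn.fstSrt, Conn.sndSrt, Conn.srt]; abel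
  | obslash =>
    have := Rep.node .plus (a := a) (b := m) b hX hZ
    refine ⟨.plus X Z, .drp₁ h, this.congr ?_⟩
    simp only [core, ten, wireS, Conn.fstSrt, Conn.sndSrt, Conn.srt]; abel
  | plus =>
    have := Rep.node .obslash (a := a) (b := m) b hX hZ
    refine ⟨.obslash X Z, .drp₂ h, this.congr ?_⟩
    simp only [core, ten, wireS, Conn.fstSrt, Conn.sndSrt, Conn.srt]; abel
  | ldiv =>
    have := Rep.node .tensor (a := a) (b := m) b hX hZ
    refine ⟨.tensor X Z, .rp₄ h, this.congr ?_⟩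
    simp only [core, ten, wireS, Conn.fstSrt, Conn.sndSrt, Conn.srt]; abel
  | rdiv =>
    have := Rep.node .ldiv (a := m) (b := a) b hZ hX
    refine ⟨.ldiv Z X, .rp₃ (.rp₁ h), this.congr ?_⟩
    simp only [core, ten, wireS, Conn.fstSrt, Conn.sndSrt, Conn.srt]; abel

theorem Cut.of_wire_eq {C : Tm V .cmd} {s s₀ : Srt} {q p q₀ p₀ : V} {G : Multiset (Item V)}
    (h : Cut form bias C s q p G) (e : wireS s₀ q₀ p₀ = wireS s q p) :
    Cut form bias C s₀ q₀ p₀ G := by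
  rcases Srt.eq_or_eq_op s₀ s with rfl | rfl
  · obtain ⟨rfl, rfl⟩ := wireS_inj e
    exact h
  · rw [wireS_op] at e
    obtain ⟨rfl, rfl⟩ := wireS_inj e
    exact h.symm

/-- From the displayed wire one descends into `X`, one display step for each connective, until the
required wire is reached. -/
theorem Rep.recut {C : Tm V .cmd} {s₀ : Srt} {q₀ p₀ : V} {s : Srt} {X : Str V Atom s} {q : V}
    {G : Multiset (Item V)} (hX : Rep form X q G) : ∀ {Y : Str V Atom s.op} {p : V}
    {G' : Multiset (Item V)}, Rep form Y p G' → FLG bias (cutJudg s C X Y) →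
    wireS s₀ q₀ p₀ ∈ G → Cut form bias C s₀ q₀ p₀ (G + G' + {wireS s q p}) := by
  induction hX with
  | leaf s x => intro Y p G' _ _ h; exact absurd h (Multiset.notMem_zero _)
  | @node c X₁ X₂ q₁ q₂ a b G₁ G₂ m h1 h2 ih1 ih2 =>
    intro Y p G' hY hC hw
    obtain ⟨Z₁, hZ₁, hr₁⟩ := display_fst (a := a) (b := b) (m := m) h2 hY hC
    obtain ⟨Z₂, hZ₂, hr₂⟩ := display_snd (a := a) (b := b) (m := m) h1 hY hC
    have e₁ : G₁ + G₂ + core c m q₁ q₂ a b + G' + {wireS c.srt m p} = G₁ +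
        (G₂ + G' + {ten c m a b} + {wireS c.sndSrt q₂ b} + {wireS c.srt m p}) +
          {wireS c.fstSrt q₁ a} := by
      simp only [core]; abel
    have e₂ : G₁ + G₂ + core c m q₁ q₂ a b + G' + {wireS c.srt m p} = G₂ +
        (G₁ + G' + {ten c m a b} + {wireS c.fstSrt q₁ a} + {wireS c.srt m p}) +
          {wireS c.sndSrt q₂ b} := by
      simp only [core]; abel
    simp only [core, Multiset.mem_add, Multiset.mem_singleton] at hw
    rcases hw with (hw | hw) | ((hw | hw) | hw)
    · rw [e₁]; exact ih1 hr₁ hZ₁ hw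
    · rw [e₂]; exact ih2 hr₂ hZ₂ hw
    · exact absurd hw.symm (ten_ne_wireS _ _ _ _ _ _ _)
    · exact Cut.of_wire_eq ⟨_, _, _, _, h1, hr₁, e₁, hZ₁⟩ hw
    · exact Cut.of_wire_eq ⟨_, _, _, _, h2, hr₂, e₂, hZ₂⟩ hw

/-- A sequent can be displayed at every wire. -/
theorem Cut.recut {C : Tm V .cmd} {s s₀ : Srt} {q p q₀ p₀ : V} {G : Multiset (Item V)}
    (h : Cut form bias C s q p G) (hw : wireS s₀ q₀ p₀ ∈ G) : Cut form bias C s₀ q₀ p₀ G := by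
  obtain ⟨X, Y, G₁, G₂, h1, h2, rfl, h4⟩ := id h
  simp only [Multiset.mem_add, Multiset.mem_singleton] at hw
  rcases hw with (hw | hw) | hw
  · exact h1.recut h2 h4 hw
  · rw [add_comm G₁, ← wireS_op]
    cases s
    · exact Rep.recut (s := .ctx) h2 (Y := X) h1 h4 hw
    · exact Rep.recut (s := .val) h2 (Y := X) h1 h4 hw
  · exact h.of_wire_eq hw

/-- A leaf would contribute `(q, s)` as a label although a link is already attached there. -/
theorem Rep.not_leaf {s : Srt} {q : V} {G₁ : Multiset (Item V)} {X : Str V Atom s}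
    (h : Rep form X q G₁) {H : Multiset (Item V)} (hnd : (ends H).Nodup)
    (hle : (X.names : Multiset (V × Srt)) + ports H ≤ ends H) (hq : (q, s) ∈ ports H) :
    X ≠ .leaf s q (form q) := by
  rintro rfl
  have := Multiset.nodup_of_le hle hnd
  exact not_mem_of_nodup_add this (by simp [Str.names, Str.leaves]) hq

theorem Cut.names_eq {s : Srt} {X : Str V Atom s} {Y : Str V Atom s.op} {q p : V}
    {G₁ G₂ : Multiset (Item V)} (h1 : Rep form X q G₁) (h2 : Rep form Y p G₂) :
    (X.names : Multiset (V × Srt)) + (Y.names : Multiset (V × Srt)) + ports (G₁ + G₂ + {wireS s q p}) =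
      ends (G₁ + G₂ + {wireS s q p}) := by
  simp only [ports_add, ends_add, ports_singleton, ends_singleton, ports_wireS, ends_wireS]
  calc _ = ((X.names : Multiset _) + ports G₁) + ((Y.names : Multiset _) + ports G₂) := by abel
    _ = _ := by rw [h1.names_eq, h2.names_eq]; abel

theorem Good.of_rep {s : Srt} {X : Str V Atom s} {Y : Str V Atom s.op} {q p : V}
    {G₁ G₂ : Multiset (Item V)} (h1 : Rep form X q G₁) (h2 : Rep form Y p G₂)
    (hnd : (ends (G₁ + G₂ + {wireS s q p})).Nodup) : Good (G₁ + G₂ + {wireS s q p}) :=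
  ⟨hnd, by rw [← Cut.names_eq h1 h2]; exact Multiset.le_add_left _ _⟩

/-- The sequent is displayed at the internal wire. The `fuse` above it makes the left side a
`⊗`-structure and the `split` below it makes the right side a `⊕`-structure, which is the premise of
the distributivity postulates. The four swaps are the four postulates, with `g₂` and `g₄` exchanged
in the numbering. -/
theorem Cut.inter {C : Tm V .cmd} {s : Srt} {q p : V} {G H : Multiset (Item V)}
    (h : Cut form bias C s q p G) (hnd : (ends G).Nodup) (hi : Inter G H) :
    ∃ s q p, Cut form bias C s q p H := by
  cases hi with
  | @mk x y m m' v w S M G₀ hs =>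
    obtain ⟨X, Y, G₁, G₂, h1, h2, h3, h4⟩ := h.recut (s₀ := .val) (q₀ := m) (p₀ := m') (by simp [wireS])
    have hgood : Good (G₁ + G₂ + {wireS .val m m'}) := Good.of_rep h1 h2 (h3 ▸ hnd)
    have hnames := Cut.names_eq h1 h2
    rw [← h3] at hgood hnames
    have hX : X ≠ .leaf _ m (form m) := h1.not_leaf hgood.nodup
      (by rw [← hnames]; gcongr; exact Multiset.le_add_right _ _)
      (mem_ports.2 ⟨fuse x y m, by simp, by simp [Item.ports]⟩)
    have hY : Y ≠ .leaf _ m' (form m') := h2.not_leaf hgood.nodup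
      (by rw [← hnames]; gcongr; exact Multiset.le_add_left _ _)
      (mem_ports.2 ⟨split m' v w, by simp, by simp [Item.ports]⟩)
    rcases h1.cases' with h1 | ⟨c, e, X₁, X₂, q₁, q₂, a, b, K₁, K₂, rfl, rfl, hX₁, hX₂⟩
    · exact absurd h1.2 hX
    rcases h2.cases' with h2 | ⟨c', e', Y₁, Y₂, p₁, p₂, a', b', L₁, L₂, rfl, rfl, hY₁, hY₂⟩
    · exact absurd h2.2 hY
    have e₁ : ten c m a b = fuse x y m := hgood.eq_of_port (x := (m, .val))
      (by rw [h3]; simp [core]) (by simp) (by simp [ports_ten, e]) (by simp [Item.ports])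
    have e₂ : ten c' m' a' b' = split m' v w := hgood.eq_of_port (x := (m', .ctx))
      (by rw [h3]; simp [core]) (by simp) (by simp [ports_ten, e']) (by simp [Item.ports])
    have hG₀ : G₀ = K₁ + K₂ + {wireS c.fstSrt q₁ a} + {wireS c.sndSrt q₂ b} + (L₁ + L₂ +
        {wireS c'.fstSrt p₁ a'} + {wireS c'.sndSrt p₂ b'}) := by
      apply Multiset.add_right_inj (s := {fuse x y m} + {wire m m'} + {split m' v w}) |>.1
      rw [h3, ← e₁, ← e₂]
      simp only [core, wireS]; abel
    -- Only `⊗` has a `fuse` with a main vertex of sort `val`, and only `⊕` has a `split` with a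
    -- main vertex of sort `ctx`.
    cases c <;> simp only [ten, reduceCtorEq, fuse.injEq, Conn.srt] at e₁ e
    cases c' <;> simp only [ten, reduceCtorEq, split.injEq, Conn.srt, Srt.op] at e₂ e'
    obtain ⟨rfl, rfl, -⟩ := e₁
    obtain ⟨-, rfl, rfl⟩ := e₂
    subst hG₀
    cases hs with
    | g₁ =>
      have r1 := Rep.node .obslash (a := a') (b := a) m hY₁ hX₁
      have r2 := Rep.node .rdiv (a := b') (b := b) m' hY₂ hX₂
      refine ⟨.val, m, m', _, _, _, _, r1, r2, ?_, FLG.g₁ h4⟩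
      simp only [core, ten, wireS, Conn.fstSrt, Conn.sndSrt]; abel
    | g₂ =>
      have r1 := Rep.node .oslash (a := a) (b := b') m hX₁ hY₂
      have r2 := Rep.node .rdiv (a := a') (b := b) m' hY₁ hX₂
      refine ⟨.val, m, m', _, _, _, _, r1, r2, ?_, FLG.g₄ h4⟩
      simp only [core, ten, wireS, Conn.fstSrt, Conn.sndSrt]; abel
    | g₃ =>
      have r1 := Rep.node .oslash (a := b) (b := b') m hX₂ hY₂
      have r2 := Rep.node .ldiv (a := a) (b := a') m' hX₁ hY₁
      refine ⟨.val, m, m', _, _, _, _, r1, r2, ?_, FLG.g₃ h4⟩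
      simp only [core, ten, wireS, Conn.fstSrt, Conn.sndSrt]; abel
    | g₄ =>
      have r1 := Rep.node .obslash (a := a') (b := b) m hY₁ hX₂
      have r2 := Rep.node .ldiv (a := a) (b := b') m' hX₁ hY₂
      refine ⟨.val, m, m', _, _, _, _, r1, r2, ?_, FLG.g₂ h4⟩
      simp only [core, ten, wireS, Conn.fstSrt, Conn.sndSrt]; abel

theorem Cut.inters {C : Tm V .cmd} {s : Srt} {q p : V} {G H : Multiset (Item V)}
    (h : Cut form bias C s q p G) (hnd : (ends G).Nodup) (hi : Inters G H) :
    ∃ s q p, Cut form bias C s q p H := by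
  induction hi with
  | refl => exact ⟨_, _, _, h⟩
  | tail hi h' ih =>
    obtain ⟨_, _, _, ih⟩ := ih
    exact ih.inter (by rw [Inters.ends_eq hi]; exact hnd) h'

/-! ### Derivations from fully contracted graphs -/

/-- The link and its main vertex determine the connective unless an active port coincides with the
main one: `\` and `/` could give the same `fuse` if both its premisses were `m`, and `⊘` and `⦸` the
same `split`. The side conditions exclude this. -/
theorem ten_inj {c c' : Conn} {m a b a' b' : V} (h : ten c m a b = ten c' m a' b')
    (hs : c.srt = c'.srt) (ha : (a, c.fstSrt.op) ≠ (m, c.srt)) (hb : (b, c.sndSrt.op) ≠ (m, c.srt)) :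
    c = c' ∧ a = a' ∧ b = b' := by
  cases c <;> cases c' <;> simp [ten, Conn.srt, Conn.fstSrt, Conn.sndSrt] at h hs ha hb ⊢ <;> tauto

theorem FLG.binary {c : Conn} {X : Str V Atom c.fstSrt} {Y : Str V Atom c.sndSrt}
    {t₁ : Tm V c.fstSrt.kind} {t₂ : Tm V c.sndSrt.kind} {A B : Form Atom}
    (hd : X.names.Disjoint Y.names) (h1 : FLG bias (focJudg c.fstSrt X t₁ A))
    (h2 : FLG bias (focJudg c.sndSrt Y t₂ B)) :
    FLG bias (focJudg c.srt (Str.mk c X Y) (Tm.mk c t₁ t₂) (.bin c A B)) := by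
  cases c
  · exact .tensorR hd h1 h2
  · exact .oslashR hd h1 h2
  · exact .obslashR hd h1 h2
  · exact .plusL hd h1 h2
  · exact .ldivL hd h1 h2
  · exact .rdivL hd h1 h2

theorem FLG.frac {c : Conn} {a b m : V} {A B : Form Atom} {C : Tm V .cmd}
    {Y : Str V Atom c.srt.op} (hm : (m, c.srt) ∉ Y.names)
    (h : FLG bias (cutJudg c.srt C (Str.mk c (.leaf _ a A) (.leaf _ b B)) Y)) :
    FLG bias (cutJudg c.srt (.frac c a b m C) (.leaf _ m (.bin c A B)) Y) := by
  cases c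
  · exact .tensorL hm h
  · exact .oslashL hm h
  · exact .obslashL hm h
  · exact .plusR hm h
  · exact .ldivR hm h
  · exact .rdivR hm h

/-- Derivability of a value or a context, up to interactions. -/
def Foc (form : V → Form Atom) (bias : Atom → Pol) (s : Srt) (v : V) (t : Tm V s.kind)
    (G : Multiset (Item V)) : Prop :=
  ∃ (X : Str V Atom s) (q : V) (G' : Multiset (Item V)), Rep form X q G' ∧
    Inters (G' + {wireS s q v}) G ∧ FLG bias (focJudg s X t (form v))

/-- Derivability of a term for a graph. -/
def Der (form : V → Form Atom) (bias : Atom → Pol) : (k : Kind) → V → Tm V k →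
    Multiset (Item V) → Prop
  | .val, v, t, G => Foc form bias .val v t G
  | .ctx, v, t, G => Foc form bias .ctx v t G
  | .cmd, _, C, G => ∃ s q p, Cut form bias C s q p G

theorem der_kind (s : Srt) (v : V) (t : Tm V s.kind) (G : Multiset (Item V)) :
    Der form bias s.kind v t G ↔ Foc form bias s v t G := by
  cases s <;> rfl

/-- A derivable command whose sequent has the label `v` can be turned into a sequent with `v`
displayed. -/
theorem Cut.display {C : Tm V .cmd} {s : Srt} {q p v : V} {s₀ : Srt} {G : Multiset (Item V)}
    (h : Cut form bias C s q p G) (hv : (v, s₀.op) ∈ ends G) (hv' : (v, s₀.op) ∉ ports G) :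
    ∃ (X : Str V Atom s₀) (q : V) (G' : Multiset (Item V)), Rep form X q G' ∧
      G' + {wireS s₀ q v} = G ∧ FLG bias (cutJudg s₀ C X (.leaf _ v (form v))) := by
  obtain ⟨N, hN, hx⟩ := mem_ends.1 hv
  obtain ⟨y, rfl⟩ := eq_wireS_of_mem_ends hx
  rw [wireS_op] at hN
  obtain ⟨X, Y, G₁, G₂, h1, h2, rfl, h4⟩ := h.recut hN
  obtain ⟨rfl, rfl⟩ := h2.eq_leaf fun h => hv' (by simp [h])
  exact ⟨X, y, G₁, h1, by simp, h4⟩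

/-- Each rule of `Conv` becomes a rule of fLG. Structural rules act on commands only, so
interactions below a tensor link are kept pending in `Foc` and carried out once a command is formed.
For `mu` and `comu` the bound label is displayed. For `contr` the wire at `p` is displayed, where
the structure must join the two active leaves, and the invertible rule applies. The rule `frac`
cannot occur, since no cotensor link is left. -/
theorem Conv.der {k : Kind} {v : V} {t : Tm V k} {Δ : Multiset (V × Srt)} {G : Multiset (Item V)}
    (h : Conv form bias k v t Δ G) (hc : ∀ c m a b, cot c m a b ∉ G) :
    Der form bias k v t G := by
  induction h with
  | var v hp => exact ⟨_, v, _, .leaf _ v, by simpa [wireS] using .refl, .ax v _ hp⟩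
  | covar v hp => exact ⟨_, v, _, .leaf _ v, by simpa [wireS] using .refl, .coax v _ hp⟩
  | @ten c m a b t₁ t₂ Δ₁ Δ₂ G₁ G₂ G hform h1 h2 hnd hG ih1 ih2 =>
    have hc' : ∀ c' m' a' b', cot c' m' a' b' ∉ G₁ + G₂ := by
      intro c' m' a' b' hmem
      exact hc c' m' a' b' ((hG.cot_mem_iff c' m' a' b').1 (Multiset.mem_add.2 (.inl hmem)))
    have ih1 := ih1 fun c m a b h => hc' c m a b (Multiset.mem_add.2 (.inl h))
    have ih2 := ih2 fun c m a b h => hc' c m a b (Multiset.mem_add.2 (.inr h))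
    rw [der_kind] at ih1 ih2 ⊢
    obtain ⟨X₁, q₁, K₁, r1, i1, f1⟩ := ih1
    obtain ⟨X₂, q₂, K₂, r2, i2, f2⟩ := ih2
    have hn : ∀ {s : Srt} {X : Str V Atom s} {q v : V} {K H}, Rep form X q K →
        Inters (K + {wireS s q v}) H → ∀ x ∈ X.names, x ∈ ends H := by
      intro s X q v K H hr hi x hx
      rw [hi.ends_eq, ends_add, ends_singleton, ends_wireS, ← add_assoc, ← hr.names_eq]
      simp [hx]
    refine ⟨Str.mk c X₁ X₂, m, _, Rep.node c m r1 r2 (a := a) (b := b), ?_, ?_⟩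
    · refine Relation.ReflTransGen.trans ?_ hG
      have := (i1.add_right ((K₂ + {wireS c.sndSrt q₂ b}) + ({Item.ten c m a b} + {wire m m}))).trans
        ((i2.add_right ({Item.ten c m a b} + {wire m m})).add_left G₁)
      convert this using 1
      · simp only [core, wireS_self]; abel
      · abel
    · rw [hform]
      refine FLG.binary ?_ f1 f2
      intro x h3 h4
      rw [ends_add, ends_add] at hnd
      exact not_mem_of_nodup_add (Multiset.nodup_add.1 hnd).1 (hn r1 i1 x h3) (hn r2 i2 x h4)
  | @cmdL v E Δ G hp h ih =>
    obtain ⟨Y, q, K, hr, hi, hf⟩ := ih hc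
    have hnd : (ends (K + {wireS .ctx q v})).Nodup := by rw [← hi.ends_eq]; exact h.nodup
    refine Cut.inters (s := .ctx) (q := q) (p := v) ⟨Y, .leaf _ v (form v), K, 0, hr, .leaf _ _,
      by simp, .comuStar v hp ?_ hf⟩ hnd hi
    intro hv
    rw [ends_add, ends_singleton, ends_wireS, ← add_assoc, ← hr.names_eq] at hnd
    exact not_mem_of_nodup_add hnd (Multiset.mem_add.2 (.inl (Multiset.mem_coe.2 hv))) (by simp)
  | @cmdR v U Δ G hp h ih =>
    obtain ⟨X, q, K, hr, hi, hf⟩ := ih hc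
    have hnd : (ends (K + {wireS .val q v})).Nodup := by rw [← hi.ends_eq]; exact h.nodup
    refine Cut.inters (s := .val) (q := q) (p := v) ⟨X, .leaf _ v (form v), K, 0, hr, .leaf _ _,
      by simp, .muStar v hp ?_ hf⟩ hnd hi
    intro hv
    rw [ends_add, ends_singleton, ends_wireS, ← add_assoc, ← hr.names_eq] at hnd
    exact not_mem_of_nodup_add hnd (Multiset.mem_add.2 (.inl (Multiset.mem_coe.2 hv))) (by simp)
  | @mu u α C Δ G hp h ih =>
    obtain ⟨s, q, p, hC⟩ := ih hc
    obtain ⟨X, q, K, hr, rfl, hf⟩ := hC.display (v := α) (s₀ := .val)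
      (by rw [h.ends_eq]; simp) (h.not_mem_ports (by simp))
    exact ⟨X, q, K, hr, .refl, .mu α hp hf⟩
  | @comu u x C Δ G hp h ih =>
    obtain ⟨s, q, p, hC⟩ := ih hc
    obtain ⟨X, q, K, hr, rfl, hf⟩ := hC.display (v := x) (s₀ := .ctx)
      (by rw [h.ends_eq]; simp) (h.not_mem_ports (by simp))
    exact ⟨X, q, K, hr, .refl, .comu x hp hf⟩
  | @frac u c m a b C Δ G hform h hnd ih => exact absurd (by simp) (hc c m a b)
  | @contr u c m a b p z a' b' C Δ Q hform h hnd ih =>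
    obtain ⟨s, q₀, p₀, hC⟩ := ih (by
      intro c' m' a₁ b₁ hmem
      refine hc c' m' a₁ b₁ ?_
      simpa [cot_not_mem_core, cot_ne_wireS] using hmem)
    obtain ⟨X, Y, G₁, G₂, h1, h2, h3, h4⟩ := hC.recut (s₀ := c.srt) (q₀ := p) (p₀ := z) (by simp)
    have hgood := h.good
    have hnames := Cut.names_eq h1 h2
    rw [← h3] at hnames
    have hX : X ≠ .leaf _ p (form p) := h1.not_leaf hgood.nodup
      (by rw [← hnames]; gcongr; exact Multiset.le_add_right _ _)
      (by simp [ports_core])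
    rcases h1.cases' with h1 | ⟨c', e, X₁, X₂, q₁, q₂, a₁, b₁, K₁, K₂, hX', rfl, hX₁, hX₂⟩
    · exact absurd h1.2 hX
    -- The outermost connective of `X` is attached at `p`, where the core has its tensor link, so
    -- the two links are the same.
    have e₁ : Item.ten c p a' b' = Item.ten c' p a₁ b₁ := hgood.eq_of_port (x := (p, c.srt))
      (by simp [core]) (by rw [h3]; simp [core]) (by simp [ports_ten]) (by simp [ports_ten, e])
    have hpn := hgood.ports_nodup
    rw [ports_add, ports_add, ports_core] at hpn
    have hpn := (Multiset.nodup_add.1 (Multiset.nodup_add.1 hpn).1).1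
    obtain ⟨rfl, rfl, rfl⟩ := ten_inj e₁ e.symm
      (fun h => not_mem_of_nodup_add hpn (a := (p, c.srt)) (by simp [h]) (by simp))
      (fun h => not_mem_of_nodup_add hpn (a := (p, c.srt)) (by simp [h]) (by simp))
    have hq₁ : q₁ = a := by
      have := hgood.eq_of_end (N := wireS c.fstSrt a a') (N' := wireS c.fstSrt q₁ a')
        (x := (a', c.fstSrt.op)) (by simp [core]) (by rw [h3]; simp [core])
        (by simp [ends_wireS]) (by simp [ends_wireS])
      exact (wireS_inj this).1.symm
    have hq₂ : q₂ = b := by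
      have := hgood.eq_of_end (N := wireS c.sndSrt b b') (N' := wireS c.sndSrt q₂ b')
        (x := (b', c.sndSrt.op)) (by simp [core]) (by rw [h3]; simp [core])
        (by simp [ends_wireS]) (by simp [ends_wireS])
      exact (wireS_inj this).1.symm
    subst hq₁ hq₂
    -- The active vertices are labels of `C`, and no link is attached to a label. Hence both
    -- immediate substructures are leaves.
    have hna := h.not_mem_ports (x := (q₁, c.fstSrt)) (by simp)
    have hnb := h.not_mem_ports (x := (q₂, c.sndSrt)) (by simp)
    rw [h3] at hna hnb
    obtain ⟨rfl, rfl⟩ := hX₁.eq_leaf fun h => hna (by simp [h])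
    obtain ⟨rfl, rfl⟩ := hX₂.eq_leaf fun h => hnb (by simp [h])
    have hX'' : X = Str.mk c (.leaf _ q₁ (form q₁)) (.leaf _ q₂ (form q₂)) := hX'
    subst hX''
    have hQ : Q = G₂ := by
      apply Multiset.add_right_inj (s := core c p q₁ q₂ a' b' + {wireS c.srt p z}) |>.1
      rw [h3]; abel
    subst hQ
    refine ⟨c.srt, m, z, .leaf _ m (form m), Y, 0, Q, .leaf _ _, h2, by abel, ?_⟩
    rw [hform]
    refine FLG.frac ?_ h4
    intro hm
    rw [ends_add, ← hnames] at hnd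
    refine not_mem_of_nodup_add hnd (a := (m, c.srt)) (by simp [hm]) ?_
    rw [ends_wire_self c.srt]; simp


/-! ### Abstract proof structures as graphs -/

/-- `Img G N l`: the link `N` of the graph `G` is the abstract link `l`, where wires are named by
their sources. -/
inductive Img (G : Multiset (Item V)) : Item V → ALink V → Prop
  | fuse {x y m s t : V} : wire s x ∈ G → wire t y ∈ G → Img G (fuse x y m) ⟨[s, t], [m], none⟩
  | split {m v w s : V} : wire s m ∈ G → Img G (split m v w) ⟨[s], [v, w], none⟩
  | tensor {m a b s : V} : wire s m ∈ G → Img G (cot .tensor m a b) ⟨[s], [a, b], some s⟩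
  | oslash {m a b s t : V} : wire s m ∈ G → wire t b ∈ G →
      Img G (cot .oslash m a b) ⟨[s, t], [a], some s⟩
  | obslash {m a b s t : V} : wire s a ∈ G → wire t m ∈ G →
      Img G (cot .obslash m a b) ⟨[s, t], [b], some t⟩
  | plus {m a b s t : V} : wire s a ∈ G → wire t b ∈ G →
      Img G (cot .plus m a b) ⟨[s, t], [m], some m⟩
  | ldiv {m a b s : V} : wire s b ∈ G → Img G (cot .ldiv m a b) ⟨[s], [a, m], some m⟩
  | rdiv {m a b s : V} : wire s a ∈ G → Img G (cot .rdiv m a b) ⟨[s], [m, b], some m⟩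

namespace Img

variable {G G' : Multiset (Item V)} {N N' : Item V} {l l' : ALink V}

theorem ne_wire (h : Img G N l) (s p : V) : N ≠ wire s p := by
  cases h <;> simp

theorem ne_wireS (h : Img G N l) (t : Srt) (s p : V) : N ≠ wireS t s p := by
  cases t <;> exact h.ne_wire _ _

/-- An abstract link names its premisses by the sources of the arriving wires and its conclusions by
its own ports. A renaming therefore has to follow the former and fix the latter. -/
theorem map (h : Img G N l) {f : V → V}
    (h1 : ∀ s q, (q, .ctx) ∈ N.ports → wire s q ∈ G → wire (f s) q ∈ G')
    (h2 : ∀ v, (v, .val) ∈ N.ports → f v = v) : Img G' N (l.map f) := by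
  cases h <;>
    simp only [Item.ports, Conn.fstSrt, Conn.sndSrt, Conn.srt, Srt.op, Multiset.mem_add,
      Multiset.mem_singleton, Prod.mk.injEq, and_true, and_false, or_false, false_or,
      reduceCtorEq, forall_eq_or_imp, forall_eq] at h1 h2 <;>
    simp only [ALink.map, List.map_cons, List.map_nil, Option.map_some, Option.map_none, h2]
  · exact .fuse ((h1 _).1 ‹_›) ((h1 _).2 ‹_›)
  · exact .split (h1 _ ‹_›)
  · exact .tensor (h1 _ ‹_›)
  · exact .oslash ((h1 _).2 ‹_›) ((h1 _).1 ‹_›)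
  · exact .obslash ((h1 _).1 ‹_›) ((h1 _).2 ‹_›)
  · exact .plus ((h1 _).1 ‹_›) ((h1 _).2 ‹_›)
  · exact .ldiv (h1 _ ‹_›)
  · exact .rdiv (h1 _ ‹_›)

theorem congr (h : Img G N l) (h1 : ∀ s q, wire s q ∈ G → wire s q ∈ G') : Img G' N l := by
  have := h.map (f := id) (G' := G') (fun s q _ => h1 s q) fun _ _ => rfl
  simpa [ALink.map] using this

theorem mem_ports (h : Img G N l) {v : V} (hv : v ∈ l.concls) : (v, .val) ∈ N.ports := by
  cases h <;> simp at hv <;> (try rcases hv with rfl | rfl) <;> try subst hv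
  all_goals simp [Item.ports, Conn.fstSrt, Conn.sndSrt, Conn.srt]

theorem concls_ne_nil (h : Img G N l) : ∃ v, v ∈ l.concls := by
  cases h <;> simp

theorem unique_item (hG : Good G) (hN : N ∈ G) (hN' : N' ∈ G) (h : Img G N l)
    (h' : Img G N' l) : N = N' := by
  obtain ⟨v, hv⟩ := h.concls_ne_nil
  exact hG.eq_of_port hN hN' (h.mem_ports hv) (h'.mem_ports hv)

end Img

theorem Good.source_unique {G : Multiset (Item V)} (hG : Good G) {s t p : V} (h : wire s p ∈ G)
    (h' : wire t p ∈ G) : s = t := by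
  have := hG.eq_of_end h h' (x := (p, .ctx)) (by simp [Item.ends]) (by simp [Item.ends])
  simpa using this

namespace Img

variable {G G' : Multiset (Item V)} {N N' : Item V} {l l' : ALink V}

theorem unique_link (hG : Good G) (h : Img G N l) (h' : Img G N l') : l = l' := by
  cases h <;> cases h' <;> simp only [ALink.mk.injEq, List.cons.injEq, and_true, true_and,
    Option.some.injEq] <;> repeat' apply And.intro
  all_goals exact hG.source_unique ‹_› ‹_›

theorem exists_link (hG : Good G) (hN : N ∈ G) (hw : ∀ s p, N ≠ wire s p) :
    ∃ l, Img G N l := by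
  have key : ∀ q, (q, Srt.ctx) ∈ N.ports → ∃ s, wire s q ∈ G := fun q hq =>
    hG.exists_wireS (LG.mem_ports.2 ⟨N, hN, hq⟩)
  cases N with
  | wire s p => exact absurd rfl (hw s p)
  | fuse x y m =>
    obtain ⟨s, hs⟩ := key x (by simp [Item.ports])
    obtain ⟨t, ht⟩ := key y (by simp [Item.ports])
    exact ⟨_, .fuse hs ht⟩
  | split m v w =>
    obtain ⟨s, hs⟩ := key m (by simp [Item.ports])
    exact ⟨_, .split hs⟩
  | cot c m a b =>
    cases c with
    | tensor =>
      obtain ⟨s, hs⟩ := key m (by simp [Item.ports, Conn.srt])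
      exact ⟨_, .tensor hs⟩
    | oslash =>
      obtain ⟨s, hs⟩ := key m (by simp [Item.ports, Conn.srt])
      obtain ⟨t, ht⟩ := key b (by simp [Item.ports, Conn.sndSrt])
      exact ⟨_, .oslash hs ht⟩
    | obslash =>
      obtain ⟨s, hs⟩ := key a (by simp [Item.ports, Conn.fstSrt])
      obtain ⟨t, ht⟩ := key m (by simp [Item.ports, Conn.srt])
      exact ⟨_, .obslash hs ht⟩
    | plus =>
      obtain ⟨s, hs⟩ := key a (by simp [Item.ports, Conn.fstSrt])
      obtain ⟨t, ht⟩ := key b (by simp [Item.ports, Conn.sndSrt])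
      exact ⟨_, .plus hs ht⟩
    | ldiv =>
      obtain ⟨s, hs⟩ := key b (by simp [Item.ports, Conn.sndSrt])
      exact ⟨_, .ldiv hs⟩
    | rdiv =>
      obtain ⟨s, hs⟩ := key a (by simp [Item.ports, Conn.fstSrt])
      exact ⟨_, .rdiv hs⟩

theorem main_ne_none {c : Conn} {m a b : V} (h : Img G (cot c m a b) l) : l.main ≠ none := by
  cases h <;> simp

end Img

/-! ### Conversions of abstract proof structures, simulated on graphs -/

/-- The links of the abstract proof structure `A` are those of the graph `G`. -/
def Rel (A : APS V) (G : Multiset (Item V)) : Prop :=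
  ∀ l, l ∈ A.links ↔ ∃ N ∈ G, Img G N l

/-- Contraction in abstract proof structures is contraction of graphs. -/
theorem Rel.contr {A : APS V} {t k : ALink V} {c : Conn} {m a b p a' b' y z low up : V}
    {Z : Multiset (Item V)} {S : Set V}
    (hR : Rel A (core c p a b a' b' + {cot c m a b} + {wireS c.srt p z} + {wireS c.srt.op m y} + Z))
    (hG : Good (core c p a b a' b' + {cot c m a b} + {wireS c.srt p z} + {wireS c.srt.op m y} + Z))
    (ht : Img (core c p a b a' b' + {cot c m a b} + {wireS c.srt p z} + {wireS c.srt.op m y} + Z)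
      (ten c p a' b') t)
    (hk : Img (core c p a b a' b' + {cot c m a b} + {wireS c.srt p z} + {wireS c.srt.op m y} + Z)
      (cot c m a b) k)
    (hlow : (c.srt = .val ∧ low = p ∧ up = y) ∨ (c.srt = .ctx ∧ low = m ∧ up = z))
    (hG' : Good ({wireS c.srt y z} + Z)) :
    Rel ⟨S, ALink.map (merge low up) '' (A.links \ {t, k})⟩ ({wireS c.srt y z} + Z) := by
  set G := core c p a b a' b' + {cot c m a b} + {wireS c.srt p z} + {wireS c.srt.op m y} + Z
    with hGdef
  have hT : ten c p a' b' ∈ G := by simp [hGdef, core]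
  have hK : cot c m a b ∈ G := by simp [hGdef]
  have hpT : (p, c.srt) ∈ (ten c p a' b').ports := by simp [ports_ten]
  have haT : (a', c.fstSrt.op) ∈ (ten c p a' b').ports := by simp [ports_ten]
  have hbT : (b', c.sndSrt.op) ∈ (ten c p a' b').ports := by simp [ports_ten]
  have hmK : (m, c.srt.op) ∈ (cot c m a b).ports := by simp [Item.ports]
  have haK : (a, c.fstSrt) ∈ (cot c m a b).ports := by simp [Item.ports]
  have hbK : (b, c.sndSrt) ∈ (cot c m a b).ports := by simp [Item.ports]
  have hnd := hG.items_nodup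
  have hZG : ∀ N ∈ Z, N ∈ G := fun N hN => Multiset.mem_add.2 (.inr hN)
  have hZne : ∀ N ∈ Z, N ≠ ten c p a' b' ∧ N ≠ cot c m a b := by
    intro N hN
    constructor <;> rintro rfl <;> refine not_mem_of_nodup_add hnd ?_ hN <;> simp [core]
  have hport : ∀ N ∈ Z, ∀ x ∈ N.ports, x ∉ (ten c p a' b').ports ∧ x ∉ (cot c m a b).ports :=
    fun N hN x hx => ⟨fun h => (hZne N hN).1 (hG.eq_of_port (hZG N hN) hT hx h),
      fun h => (hZne N hN).2 (hG.eq_of_port (hZG N hN) hK hx h)⟩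
  -- The renamed vertex `low` is a conclusion of one of the two links that disappear, so the
  -- conclusions of the surviving links keep their names.
  have hval : ∀ N ∈ Z, ∀ v, (v, Srt.val) ∈ N.ports → merge low up v = v := by
    intro N hN v hv
    have hv' := hport N hN _ hv
    have : v ≠ low := by
      rintro rfl
      rcases hlow with ⟨hs, rfl, -⟩ | ⟨hs, rfl, -⟩
      · exact hv'.1 (hs ▸ hpT)
      · rw [hs] at hmK; exact hv'.2 hmK
    simp [merge, this]
  -- Among the wires into premisses of surviving links, only the lower outer wire of the redex
  -- changes. It started at `low`, and its replacement in the contracted graph starts at `up`.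
  have hwire : ∀ N ∈ Z, ∀ s q, (q, Srt.ctx) ∈ N.ports → wire s q ∈ G →
      wire (merge low up s) q ∈ {wireS c.srt y z} + Z := by
    intro N hN s q hq hs
    have hq' := hport N hN _ hq
    have hend : ∀ t u w, wire s q = wireS t u w → (q, Srt.ctx) = (u, t) ∨ (q, Srt.ctx) = (w, t.op) := by
      intro t u w e
      cases t <;> simp [wireS] at e ⊢ <;> tauto
    simp only [hGdef, core, Multiset.mem_add, Multiset.mem_singleton] at hs
    rcases hs with ((((( h | h) | h) | h) | h) | h) | h
    · exact absurd h.symm (ten_ne_wire _ _ _ _ _ _)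
    · rcases hend _ _ _ h with e | e
      · exact absurd (e ▸ haK) hq'.2
      · exact absurd (e ▸ haT) hq'.1
    · rcases hend _ _ _ h with e | e
      · exact absurd (e ▸ hbK) hq'.2
      · exact absurd (e ▸ hbT) hq'.1
    · simp at h
    · rcases hend _ _ _ h with e | e
      · exact absurd (e ▸ hpT) hq'.1
      · rcases hlow with ⟨hs, rfl, rfl⟩ | ⟨hs, rfl, rfl⟩
        · rw [hs] at h ⊢
          simp only [wireS, wire.injEq] at h
          simp [merge, wireS, h.1, h.2]
        · simp [hs] at e
    · rcases hend _ _ _ h with e | e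
      · exact absurd (e ▸ hmK) hq'.2
      · rcases hlow with ⟨hs, rfl, rfl⟩ | ⟨hs, rfl, rfl⟩
        · simp [hs] at e
        · rw [hs] at h ⊢
          simp only [wireS, Srt.op, wire.injEq] at h
          simp [merge, wireS, h.1, h.2]
    · have : s ≠ low := by
        rintro rfl
        have hnde := hG.nodup
        rw [hGdef, ends_add] at hnde
        refine not_mem_of_nodup_add hnde (a := (s, .val)) ?_
          (mem_ends.2 ⟨_, h, by simp [Item.ends]⟩)
        rcases hlow with ⟨hs, rfl, rfl⟩ | ⟨hs, rfl, rfl⟩ <;> simp [ends_wireS, hs]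
      rw [merge, if_neg this]
      simp [h]
  have hmap : ∀ N ∈ Z, ∀ l, Img G N l → Img ({wireS c.srt y z} + Z) N (l.map (merge low up)) :=
    fun N hN l hl => hl.map (hwire N hN) (hval N hN)
  intro l'
  constructor
  · rintro ⟨l, ⟨hl, hlt⟩, rfl⟩
    simp only [Set.mem_insert_iff, Set.mem_singleton_iff, not_or] at hlt
    obtain ⟨N, hN, hl⟩ := (hR l).1 hl
    have hNZ : N ∈ Z := by
      have hN' := hN
      simp only [hGdef, core, Multiset.mem_add, Multiset.mem_singleton] at hN'
      rcases hN' with ((((( rfl | rfl) | rfl) | rfl) | rfl) | rfl) | h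
      · exact absurd (hl.unique_link hG ht) hlt.1
      · exact absurd rfl (hl.ne_wireS _ _ _)
      · exact absurd rfl (hl.ne_wireS _ _ _)
      · exact absurd (hl.unique_link hG hk) hlt.2
      · exact absurd rfl (hl.ne_wireS _ _ _)
      · exact absurd rfl (hl.ne_wireS _ _ _)
      · exact h
    exact ⟨N, Multiset.mem_add.2 (.inr hNZ), hmap N hNZ l hl⟩
  · rintro ⟨N, hN, hl'⟩
    have hNZ : N ∈ Z := by
      rcases Multiset.mem_add.1 hN with h | h
      · rw [Multiset.mem_singleton] at h
        subst h
        exact absurd rfl (hl'.ne_wireS _ _ _)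
      · exact h
    obtain ⟨l, hl⟩ := Img.exists_link hG (hZG N hNZ) hl'.ne_wire
    refine ⟨l, ⟨(hR l).2 ⟨N, hZG N hNZ, hl⟩, ?_⟩, (hmap N hNZ l hl).unique_link hG' hl'⟩
    simp only [Set.mem_insert_iff, Set.mem_singleton_iff, not_or]
    constructor
    · rintro rfl
      exact (hZne N hNZ).1 (hl.unique_item hG (hZG N hNZ) hT ht)
    · rintro rfl
      exact (hZne N hNZ).2 (hl.unique_item hG (hZG N hNZ) hK hk)

theorem Contr.good {G H : Multiset (Item V)} (h : Contr G H) (hG : Good G) : Good H := by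
  refine ⟨Multiset.nodup_of_le h.ends_le hG.nodup, ?_⟩
  cases h with
  | mk c m a b p a' b' y z Z =>
    have := hG.le
    simp only [ends_add, ports_add, ends_core, ports_core, ends_singleton, ports_singleton,
      ends_wireS, ports_wireS, ends_cot, ports_cot, Srt.op_op, add_zero, zero_add] at this ⊢
    refine (Multiset.add_le_add_iff_left (s := {(a, c.fstSrt)} + {(a', c.fstSrt.op)} +
      ({(b, c.sndSrt)} + {(b', c.sndSrt.op)}) + {(p, c.srt)} + {(m, c.srt.op)})).1 ?_
    convert this using 1 <;> abel

theorem Rel.contract {A : APS V} {G : Multiset (Item V)} (hR : Rel A G) (hG : Good G)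
    {c : Conn} {m a b p a' b' y z low up : V} {t k : ALink V} {S : Set V}
    (hT : ten c p a' b' ∈ G) (hK : cot c m a b ∈ G) (ha : wireS c.fstSrt a a' ∈ G)
    (hb : wireS c.sndSrt b b' ∈ G) (hp : wireS c.srt p z ∈ G) (hm : wireS c.srt.op m y ∈ G)
    (hnd : [wireS c.fstSrt a a', wireS c.sndSrt b b', wireS c.srt p z, wireS c.srt.op m y].Nodup)
    (ht : Img G (ten c p a' b') t) (hk : Img G (cot c m a b) k)
    (hlow : (c.srt = .val ∧ low = p ∧ up = y) ∨ (c.srt = .ctx ∧ low = m ∧ up = z)) :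
    ∃ G', Contr G G' ∧ Rel ⟨S, ALink.map (merge low up) '' (A.links \ {t, k})⟩ G' := by
  have hle : core c p a b a' b' + {cot c m a b} + {wireS c.srt p z} + {wireS c.srt.op m y} ≤ G := by
    rw [Multiset.le_iff_subset]
    · intro N hN
      simp only [core, Multiset.mem_add, Multiset.mem_singleton] at hN
      rcases hN with (((( rfl | rfl) | rfl) | rfl) | rfl) | rfl <;> assumption
    · have e : core c p a b a' b' + {cot c m a b} + {wireS c.srt p z} + {wireS c.srt.op m y} =
          (([ten c p a' b', cot c m a b, wireS c.fstSrt a a', wireS c.sndSrt b b',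
            wireS c.srt p z, wireS c.srt.op m y] : List (Item V)) : Multiset (Item V)) := by
        simp only [core, ← Multiset.cons_coe, ← Multiset.singleton_add, Multiset.coe_nil, add_zero]
        abel
      rw [e, Multiset.coe_nodup, List.nodup_cons, List.nodup_cons]
      refine ⟨?_, ?_, hnd⟩
      · simp [ten_ne_cot, ten_ne_wireS]
      · simp [cot_ne_wireS]
  obtain ⟨Z, rfl⟩ := Multiset.le_iff_exists_add.1 hle
  have hC := Contr.mk c m a b p a' b' y z Z
  exact ⟨_, hC, Rel.contr hR hG ht hk hlow (hC.good hG)⟩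

/-- The numbers of premisses and conclusions of an unlabelled cotensor link leave three connectives
possible. The position of the main vertex, together with the distinctness of `h`, `c`, `i`, `j`,
leaves one. -/
theorem Rel.redex {A : APS V} {G : Multiset (Item V)} (hR : Rel A G) (hG : Good G)
    {t k : ALink V} {h c i j : V} (hr : Redex t k h c i j) (hnd : [h, c, i, j].Nodup)
    (ht : t ∈ A.links) (hk : k ∈ A.links) (S : Set V) :
    ∃ G', Contr G G' ∧ Rel ⟨S, ALink.map (merge c h) '' (A.links \ {t, k})⟩ G' := by
  obtain ⟨T, hT, ht⟩ := (hR t).1 ht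
  obtain ⟨K, hK, hk⟩ := (hR k).1 hk
  simp only [List.nodup_cons, List.mem_cons, List.not_mem_nil, or_false, not_or, not_false_eq_true,
    List.nodup_nil, and_true] at hnd
  obtain ⟨⟨hhc, hhi, hhj⟩, ⟨hci, hcj⟩, hij⟩ := hnd
  have hdown : ∀ q N, N ∈ G → (q, Srt.val) ∈ N.ports → ∃ y, wire q y ∈ G := fun q N hN hq =>
    hG.exists_wireS (mem_ports.2 ⟨N, hN, hq⟩)
  have ht' := ht
  have hk' := hk
  cases hr with
  | rdivR =>
    cases ht with | fuse h1 h2 => ?_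
    cases hk with
    | tensor h3 => exact absurd rfl hcj
    | ldiv h3 => exact absurd rfl hci
    | rdiv h3 =>
      obtain ⟨y, hy⟩ := hdown c _ hK (by simp [Item.ports, Conn.srt])
      exact Rel.contract (c := .rdiv) hR hG hT hK h3 h2 h1 hy
        (by simp [wireS, Conn.fstSrt, Conn.sndSrt, Conn.srt]; grind) ht' hk' (.inr ⟨rfl, rfl, rfl⟩)
  | tensorL =>
    cases ht with | fuse h1 h2 => ?_
    cases hk with
    | tensor h3 =>
      obtain ⟨y, hy⟩ := hdown c _ hT (by simp [Item.ports])
      exact Rel.contract (c := .tensor) hR hG hT hK h1 h2 hy h3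
        (by simp [wireS, Conn.fstSrt, Conn.sndSrt, Conn.srt]; grind) ht' hk' (.inl ⟨rfl, rfl, rfl⟩)
    | ldiv h3 => exact absurd rfl hhj
    | rdiv h3 => exact absurd rfl hhi
  | ldivR =>
    cases ht with | fuse h1 h2 => ?_
    cases hk with
    | tensor h3 => exact absurd rfl hcj
    | rdiv h3 => exact absurd rfl hci
    | ldiv h3 =>
      obtain ⟨y, hy⟩ := hdown c _ hK (by simp [Item.ports, Conn.srt])
      exact Rel.contract (c := .ldiv) hR hG hT hK h1 h3 h2 hy
        (by simp [wireS, Conn.fstSrt, Conn.sndSrt, Conn.srt]; grind) ht' hk' (.inr ⟨rfl, rfl, rfl⟩)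
  | oslashL =>
    cases ht with | split h1 => ?_
    cases hk with
    | oslash h3 h4 =>
      obtain ⟨y, hy⟩ := hdown c _ hT (by simp [Item.ports])
      exact Rel.contract (c := .oslash) hR hG hT hK h1 h4 hy h3
        (by simp [wireS, Conn.fstSrt, Conn.sndSrt, Conn.srt]; grind) ht' hk' (.inl ⟨rfl, rfl, rfl⟩)
    | obslash h3 h4 => exact absurd rfl hhi
    | plus h3 h4 => exact absurd rfl hhj
  | plusR =>
    cases ht with | split h1 => ?_
    cases hk with
    | oslash h3 h4 => exact absurd rfl hci
    | obslash h3 h4 => exact absurd rfl hcj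
    | plus h3 h4 =>
      obtain ⟨y, hy⟩ := hdown c _ hK (by simp [Item.ports, Conn.srt])
      exact Rel.contract (c := .plus) hR hG hT hK h3 h4 h1 hy
        (by simp [wireS, Conn.fstSrt, Conn.sndSrt, Conn.srt]; grind) ht' hk' (.inr ⟨rfl, rfl, rfl⟩)
  | obslashL =>
    cases ht with | split h1 => ?_
    cases hk with
    | oslash h3 h4 => exact absurd rfl hhi
    | obslash h3 h4 =>
      obtain ⟨y, hy⟩ := hdown c _ hT (by simp [Item.ports])
      exact Rel.contract (c := .obslash) hR hG hT hK h3 h1 hy h4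
        (by simp [wireS, Conn.fstSrt, Conn.sndSrt, Conn.srt]; grind) ht' hk' (.inl ⟨rfl, rfl, rfl⟩)
    | plus h3 h4 => exact absurd rfl hhj

/-- The internal wire keeps its source `m`, and no wire is changed. So the untouched links have the
same names before and after the step. -/
theorem Rel.interaction {A : APS V} {G : Multiset (Item V)} (hR : Rel A G) (hG : Good G)
    {x y m v w : V} {l₁ l₂ : ALink V} (hi : Interaction x y m v w l₁ l₂)
    (h1 : ⟨[x, y], [m], none⟩ ∈ A.links) (h2 : ⟨[m], [v, w], none⟩ ∈ A.links) (S : Set V) :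
    ∃ G', Inter G G' ∧
      Rel ⟨S, (A.links \ {⟨[x, y], [m], none⟩, ⟨[m], [v, w], none⟩}) ∪ {l₁, l₂}⟩ G' := by
  obtain ⟨M₀, hM, h1⟩ := (hR _).1 h1
  obtain ⟨S₀, hS, h2⟩ := (hR _).1 h2
  have h1' := h1
  have h2' := h2
  cases h1 with | @fuse x' y' _ _ _ hx hy => ?_
  cases h2 with | @split m' _ _ _ hm => ?_
  obtain ⟨Z, rfl⟩ : ∃ Z, G = {fuse x' y' m} + {wire m m'} + {split m' v w} + Z := by
    refine Multiset.le_iff_exists_add.1 ?_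
    rw [Multiset.le_iff_subset]
    · intro N hN
      simp only [Multiset.mem_add, Multiset.mem_singleton] at hN
      rcases hN with (rfl | rfl) | rfl <;> assumption
    · simp [Multiset.nodup_cons, Multiset.singleton_add]
  obtain ⟨S', M', hs, him⟩ : ∃ S' M', Swap x' y' m m' v w S' M' ∧
      ∀ G', wire x x' ∈ G' → wire y y' ∈ G' → wire m m' ∈ G' → Img G' S' l₁ ∧ Img G' M' l₂ := by
    cases hi with
    | g₁ => exact ⟨_, _, .g₁, fun G' h1 h2 h3 => ⟨.split h1, .fuse h3 h2⟩⟩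
    | g₂ => exact ⟨_, _, .g₂, fun G' h1 h2 h3 => ⟨.split h1, .fuse h3 h2⟩⟩
    | g₃ => exact ⟨_, _, .g₃, fun G' h1 h2 h3 => ⟨.split h2, .fuse h1 h3⟩⟩
    | g₄ => exact ⟨_, _, .g₄, fun G' h1 h2 h3 => ⟨.split h2, .fuse h1 h3⟩⟩
  have hI := Inter.mk Z hs
  have hG' := hI.good hG
  have hw : ∀ s q, wire s q ∈ {fuse x' y' m} + {wire m m'} + {split m' v w} + Z ↔
    wire s q ∈ {S'} + {wire m m'} + {M'} + Z := fun s q => hI.wire_mem_iff .val s q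
  obtain ⟨i1, i2⟩ := him _ ((hw _ _).1 hx) ((hw _ _).1 hy) ((hw _ _).1 hm)
  have hnd := hG.items_nodup
  refine ⟨_, hI, fun l => ?_⟩
  simp only [Set.mem_union, Set.mem_sdiff, Set.mem_insert_iff, Set.mem_singleton_iff, not_or]
  constructor
  · rintro (⟨hl, hn1, hn2⟩ | rfl | rfl)
    · obtain ⟨N, hN, hl⟩ := (hR l).1 hl
      refine ⟨N, ?_, hl.congr fun s q => (hw s q).1⟩
      simp only [Multiset.mem_add, Multiset.mem_singleton] at hN
      rcases hN with ((rfl | rfl) | rfl) | h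
      · exact absurd (hl.unique_link hG h1') hn1
      · exact absurd rfl (hl.ne_wire _ _)
      · exact absurd (hl.unique_link hG h2') hn2
      · exact Multiset.mem_add.2 (.inr h)
    · exact ⟨S', by simp, i1⟩
    · exact ⟨M', by simp, i2⟩
  · rintro ⟨N, hN, hl⟩
    simp only [Multiset.mem_add, Multiset.mem_singleton] at hN
    rcases hN with ((rfl | rfl) | rfl) | h
    · exact .inr (.inl (hl.unique_link hG' i1))
    · exact absurd rfl (hl.ne_wire _ _)
    · exact .inr (.inr (hl.unique_link hG' i2))
    · have hl' := hl.congr fun s q => (hw s q).2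
      have hN : N ∈ {fuse x' y' m} + {wire m m'} + {split m' v w} + Z := Multiset.mem_add.2 (.inr h)
      refine .inl ⟨(hR l).2 ⟨N, hN, hl'⟩, ?_, ?_⟩
      · rintro rfl
        obtain rfl := hl'.unique_item hG hN hM h1'
        exact not_mem_of_nodup_add hnd (by simp) h
      · rintro rfl
        obtain rfl := hl'.unique_item hG hN hS h2'
        exact not_mem_of_nodup_add hnd (by simp) h

/-- Every conversion of the abstract proof structure of a net is a conversion of its graph. -/
theorem Conv.steps {form : V → Form Atom} {bias : Atom → Pol} {k : Kind} {v : V} {t : Tm V k}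
    {Δ : Multiset (V × Srt)} {A T : APS V} (hsteps : Relation.ReflTransGen Step A T)
    {G : Multiset (Item V)} (hG : Conv form bias k v t Δ G) (hR : Rel A G) :
    ∃ H, Conv form bias k v t Δ H ∧ Rel T H := by
  induction hsteps with
  | refl => exact ⟨G, hG, hR⟩
  | tail _ hs ih =>
    obtain ⟨H, hH, hR⟩ := ih
    cases hs with
    | contract hr hnd ht hk =>
      obtain ⟨H', hC, hR'⟩ := hR.redex hH.good hr hnd ht hk _
      exact ⟨H', hH.contraction .refl hC, hR'⟩
    | interact hi hnd h1 h2 =>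
      obtain ⟨H', hI, hR'⟩ := hR.interaction hH.good hi h1 h2 _
      exact ⟨H', hH.inter hI, hR'⟩

theorem Rel.no_cot {A : APS V} {G : Multiset (Item V)} (hR : Rel A G) (hG : Good G)
    (hA : ∀ l ∈ A.links, l.main = none) (c : Conn) (m a b : V) : cot c m a b ∉ G := by
  intro h
  obtain ⟨l, hl⟩ := Img.exists_link hG h (by simp)
  exact hl.main_ne_none (hA l ((hR l).2 ⟨_, h, hl⟩))


/-! ### Links and their sorts -/

/-- The kind of the terms that are built by the rules for a polarity. -/
def Pol.kind : Pol → Kind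
  | .pos => .val
  | .neg => .ctx

theorem Conn.pol_kind (c : Conn) : c.pol.kind = c.srt.kind := by cases c <;> rfl

theorem Srt.kind_injective : Function.Injective Srt.kind := by
  intro s t h
  cases s <;> cases t <;> simp [Srt.kind] at h ⊢

theorem Conn.srt_of_pol (c : Conn) : (c.pol = .pos ∧ c.srt = .val) ∨ (c.pol = .neg ∧ c.srt = .ctx) := by
  cases c <;> simp [Conn.pol, Conn.srt]

namespace Link

variable {l : Link V}

theorem main_of_isTensor (h : l.IsTensor) : (l.conn.srt = .val ∧ (l.main, .val) ∈ l.concls) ∨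
    (l.conn.srt = .ctx ∧ (l.main, .ctx) ∈ l.prems) := by
  rcases l with ⟨c, s, m, a, b⟩
  cases c <;> cases s <;>
    simp [IsTensor, Conn.pol, Conn.srt, prems, concls, outer, inner] at h ⊢

theorem main_of_not_isTensor (h : ¬ l.IsTensor) :
    (l.conn.srt = .val ∧ (l.main, .val) ∈ l.prems) ∨
      (l.conn.srt = .ctx ∧ (l.main, .ctx) ∈ l.concls) := by
  rcases l with ⟨c, s, m, a, b⟩
  cases c <;> cases s <;>
    simp [IsTensor, Conn.pol, Conn.srt, prems, concls, outer, inner] at h ⊢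

theorem fst_of_isTensor (h : l.IsTensor) : (l.conn.fstSrt = .val ∧ (l.fst, .val) ∈ l.prems) ∨
    (l.conn.fstSrt = .ctx ∧ (l.fst, .ctx) ∈ l.concls) := by
  rcases l with ⟨c, s, m, a, b⟩
  cases c <;> cases s <;>
    simp [IsTensor, Conn.pol, Conn.fstSrt, prems, concls, outer, inner] at h ⊢

theorem snd_of_isTensor (h : l.IsTensor) : (l.conn.sndSrt = .val ∧ (l.snd, .val) ∈ l.prems) ∨
    (l.conn.sndSrt = .ctx ∧ (l.snd, .ctx) ∈ l.concls) := by
  rcases l with ⟨c, s, m, a, b⟩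
  cases c <;> cases s <;>
    simp [IsTensor, Conn.pol, Conn.sndSrt, prems, concls, outer, inner] at h ⊢

open Classical in
/-- The link as an item of a graph in which every vertex is a wire. -/
noncomputable def item (l : Link V) : Item V :=
  if l.IsTensor then ten l.conn l.main l.fst l.snd else cot l.conn l.main l.fst l.snd

theorem mem_ports_item (l : Link V) (v : V) :
    ((v, .ctx) ∈ l.item.ports ↔ v ∈ l.premVerts) ∧
      ((v, .val) ∈ l.item.ports ↔ v ∈ l.conclVerts) := by
  rcases l with ⟨c, s, m, a, b⟩
  cases c <;> cases s <;>
    simp [item, IsTensor, Conn.pol, Conn.fstSrt, Conn.sndSrt, Conn.srt, premVerts, conclVerts, prems,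
      concls, outer, inner, ten, Item.ports, or_comm]

theorem img_item (l : Link V) {G : Multiset (Item V)} (hG : ∀ v, wire v v ∈ G) :
    Img G l.item l.toALink := by
  rcases l with ⟨c, s, m, a, b⟩
  cases c <;> cases s <;>
    simp [item, toALink, IsTensor, Conn.pol, premVerts, conclVerts, prems, concls, outer, inner,
      ten] <;>
    constructor <;> exact hG _

theorem item_ne_wire (l : Link V) (s p : V) : l.item ≠ wire s p := by
  unfold item
  split
  · exact ten_ne_wire _ _ _ _ _ _
  · simp

theorem prems_srt_unique (h : l.premVerts.Nodup) {v : V} {s s' : Srt} (h1 : (v, s) ∈ l.prems)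
    (h2 : (v, s') ∈ l.prems) : s = s' :=
  congrArg Prod.snd (List.inj_on_of_nodup_map h h1 h2 rfl)

theorem concls_srt_unique (h : l.conclVerts.Nodup) {v : V} {s s' : Srt} (h1 : (v, s) ∈ l.concls)
    (h2 : (v, s') ∈ l.concls) : s = s' :=
  congrArg Prod.snd (List.inj_on_of_nodup_map h h1 h2 rfl)

theorem mem_premVerts {v : V} {s : Srt} (h : (v, s) ∈ l.prems) : v ∈ l.premVerts :=
  List.mem_map_of_mem (f := Prod.fst) h

theorem mem_conclVerts {v : V} {s : Srt} (h : (v, s) ∈ l.concls) : v ∈ l.conclVerts :=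
  List.mem_map_of_mem (f := Prod.fst) h

end Link

theorem Tm.fv_mk {N : Type*} (c : Conn) (t₁ : Tm N c.fstSrt.kind) (t₂ : Tm N c.sndSrt.kind) :
    (Tm.mk c t₁ t₂).fv = t₁.fv ∪ t₂.fv := by
  cases c <;> rfl

namespace ProofStructure

variable {P : ProofStructure Atom V} {bias : Atom → Pol} {d : V}

theorem TopSrt.unique {v : V} {s s' : Srt} (h : P.TopSrt v s) (h' : P.TopSrt v s') : s = s' := by
  rcases h with ⟨h1, rfl⟩ | ⟨l, hl, h1⟩ <;> rcases h' with ⟨h2, rfl⟩ | ⟨l', hl', h2⟩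
  · rfl
  · exact absurd (Link.mem_conclVerts h2) (h1 l' hl')
  · exact absurd (Link.mem_conclVerts h1) (h2 l hl)
  · obtain rfl := P.concl_unique l hl l' hl' v (Link.mem_conclVerts h1) (Link.mem_conclVerts h2)
    exact Link.concls_srt_unique (P.concl_nodup l hl) h1 h2

theorem BotSrt.unique {v : V} {s s' : Srt} (h : P.BotSrt d v s) (h' : P.BotSrt d v s') : s = s' := by
  rcases h with ⟨h1, h1'⟩ | ⟨l, hl, h1⟩ <;> rcases h' with ⟨h2, h2'⟩ | ⟨l', hl', h2⟩
  · rcases h1' with ⟨h1, rfl⟩ | ⟨h1, rfl⟩ <;> rcases h2' with ⟨h2, rfl⟩ | ⟨h2, rfl⟩ <;>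
      first | rfl | contradiction
  · exact absurd (Link.mem_premVerts h2) (h1 l' hl')
  · exact absurd (Link.mem_premVerts h1) (h2 l hl)
  · obtain rfl := P.prem_unique l hl l' hl' v (Link.mem_premVerts h1) (Link.mem_premVerts h2)
    exact Link.prems_srt_unique (P.prem_nodup l hl) h1 h2

/-- Active vertices of the same sort lie on the same side of the link, where repetitions are
forbidden. -/
theorem actives_ne {l : Link V} (hl : l ∈ P.links) :
    (l.fst, l.conn.fstSrt) ≠ (l.snd, l.conn.sndSrt) := by
  have h1 := P.prem_nodup l hl
  have h2 := P.concl_nodup l hl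
  clear hl
  rcases l with ⟨c, s, m, a, b⟩
  cases c <;> cases s <;>
    simp [Conn.fstSrt, Conn.sndSrt, Link.premVerts, Link.conclVerts, Link.prems, Link.concls,
      Link.outer, Link.inner] at h1 h2 ⊢ <;> assumption

/-- `v` is the main vertex of a cotensor link. -/
def CotMain (P : ProofStructure Atom V) (v : V) : Prop := ∃ l ∈ P.links, ¬ l.IsTensor ∧ l.main = v

theorem pol_main {l : Link V} (hl : l ∈ P.links) : (P.form l.main).pol bias = l.conn.pol := by
  rw [P.form_main l hl]; rfl

/-- The term at `v` of the given kind may be asked for in the course of a computation. -/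
def Use (P : ProofStructure Atom V) (bias : Atom → Pol) (d : V) : Kind → V → Prop
  | .val, v => v = d ∨ (∃ l ∈ P.links, l.IsTensor ∧ (v, .val) ∈ l.prems) ∨
      (P.IsCommand d v ∧ (P.form v).pol bias = .pos)
  | .ctx, v => (∃ l ∈ P.links, l.IsTensor ∧ (v, .ctx) ∈ l.concls) ∨
      (P.IsCommand d v ∧ (P.form v).pol bias = .neg)
  | .cmd, _ => True

theorem Use.fst {l : Link V} (hl : l ∈ P.links) (ht : l.IsTensor) :
    P.Use bias d l.conn.fstSrt.kind l.fst := by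
  rcases Link.fst_of_isTensor ht with ⟨h1, h2⟩ | ⟨h1, h2⟩ <;> rw [h1]
  · exact .inr (.inl ⟨l, hl, ht, h2⟩)
  · exact .inl ⟨l, hl, ht, h2⟩

theorem Use.snd {l : Link V} (hl : l ∈ P.links) (ht : l.IsTensor) :
    P.Use bias d l.conn.sndSrt.kind l.snd := by
  rcases Link.snd_of_isTensor ht with ⟨h1, h2⟩ | ⟨h1, h2⟩ <;> rw [h1]
  · exact .inr (.inl ⟨l, hl, ht, h2⟩)
  · exact .inl ⟨l, hl, ht, h2⟩

/-- The main vertex of a cotensor link, if positive, is a premiss of sort `val` of that link. So it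
is not `d`, not a premiss of a tensor link, and not a command link. Hence no atomic value brings a
main vertex into the graph before its cotensor link is passed. -/
theorem Use.not_cotMain_of_pos (hd : P.IsConcl d) {v : V} (h : P.Use bias d .val v)
    (hp : (P.form v).pol bias = .pos) : ¬ P.CotMain v := by
  rintro ⟨l, hl, ht, rfl⟩
  rw [pol_main hl] at hp
  rcases Link.main_of_not_isTensor ht with ⟨-, h2⟩ | ⟨h1, -⟩
  · rcases h with rfl | ⟨l', hl', ht', h3⟩ | ⟨h3, -⟩
    · exact hd l hl (Link.mem_premVerts h2)
    · obtain rfl := P.prem_unique l hl l' hl' _ (Link.mem_premVerts h2) (Link.mem_premVerts h3)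
      exact ht ht'
    · have := BotSrt.unique h3.2 (.inr ⟨l, hl, h2⟩)
      simp at this
  · rcases l.conn.srt_of_pol with h | h <;> simp_all

theorem Use.not_cotMain_of_neg {v : V} (h : P.Use bias d .ctx v)
    (hp : (P.form v).pol bias = .neg) : ¬ P.CotMain v := by
  rintro ⟨l, hl, ht, rfl⟩
  rw [pol_main hl] at hp
  rcases Link.main_of_not_isTensor ht with ⟨h1, -⟩ | ⟨-, h2⟩
  · rcases l.conn.srt_of_pol with h | h <;> simp_all
  · rcases h with ⟨l', hl', ht', h3⟩ | ⟨h3, -⟩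
    · obtain rfl := P.concl_unique l hl l' hl' _ (Link.mem_conclVerts h2) (Link.mem_conclVerts h3)
      exact ht ht'
    · have := TopSrt.unique h3.1 (.inr ⟨l, hl, h2⟩)
      simp at this

theorem TopVar.topSrt {v : V} (h : P.TopVar v) : P.TopSrt v .val := by
  rcases h with h | ⟨l, hl, -, h⟩
  · exact .inl ⟨h, rfl⟩
  · exact .inr ⟨l, hl, h⟩

theorem BotCovar.botSrt {v : V} (h : P.BotCovar d v) : P.BotSrt d v .ctx := by
  rcases h with h | ⟨l, hl, -, h⟩
  · exact .inl ⟨h.1, .inr ⟨h.2, rfl⟩⟩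
  · exact .inr ⟨l, hl, h⟩

/-- If a value is needed at the lower end and stands at the upper end, the axiom link is a
substitution link, whose polarity the bias condition fixes. The exception is a command link, where
the polarity is already part of the use. -/
theorem Use.pos_of_topSrt (hd : P.IsConcl d) (hbias : P.RespectsBias bias d) {v : V}
    (h : P.Use bias d .val v) (hv : P.TopSrt v .val) : (P.form v).pol bias = .pos := by
  rcases h with rfl | ⟨l, hl, ht, h⟩ | h
  · exact (hbias _).1 ⟨hv, .inl ⟨hd, .inl ⟨rfl, rfl⟩⟩⟩
  · exact (hbias _).1 ⟨hv, .inr ⟨l, hl, h⟩⟩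
  · exact h.2

theorem Use.neg_of_botSrt (hbias : P.RespectsBias bias d) {v : V}
    (h : P.Use bias d .ctx v) (hv : P.BotSrt d v .ctx) : (P.form v).pol bias = .neg := by
  rcases h with ⟨l, hl, ht, h⟩ | h
  · exact (hbias _).2 ⟨.inr ⟨l, hl, h⟩, hv⟩
  · exact h.2

variable {pair : {v // P.IsCommand d v} ≃ {v // P.IsMu d v}}

/-! ### The order in which a computation visits a net -/

/-- `Sub bias d pair q p`: to compute the term at `p` one needs the term at `q`. -/
inductive Sub (bias : Atom → Pol) (d : V) (pair : {v // P.IsCommand d v} ≃ {v // P.IsMu d v}) :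
    Kind × V → Kind × V → Prop
  | fst {l : Link V} {q p} : l ∈ P.links → l.IsTensor → q = (l.conn.fstSrt.kind, l.fst) →
      p = (l.conn.srt.kind, l.main) → Sub bias d pair q p
  | snd {l : Link V} {q p} : l ∈ P.links → l.IsTensor → q = (l.conn.sndSrt.kind, l.snd) →
      p = (l.conn.srt.kind, l.main) → Sub bias d pair q p
  | cmd {v : V} {q p} : P.IsCommand d v → q = (((P.form v).pol bias).kind, v) → p = (.cmd, v) →
      Sub bias d pair q p
  | mu {q p} (c : {v // P.IsCommand d v}) : (P.form (pair c).1).pol bias = .neg → q = (.cmd, c.1) →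
      p = (.val, (pair c).1) → Sub bias d pair q p
  | comu {q p} (c : {v // P.IsCommand d v}) : (P.form (pair c).1).pol bias = .pos →
      q = (.cmd, c.1) → p = (.ctx, (pair c).1) → Sub bias d pair q p

/-- The three ways in which a computation proceeds: upwards or downwards through a tensor link, from
a command link to its term, and from a `μ/μ̃` link to the command link paired with it. -/
theorem Sub.cases' {q p : Kind × V} (h : Sub bias d pair q p) :
    (∃ l ∈ P.links, l.IsTensor ∧ p = (l.conn.srt.kind, l.main) ∧
      (q = (l.conn.fstSrt.kind, l.fst) ∨ q = (l.conn.sndSrt.kind, l.snd)) ∧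
      ((q.1 = .val ∧ (q.2, .val) ∈ l.prems) ∨ (q.1 = .ctx ∧ (q.2, .ctx) ∈ l.concls))) ∨
    (∃ v, P.IsCommand d v ∧ q = (((P.form v).pol bias).kind, v) ∧ p = (.cmd, v)) ∨
    ∃ c : {v // P.IsCommand d v}, q = (.cmd, c.1) ∧
      (((P.form (pair c).1).pol bias = .neg ∧ p = (.val, (pair c).1)) ∨
        ((P.form (pair c).1).pol bias = .pos ∧ p = (.ctx, (pair c).1))) := by
  cases h with
  | @fst l _ _ hl ht hq hp =>
    refine .inl ⟨l, hl, ht, hp, .inl hq, ?_⟩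
    subst hq
    rcases Link.fst_of_isTensor ht with ⟨h1, h2⟩ | ⟨h1, h2⟩ <;> simp [h1, h2, Srt.kind]
  | @snd l _ _ hl ht hq hp =>
    refine .inl ⟨l, hl, ht, hp, .inr hq, ?_⟩
    subst hq
    rcases Link.snd_of_isTensor ht with ⟨h1, h2⟩ | ⟨h1, h2⟩ <;> simp [h1, h2, Srt.kind]
  | cmd hv hq hp => exact .inr (.inl ⟨_, hv, hq, hp⟩)
  | mu c hc hq hp => exact .inr (.inr ⟨c, hq, .inl ⟨hc, hp⟩⟩)
  | comu c hc hq hp => exact .inr (.inr ⟨c, hq, .inr ⟨hc, hp⟩⟩)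

theorem pol_kind_ne_cmd (p : Pol) : p.kind ≠ .cmd := by cases p <;> simp [Pol.kind]

/-- A term is needed in one place only: a vertex is a premiss and a conclusion of at most one link
each, and a command link has one partner, whose polarity decides between `μ` and `μ̃`. The sorts
keep the three kinds of passage apart. -/
theorem Sub.rightUnique : Relator.RightUnique (Sub bias d pair) := by
  intro q p p' h h'
  rcases h.cases' with ⟨l, hl, ht, rfl, -, h1⟩ | ⟨v, hv, rfl, rfl⟩ | ⟨c, rfl, h1⟩ <;>
    rcases h'.cases' with ⟨l', hl', ht', rfl, -, h2⟩ | ⟨v', hv', h2, rfl⟩ | ⟨c', h2, h3⟩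
  · rcases h1 with ⟨h1, h3⟩ | ⟨h1, h3⟩ <;> rcases h2 with ⟨h2, h4⟩ | ⟨h2, h4⟩
    · rw [P.prem_unique l hl l' hl' _ (Link.mem_premVerts h3) (Link.mem_premVerts h4)]
    · simp [h1] at h2
    · simp [h1] at h2
    · rw [P.concl_unique l hl l' hl' _ (Link.mem_conclVerts h3) (Link.mem_conclVerts h4)]
  · subst h2
    rcases h1 with ⟨-, h1⟩ | ⟨-, h1⟩
    · exact absurd (BotSrt.unique (.inr ⟨l, hl, h1⟩) hv'.2) (by simp)
    · exact absurd (TopSrt.unique (.inr ⟨l, hl, h1⟩) hv'.1) (by simp)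
  · subst h2; simp at h1
  · rcases h2 with ⟨-, h1⟩ | ⟨-, h1⟩
    · exact absurd (BotSrt.unique (.inr ⟨l', hl', h1⟩) hv.2) (by simp)
    · exact absurd (TopSrt.unique (.inr ⟨l', hl', h1⟩) hv.1) (by simp)
  · simp only [Prod.mk.injEq] at h2; rw [h2.2]
  · simp [pol_kind_ne_cmd] at h2
  · simp at h2
  · simp [(pol_kind_ne_cmd _).symm] at h2
  · simp only [Prod.mk.injEq, true_and] at h2
    obtain rfl := Subtype.ext h2
    rcases h1 with ⟨h1, rfl⟩ | ⟨h1, rfl⟩ <;> rcases h3 with ⟨h3, rfl⟩ | ⟨h3, rfl⟩ <;>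
      first | rfl | simp [h1] at h3

/-- If `q` is below two distinct immediate predecessors of `p`, then there is a cycle. -/
theorem Sub.transGen_self {q p q₁ q₂ : Kind × V} (h1 : Relation.ReflTransGen (Sub bias d pair) q q₁)
    (h2 : Relation.ReflTransGen (Sub bias d pair) q q₂) (h3 : Sub bias d pair q₁ p)
    (h4 : Sub bias d pair q₂ p) (hne : q₁ ≠ q₂) : Relation.TransGen (Sub bias d pair) p p := by
  have key : ∀ {q₁ q₂}, Relation.ReflTransGen (Sub bias d pair) q₁ q₂ → Sub bias d pair q₁ p →
      Sub bias d pair q₂ p → q₁ ≠ q₂ → Relation.TransGen (Sub bias d pair) p p := by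
    intro q₁ q₂ h h3 h4 hne
    rcases Relation.ReflTransGen.cases_head h with h | ⟨r, h5, h6⟩
    · exact absurd h hne
    · obtain rfl := Sub.rightUnique h5 h3
      exact Relation.TransGen.tail' h6 h4
  rcases Relation.ReflTransGen.total_of_right_unique Sub.rightUnique h1 h2 with h | h
  · exact key h h3 h4 hne
  · exact key h h4 h3 hne.symm

theorem _root_.Acc.not_transGen_self {α : Type*} {r : α → α → Prop} {a : α} (h : Acc r a) :
    ¬ Relation.TransGen r a a := by
  intro h'
  have := h.transGen
  clear h
  induction this with
  | intro x _ ih => exact ih x h' h'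

theorem Sub.of_val {q : Kind × V} {v : V} (h : Sub bias d pair q (.val, v)) :
    (∃ l ∈ P.links, l.IsTensor ∧ l.main = v ∧ (v, .val) ∈ l.concls ∧
      (q = (l.conn.fstSrt.kind, l.fst) ∨ q = (l.conn.sndSrt.kind, l.snd))) ∨
    ∃ c : {v // P.IsCommand d v}, q = (.cmd, c.1) ∧ (P.form v).pol bias = .neg ∧
      (pair c).1 = v := by
  rcases h.cases' with ⟨l, hl, ht, h1, h2, -⟩ | ⟨v, hv, h1, h2⟩ | ⟨c, h1, ⟨h2, h3⟩ | ⟨h2, h3⟩⟩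
  · simp only [Prod.mk.injEq] at h1
    obtain ⟨h1, rfl⟩ := h1
    refine .inl ⟨l, hl, ht, rfl, ?_, h2⟩
    rcases Link.main_of_isTensor ht with ⟨h3, h4⟩ | ⟨h3, h4⟩
    · exact h4
    · simp [h3, Srt.kind] at h1
  · simp at h2
  · simp only [Prod.mk.injEq, true_and] at h3
    exact .inr ⟨c, h1, h3 ▸ h2, h3.symm⟩
  · simp at h3

theorem Sub.of_ctx {q : Kind × V} {v : V} (h : Sub bias d pair q (.ctx, v)) :
    (∃ l ∈ P.links, l.IsTensor ∧ l.main = v ∧ (v, .ctx) ∈ l.prems ∧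
      (q = (l.conn.fstSrt.kind, l.fst) ∨ q = (l.conn.sndSrt.kind, l.snd))) ∨
    ∃ c : {v // P.IsCommand d v}, q = (.cmd, c.1) ∧ (P.form v).pol bias = .pos ∧
      (pair c).1 = v := by
  rcases h.cases' with ⟨l, hl, ht, h1, h2, -⟩ | ⟨v, hv, h1, h2⟩ | ⟨c, h1, ⟨h2, h3⟩ | ⟨h2, h3⟩⟩
  · simp only [Prod.mk.injEq] at h1
    obtain ⟨h1, rfl⟩ := h1
    refine .inl ⟨l, hl, ht, rfl, ?_, h2⟩
    rcases Link.main_of_isTensor ht with ⟨h3, h4⟩ | ⟨h3, h4⟩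
    · simp [h3, Srt.kind] at h1
    · exact h4
  · simp at h2
  · simp at h3
  · simp only [Prod.mk.injEq, true_and] at h3
    exact .inr ⟨c, h1, h3 ▸ h2, h3.symm⟩

/-! ### Computations as constructions of graphs -/

/-- `Trav bias d pair k v t Δ G W`: a computation that yields the term `t`, with labels `Δ`, has
traversed the graph `G` and visited `W`. -/
inductive Trav (bias : Atom → Pol) (d : V) (pair : {v // P.IsCommand d v} ≃ {v // P.IsMu d v}) :
    (k : Kind) → V → Tm V k → Multiset (V × Srt) → Multiset (Item V) → Set (Mark V) → Prop
  | var (v : V) : (P.form v).pol bias = .pos → ¬ P.CotMain v →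
      (∀ q, ¬ Sub bias d pair q (.val, v)) →
      Trav bias d pair .val v (.var v) {(v, .val)} {wire v v} ∅
  | covar (v : V) : (P.form v).pol bias = .neg → ¬ P.CotMain v →
      (∀ q, ¬ Sub bias d pair q (.ctx, v)) →
      Trav bias d pair .ctx v (.covar v) {(v, .ctx)} {wire v v} ∅
  | ten {l : Link V} {t₁ t₂ Δ₁ Δ₂ G₁ G₂ W₁ W₂} : l ∈ P.links → l.IsTensor →
      Trav bias d pair l.conn.fstSrt.kind l.fst t₁ Δ₁ G₁ W₁ →
      Trav bias d pair l.conn.sndSrt.kind l.snd t₂ Δ₂ G₂ W₂ →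
      Trav bias d pair l.conn.srt.kind l.main (Tm.mk l.conn t₁ t₂) (Δ₁ + Δ₂)
        (G₁ + G₂ + ({Item.ten l.conn l.main l.fst l.snd} + {wire l.main l.main}))
        ({.link l} ∪ W₁ ∪ W₂)
  | cmdL {v : V} {E Δ G W} : P.IsCommand d v → (P.form v).pol bias = .neg →
      Trav bias d pair .ctx v E Δ G W →
      Trav bias d pair .cmd v (.cmdL v E) (Δ + {(v, .val)}) G ({.axm v} ∪ W)
  | cmdR {v : V} {U Δ G W} : P.IsCommand d v → (P.form v).pol bias = .pos →
      Trav bias d pair .val v U Δ G W →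
      Trav bias d pair .cmd v (.cmdR U v) (Δ + {(v, .ctx)}) G ({.axm v} ∪ W)
  | mu {C Δ G W} (c : {v // P.IsCommand d v}) : (P.form (pair c).1).pol bias = .neg →
      Trav bias d pair .cmd c.1 C (Δ + {((pair c).1, .ctx)}) G W →
      Trav bias d pair .val (pair c).1 (.mu (pair c).1 C) Δ G ({.axm (pair c).1} ∪ W)
  | comu {C Δ G W} (c : {v // P.IsCommand d v}) : (P.form (pair c).1).pol bias = .pos →
      Trav bias d pair .cmd c.1 C (Δ + {((pair c).1, .val)}) G W →
      Trav bias d pair .ctx (pair c).1 (.comu (pair c).1 C) Δ G ({.axm (pair c).1} ∪ W)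
  | frac {l : Link V} {u : V} {C Δ G W} : l ∈ P.links → ¬ l.IsTensor →
      Trav bias d pair .cmd u C (Δ + {(l.fst, l.conn.fstSrt)} + {(l.snd, l.conn.sndSrt)}) G W →
      Trav bias d pair .cmd u (.frac l.conn l.fst l.snd l.main C) (Δ + {(l.main, l.conn.srt)})
        (G + ({cot l.conn l.main l.fst l.snd} + {wire l.main l.main})) ({.link l} ∪ W)

theorem Calc.trav_ten {l : Link V} (hl : l ∈ P.links) (ht : l.IsTensor)
    {t₁ : Tm V l.conn.fstSrt.kind} {t₂ : Tm V l.conn.sndSrt.kind} {W₁ W₂ : Set (Mark V)}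
    (h1 : ∃ Δ G, Trav bias d pair l.conn.fstSrt.kind l.fst t₁ Δ G W₁ ∧ ∀ x ∈ t₁.fv, x ∈ Δ)
    (h2 : ∃ Δ G, Trav bias d pair l.conn.sndSrt.kind l.snd t₂ Δ G W₂ ∧ ∀ x ∈ t₂.fv, x ∈ Δ) :
    ∃ Δ G, Trav bias d pair l.conn.srt.kind l.main (Tm.mk l.conn t₁ t₂) Δ G
      ({.link l} ∪ W₁ ∪ W₂) ∧ ∀ x ∈ (Tm.mk l.conn t₁ t₂).fv, x ∈ Δ := by
  obtain ⟨Δ₁, G₁, h1, hf1⟩ := h1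
  obtain ⟨Δ₂, G₂, h2, hf2⟩ := h2
  refine ⟨_, _, .ten hl ht h1 h2, fun x hx => ?_⟩
  rw [Tm.fv_mk] at hx
  exact Multiset.mem_add.2 (hx.imp (hf1 x) (hf2 x))

/-- The computation requires the labels that it binds to be free in the command. Since free names
are among the labels `Δ`, they can be removed from `Δ`. The invariant `Use` supplies the polarities
at atomic terms. -/
theorem Calc.trav (hd : P.IsConcl d) (hbias : P.RespectsBias bias d) {k : Kind} {v : V} {t : Tm V k}
    {W : Set (Mark V)} (h : P.Calc bias d pair k v t W) : P.Use bias d k v →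
    ∃ Δ G, Trav bias d pair k v t Δ G W ∧ ∀ x ∈ t.fv, x ∈ Δ := by
  induction h with
  | @var v hv =>
    intro hu
    have hp := hu.pos_of_topSrt hd hbias hv.topSrt
    refine ⟨_, _, .var v hp (hu.not_cotMain_of_pos hd hp) fun q hq => ?_, by simp [Tm.fv]⟩
    rcases hq.of_val with ⟨l, hl, ht, rfl, h1, -⟩ | ⟨c, -, -, rfl⟩
    · rcases hv with hv | ⟨l', hl', ht', h2⟩
      · exact hv l hl (Link.mem_conclVerts h1)
      · obtain rfl := P.concl_unique l hl l' hl' _ (Link.mem_conclVerts h1) (Link.mem_conclVerts h2)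
        exact ht' ht
    · exact absurd (TopSrt.unique hv.topSrt (pair c).2.1) (by simp)
  | @covar v hv =>
    intro hu
    have hp := hu.neg_of_botSrt hbias hv.botSrt
    refine ⟨_, _, .covar v hp (hu.not_cotMain_of_neg hp) fun q hq => ?_, by simp [Tm.fv]⟩
    rcases hq.of_ctx with ⟨l, hl, ht, rfl, h1, -⟩ | ⟨c, -, -, rfl⟩
    · rcases hv with hv | ⟨l', hl', ht', h2⟩
      · exact hv.1 l hl (Link.mem_premVerts h1)
      · obtain rfl := P.prem_unique l hl l' hl' _ (Link.mem_premVerts h1) (Link.mem_premVerts h2)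
        exact ht' ht
    · exact absurd (BotSrt.unique hv.botSrt (pair c).2.2) (by simp)
  | @muVar v hv hp =>
    intro hu
    refine ⟨_, _, .var v hp (hu.not_cotMain_of_pos hd hp) fun q hq => ?_, by simp [Tm.fv]⟩
    rcases hq.of_val with ⟨l, hl, ht, rfl, h1, -⟩ | ⟨c, -, h1, rfl⟩
    · exact absurd (TopSrt.unique hv.1 (.inr ⟨l, hl, h1⟩)) (by simp)
    · simp [hp] at h1
  | @muCovar v hv hp =>
    intro hu
    refine ⟨_, _, .covar v hp (hu.not_cotMain_of_neg hp) fun q hq => ?_, by simp [Tm.fv]⟩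
    rcases hq.of_ctx with ⟨l, hl, ht, rfl, h1, -⟩ | ⟨c, -, h1, rfl⟩
    · exact absurd (BotSrt.unique hv.2 (.inr ⟨l, hl, h1⟩)) (by simp)
    · simp [hp] at h1
  | tensorR hl _ _ ih1 ih2 =>
    exact fun _ =>
      trav_ten hl trivial (ih1 (Use.fst hl trivial)) (ih2 (Use.snd hl trivial))
  | oslashR hl _ _ ih1 ih2 =>
    exact fun _ =>
      trav_ten hl trivial (ih1 (Use.fst hl trivial)) (ih2 (Use.snd hl trivial))
  | obslashR hl _ _ ih1 ih2 =>
    exact fun _ =>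
      trav_ten hl trivial (ih1 (Use.fst hl trivial)) (ih2 (Use.snd hl trivial))
  | plusL hl _ _ ih1 ih2 =>
    exact fun _ =>
      trav_ten hl trivial (ih1 (Use.fst hl trivial)) (ih2 (Use.snd hl trivial))
  | ldivL hl _ _ ih1 ih2 =>
    exact fun _ =>
      trav_ten hl trivial (ih1 (Use.fst hl trivial)) (ih2 (Use.snd hl trivial))
  | rdivL hl _ _ ih1 ih2 =>
    exact fun _ =>
      trav_ten hl trivial (ih1 (Use.fst hl trivial)) (ih2 (Use.snd hl trivial))
  | cmdL hv hp _ ih =>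
    intro _
    obtain ⟨Δ, G, h, hf⟩ := ih (.inr ⟨hv, hp⟩)
    refine ⟨_, _, .cmdL hv hp h, fun x hx => ?_⟩
    rw [add_comm]
    exact Multiset.mem_add.2 (hx.imp (fun h => Multiset.mem_singleton.2 h) (hf x))
  | cmdR hv hp _ ih =>
    intro _
    obtain ⟨Δ, G, h, hf⟩ := ih (.inr (.inr ⟨hv, hp⟩))
    refine ⟨_, _, .cmdR hv hp h, fun x hx => ?_⟩
    exact Multiset.mem_add.2 (hx.imp (hf x) (fun h => Multiset.mem_singleton.2 h))
  | frac l hl ht _ ha hb ih =>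
    intro _
    obtain ⟨Δ, G, h, hf⟩ := ih trivial
    obtain ⟨Δ, rfl⟩ := exists_eq_singleton_add (hf _ hb)
    -- The two active labels are different, so removing the second from `Δ` leaves the first in
    -- place.
    have ha' := (Multiset.mem_add.1 (hf _ ha)).resolve_left fun e =>
      actives_ne hl (Multiset.mem_singleton.1 e)
    obtain ⟨Δ, rfl⟩ := exists_eq_singleton_add ha'
    have e : {(l.snd, l.conn.sndSrt)} + ({(l.fst, l.conn.fstSrt)} + Δ) =
        Δ + {(l.fst, l.conn.fstSrt)} + {(l.snd, l.conn.sndSrt)} := by abel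
    rw [e] at h hf
    refine ⟨_, _, .frac hl ht h, ?_⟩
    rintro x (⟨hx, hx'⟩ | hx)
    · simp only [Set.mem_insert_iff, Set.mem_singleton_iff, not_or] at hx'
      have := hf x hx
      simp only [Multiset.mem_add, Multiset.mem_singleton, hx', or_false] at this
      exact Multiset.mem_add.2 (.inl this)
    · exact Multiset.mem_add.2 (.inr (Multiset.mem_singleton.2 hx))
  | mu c hp _ hc ih =>
    intro _
    obtain ⟨Δ, G, h, hf⟩ := ih trivial
    obtain ⟨Δ, rfl⟩ := exists_eq_singleton_add (hf _ hc)
    rw [add_comm] at h hf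
    refine ⟨_, _, .mu c hp h, ?_⟩
    rintro x ⟨hx, hx'⟩
    exact (Multiset.mem_add.1 (hf x hx)).resolve_right fun e => hx' (Multiset.mem_singleton.1 e)
  | comu c hp _ hc ih =>
    intro _
    obtain ⟨Δ, G, h, hf⟩ := ih trivial
    obtain ⟨Δ, rfl⟩ := exists_eq_singleton_add (hf _ hc)
    rw [add_comm] at h hf
    refine ⟨_, _, .comu c hp h, ?_⟩
    rintro x ⟨hx, hx'⟩
    exact (Multiset.mem_add.1 (hf x hx)).resolve_right fun e => hx' (Multiset.mem_singleton.1 e)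

end ProofStructure


/-! ### Computations in cut-free nets: termination, linearity, exhaustiveness -/

namespace ProofStructure

variable {P : ProofStructure Atom V} {bias : Atom → Pol} {d : V}
  {pair : {v // P.IsCommand d v} ≃ {v // P.IsMu d v}}
  {k : Kind} {v : V} {t : Tm V k} {Δ : Multiset (V × Srt)} {G : Multiset (Item V)}
  {W : Set (Mark V)}

theorem main_srt {l : Link V} (ht : l.IsTensor) {k : Kind} {v : V}
    (h : (l.conn.srt.kind, l.main) = (k, v)) :
    (k = .val ∧ (v, .val) ∈ l.concls) ∨ (k = .ctx ∧ (v, .ctx) ∈ l.prems) := by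
  simp only [Prod.mk.injEq] at h
  obtain ⟨rfl, rfl⟩ := h
  rcases Link.main_of_isTensor ht with ⟨h1, h2⟩ | ⟨h1, h2⟩ <;> simp [h1, h2, Srt.kind]

/-- A computation does not run in circles. -/
theorem Trav.acc (hcut : P.CutFree) (h : Trav bias d pair k v t Δ G W) :
    Acc (Sub bias d pair) (k, v) := by
  induction h with
  | var v _ _ hs => exact ⟨_, fun q hq => (hs q hq).elim⟩
  | covar v _ _ hs => exact ⟨_, fun q hq => (hs q hq).elim⟩
  | @ten l _ _ _ _ _ _ _ _ hl ht _ _ ih1 ih2 =>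
    refine ⟨_, fun q hq => ?_⟩
    rcases hq.cases' with ⟨l', hl', ht', h1, h2, -⟩ | ⟨v, hv, h1, h2⟩ | ⟨c, h1, ⟨h2, h3⟩ | ⟨h2, h3⟩⟩
    · simp only [Prod.mk.injEq] at h1
      -- Cut-freeness makes this the only link with the given main vertex, so its two operands are
      -- the only predecessors.
      obtain rfl := hcut l hl l' hl' h1.2
      rcases h2 with rfl | rfl
      exacts [ih1, ih2]
    · rcases main_srt ht h2 with ⟨h, -⟩ | ⟨h, -⟩ <;> simp at h
    · rcases main_srt ht h3 with ⟨-, h⟩ | ⟨h, -⟩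
      · exact absurd (TopSrt.unique (.inr ⟨l, hl, h⟩) (pair c).2.1) (by simp)
      · simp at h
    · rcases main_srt ht h3 with ⟨h, -⟩ | ⟨-, h⟩
      · simp at h
      · exact absurd (BotSrt.unique (.inr ⟨l, hl, h⟩) (pair c).2.2) (by simp)
  | @cmdL v _ _ _ _ hv hp _ ih =>
    refine ⟨_, fun q hq => ?_⟩
    rcases hq.cases' with ⟨l', hl', ht', h1, h2, -⟩ | ⟨v, hv, rfl, h2⟩ | ⟨c, h1, ⟨h2, h3⟩ | ⟨h2, h3⟩⟩
    · rcases main_srt ht' h1.symm with ⟨h, -⟩ | ⟨h, -⟩ <;> simp at h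
    · simp only [Prod.mk.injEq, true_and] at h2
      subst h2
      rw [hp]; exact ih
    · simp at h3
    · simp at h3
  | @cmdR v _ _ _ _ hv hp _ ih =>
    refine ⟨_, fun q hq => ?_⟩
    rcases hq.cases' with ⟨l', hl', ht', h1, h2, -⟩ | ⟨v, hv, rfl, h2⟩ | ⟨c, h1, ⟨h2, h3⟩ | ⟨h2, h3⟩⟩
    · rcases main_srt ht' h1.symm with ⟨h, -⟩ | ⟨h, -⟩ <;> simp at h
    · simp only [Prod.mk.injEq, true_and] at h2
      subst h2
      rw [hp]; exact ih
    · simp at h3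
    · simp at h3
  | @mu _ _ _ _ c hp _ ih =>
    refine ⟨_, fun q hq => ?_⟩
    rcases hq.of_val with ⟨l, hl, ht, -, h, -⟩ | ⟨c', rfl, -, h⟩
    · exact absurd (TopSrt.unique (.inr ⟨l, hl, h⟩) (pair c).2.1) (by simp)
    -- The pairing is injective, so the command link just computed is the only one from which this
    -- `μ` link can be followed.
    · obtain rfl := pair.injective (Subtype.ext h)
      exact ih
  | @comu _ _ _ _ c hp _ ih =>
    refine ⟨_, fun q hq => ?_⟩
    rcases hq.of_ctx with ⟨l, hl, ht, -, h, -⟩ | ⟨c', rfl, -, h⟩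
    · exact absurd (BotSrt.unique (.inr ⟨l, hl, h⟩) (pair c).2.2) (by simp)
    · obtain rfl := pair.injective (Subtype.ext h)
      exact ih
  | frac _ _ _ ih => exact ih

/-- `Orig bias x q`: the vertex `x` enters a computation at `q`, or else it is the main vertex of a
cotensor link and the vertices above that link enter it at `q`. -/
inductive Orig (P : ProofStructure Atom V) (bias : Atom → Pol) : V → Kind × V → Prop
  | base {x : V} : ¬ P.CotMain x → Orig P bias x (((P.form x).pol bias).kind, x)
  | cot {l : Link V} {q} : l ∈ P.links → ¬ l.IsTensor → Orig P bias l.fst q →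
      Orig P bias l.main q

/-- By cut-freeness a vertex is the main vertex of at most one cotensor link, so the ascent from a
vertex to its origin involves no choice. -/
theorem Orig.unique (hcut : P.CutFree) {x : V} {q q' : Kind × V} (h : P.Orig bias x q)
    (h' : P.Orig bias x q') : q = q' := by
  induction h with
  | base hx =>
    cases h' with
    | base => rfl
    | cot hl ht _ => exact absurd ⟨_, hl, ht, rfl⟩ hx
  | @cot l q hl ht _ ih =>
    generalize hy : l.main = y at h'
    cases h' with
    | base hx => exact absurd ⟨l, hl, ht, hy⟩ hx
    | cot hl' ht' h' =>
      obtain rfl := hcut _ hl _ hl' hy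
      exact ih h'

theorem not_cotMain_of_isTensor (hcut : P.CutFree) {l : Link V} (hl : l ∈ P.links)
    (ht : l.IsTensor) : ¬ P.CotMain l.main := by
  rintro ⟨l', hl', ht', h⟩
  obtain rfl := hcut _ hl' _ hl h
  exact ht' ht

theorem mem_ends_wire_self {x m : V} {s : Srt} : (x, s) ∈ ends {wire m m} ↔ x = m := by
  cases s <;> simp [Item.ends]

/-- The graph of a computation in a cut-free structure is well formed. -/
theorem Trav.conv (hcut : P.CutFree) (h : Trav bias d pair k v t Δ G W) :
    Conv P.form bias k v t Δ G ∧
      (∀ x s, (x, s) ∈ ends G →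
        ∃ q, P.Orig bias x q ∧ Relation.ReflTransGen (Sub bias d pair) q (k, v)) ∧
      ∀ l ∈ P.links, ¬ l.IsTensor → ∀ s, (l.main, s) ∈ ends G →
        cot l.conn l.main l.fst l.snd ∈ G := by
  have hacc := h.acc hcut
  induction h with
  | var v hp hv _ =>
    refine ⟨.var v hp, fun x s hx => ?_, fun l hl ht s hx => ?_⟩ <;>
      rw [mem_ends_wire_self] at hx
    · subst hx
      refine ⟨_, .base hv, ?_⟩
      rw [hp]
      exact .refl
    · exact absurd ⟨l, hl, ht, hx⟩ hv
  | covar v hp hv _ =>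
    refine ⟨.covar v hp, fun x s hx => ?_, fun l hl ht s hx => ?_⟩ <;>
      rw [mem_ends_wire_self] at hx
    · subst hx
      refine ⟨_, .base hv, ?_⟩
      rw [hp]
      exact .refl
    · exact absurd ⟨l, hl, ht, hx⟩ hv
  | @ten l t₁ t₂ Δ₁ Δ₂ G₁ G₂ W₁ W₂ hl ht h1 h2 ih1 ih2 =>
    have hs1 : Sub bias d pair _ _ := .fst hl ht rfl rfl
    have hs2 : Sub bias d pair _ _ := .snd hl ht rfl rfl
    obtain ⟨c1, o1, m1⟩ := ih1 (hacc.inv hs1)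
    obtain ⟨c2, o2, m2⟩ := ih2 (hacc.inv hs2)
    have hmain := not_cotMain_of_isTensor hcut hl ht
    have horig : P.Orig bias l.main (l.conn.srt.kind, l.main) := by
      have := Orig.base (bias := bias) hmain
      rwa [pol_main hl, Conn.pol_kind] at this
    have hcyc := hacc.not_transGen_self
    -- If the main vertex already occurred in an operand, its origin, which is the term being
    -- computed, would be needed for that operand: a cycle.
    have key : ∀ {q₁ x q}, P.Orig bias x q → Relation.ReflTransGen (Sub bias d pair) q q₁ →
        Sub bias d pair q₁ (l.conn.srt.kind, l.main) → x ≠ l.main := by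
      rintro q₁ x q ho hq hs rfl
      obtain rfl := ho.unique hcut horig
      exact hcyc (Relation.TransGen.tail' hq hs)
    have hn1 : ∀ x s, (x, s) ∈ ends G₁ → x ≠ l.main := fun x s hx =>
      let ⟨_, ho, hq⟩ := o1 x s hx; key ho hq hs1
    have hn2 : ∀ x s, (x, s) ∈ ends G₂ → x ≠ l.main := fun x s hx =>
      let ⟨_, ho, hq⟩ := o2 x s hx; key ho hq hs2
    have hnd : (ends (G₁ + G₂ + ({Item.ten l.conn l.main l.fst l.snd} +
        {wire l.main l.main}))).Nodup := by
      rw [ends_add, ends_add, ends_add, ends_singleton (Item.ten _ _ _ _), ends_ten, zero_add]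
      refine Multiset.nodup_add.2 ⟨Multiset.nodup_add.2 ⟨c1.nodup, c2.nodup, ?_⟩, ?_, ?_⟩
      -- A vertex common to both operands has a single origin, needed for each of the two, and two
      -- distinct predecessors of one term above the same origin give a cycle.
      · refine Multiset.disjoint_left.2 ?_
        rintro ⟨x, s⟩ hx1 hx2
        obtain ⟨q, ho, hq⟩ := o1 x s hx1
        obtain ⟨q', ho', hq'⟩ := o2 x s hx2
        obtain rfl := ho.unique hcut ho'
        refine hcyc (Sub.transGen_self hq hq' hs1 hs2 fun e => ?_)
        simp only [Prod.mk.injEq] at e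
        exact actives_ne hl (Prod.ext e.2 (Srt.kind_injective e.1))
      · simp [Item.ends]
      · refine Multiset.disjoint_left.2 ?_
        rintro ⟨x, s⟩ hx1 hx2
        rw [mem_ends_wire_self] at hx2
        rcases Multiset.mem_add.1 hx1 with hx1 | hx1
        exacts [hn1 x s hx1 hx2, hn2 x s hx1 hx2]
    refine ⟨.ten (P.form_main l hl) c1 c2 hnd .refl, fun x s hx => ?_, fun l' hl' ht' s hx => ?_⟩ <;>
      rw [ends_add, ends_add, ends_add, ends_singleton (Item.ten _ _ _ _), ends_ten, zero_add,
        Multiset.mem_add, Multiset.mem_add, mem_ends_wire_self] at hx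
    · rcases hx with (hx | hx) | rfl
      · obtain ⟨q, ho, hq⟩ := o1 x s hx
        exact ⟨q, ho, hq.tail hs1⟩
      · obtain ⟨q, ho, hq⟩ := o2 x s hx
        exact ⟨q, ho, hq.tail hs2⟩
      · exact ⟨_, horig, .refl⟩
    · rcases hx with (hx | hx) | hx
      · exact Multiset.mem_add.2 (.inl (Multiset.mem_add.2 (.inl (m1 l' hl' ht' s hx))))
      · exact Multiset.mem_add.2 (.inl (Multiset.mem_add.2 (.inr (m2 l' hl' ht' s hx))))
      · exact absurd ⟨l', hl', ht', hx⟩ hmain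
  | @cmdL v _ _ _ _ hv hp _ ih =>
    have hs : Sub bias d pair _ _ := .cmd hv rfl rfl
    rw [hp] at hs
    obtain ⟨c, o, m⟩ := ih (hacc.inv hs)
    exact ⟨.cmdL hp c, fun x s hx => let ⟨q, ho, hq⟩ := o x s hx; ⟨q, ho, hq.tail hs⟩, m⟩
  | @cmdR v _ _ _ _ hv hp _ ih =>
    have hs : Sub bias d pair _ _ := .cmd hv rfl rfl
    rw [hp] at hs
    obtain ⟨c, o, m⟩ := ih (hacc.inv hs)
    exact ⟨.cmdR hp c, fun x s hx => let ⟨q, ho, hq⟩ := o x s hx; ⟨q, ho, hq.tail hs⟩, m⟩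
  | @mu _ _ _ _ c hp _ ih =>
    have hs : Sub bias d pair _ _ := .mu c hp rfl rfl
    obtain ⟨c, o, m⟩ := ih (hacc.inv hs)
    exact ⟨.mu hp c, fun x s hx => let ⟨q, ho, hq⟩ := o x s hx; ⟨q, ho, hq.tail hs⟩, m⟩
  | @comu _ _ _ _ c hp _ ih =>
    have hs : Sub bias d pair _ _ := .comu c hp rfl rfl
    obtain ⟨c, o, m⟩ := ih (hacc.inv hs)
    exact ⟨.comu hp c, fun x s hx => let ⟨q, ho, hq⟩ := o x s hx; ⟨q, ho, hq.tail hs⟩, m⟩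
  | @frac l u C Δ G W hl ht _ ih =>
    obtain ⟨c, o, m⟩ := ih hacc
    -- If the main vertex were already present, so would be its cotensor link, and the active end
    -- `l.fst` would be occupied. But that end is still a label of the command.
    have hmain : ∀ s, (l.main, s) ∉ ends G := fun s hs =>
      c.not_mem_ports (x := (l.fst, l.conn.fstSrt)) (by simp)
        (mem_ports.2 ⟨_, m l hl ht s hs, by simp [Item.ports]⟩)
    have hnd : (ends (G + {wire l.main l.main})).Nodup := by
      rw [ends_add]
      refine Multiset.nodup_add.2 ⟨c.nodup, by simp [Item.ends], ?_⟩
      refine Multiset.disjoint_left.2 ?_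
      rintro ⟨x, s⟩ hx1 hx2
      rw [mem_ends_wire_self] at hx2
      exact hmain s (hx2 ▸ hx1)
    refine ⟨.frac (P.form_main l hl) c hnd, fun x s hx => ?_, fun l' hl' ht' s hx => ?_⟩ <;>
      rw [ends_add, ends_add, ends_singleton (cot _ _ _ _), ends_cot, zero_add, Multiset.mem_add,
        mem_ends_wire_self] at hx
    · rcases hx with hx | rfl
      · exact o x s hx
      -- The new main vertex inherits its origin from the active vertex `l.fst`, which already
      -- belongs to the graph of the command.
      · obtain ⟨q, ho, hq⟩ := o l.fst l.conn.fstSrt (by rw [c.ends_eq]; simp)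
        exact ⟨q, .cot hl ht ho, hq⟩
    · rcases hx with hx | hx
      · exact Multiset.mem_add.2 (.inl (m l' hl' ht' s hx))
      · obtain rfl := hcut _ hl' _ hl hx
        simp

theorem item_of_isTensor {l : Link V} (ht : l.IsTensor) :
    l.item = Item.ten l.conn l.main l.fst l.snd := by
  rw [Link.item, if_pos ht]

theorem item_of_not_isTensor {l : Link V} (ht : ¬ l.IsTensor) :
    l.item = cot l.conn l.main l.fst l.snd := by
  rw [Link.item, if_neg ht]

/-- The graph of a computation consists of wires and links of the net. -/
theorem Trav.mem (h : Trav bias d pair k v t Δ G W) :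
    ∀ N ∈ G, (∃ x, N = wire x x) ∨ ∃ l ∈ P.links, N = l.item := by
  induction h with
  | var v _ _ _ => exact fun N hN => .inl ⟨v, Multiset.mem_singleton.1 hN⟩
  | covar v _ _ _ => exact fun N hN => .inl ⟨v, Multiset.mem_singleton.1 hN⟩
  | @ten l _ _ _ _ _ _ _ _ hl ht _ _ ih1 ih2 =>
    intro N hN
    simp only [Multiset.mem_add, Multiset.mem_singleton] at hN
    rcases hN with (hN | hN) | hN | hN
    exacts [ih1 N hN, ih2 N hN, .inr ⟨l, hl, by rw [hN, item_of_isTensor ht]⟩, .inl ⟨_, hN⟩]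
  | cmdL _ _ _ ih => exact ih
  | cmdR _ _ _ ih => exact ih
  | mu _ _ _ ih => exact ih
  | comu _ _ _ ih => exact ih
  | @frac l _ _ _ _ _ hl ht _ ih =>
    intro N hN
    simp only [Multiset.mem_add, Multiset.mem_singleton] at hN
    rcases hN with hN | hN | hN
    exacts [ih N hN, .inr ⟨l, hl, by rw [hN, item_of_not_isTensor ht]⟩, .inl ⟨_, hN⟩]

/-- What a computation has visited belongs to its graph. -/
theorem Trav.visited (hcut : P.CutFree) (h : Trav bias d pair k v t Δ G W) :
    (∀ l, Mark.link l ∈ W → l.item ∈ G) ∧ ∀ u, Mark.axm u ∈ W → ∃ s, (u, s) ∈ ends G := by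
  induction h with
  | var v _ _ _ => simp
  | covar v _ _ _ => simp
  | @ten l _ _ _ _ _ _ _ _ hl ht _ _ ih1 ih2 =>
    constructor
    · rintro l' ((hl' | hl') | hl')
      · simp only [Set.mem_singleton_iff, Mark.link.injEq] at hl'
        subst hl'
        rw [item_of_isTensor ht]; simp
      · simp [ih1.1 l' hl']
      · simp [ih2.1 l' hl']
    · rintro u ((hu | hu) | hu)
      · simp at hu
      · obtain ⟨s, hs⟩ := ih1.2 u hu
        exact ⟨s, by simp [hs]⟩
      · obtain ⟨s, hs⟩ := ih2.2 u hu
        exact ⟨s, by simp [hs]⟩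
  | @cmdL v _ _ _ _ _ _ h ih =>
    refine ⟨fun l hl => ih.1 l (by simpa using hl), ?_⟩
    rintro u (hu | hu)
    · simp only [Set.mem_singleton_iff, Mark.axm.injEq] at hu
      exact ⟨.val, by rw [(h.conv hcut).1.ends_eq, hu]; simp [root]⟩
    · exact ih.2 u hu
  | @cmdR v _ _ _ _ _ _ h ih =>
    refine ⟨fun l hl => ih.1 l (by simpa using hl), ?_⟩
    rintro u (hu | hu)
    · simp only [Set.mem_singleton_iff, Mark.axm.injEq] at hu
      exact ⟨.ctx, by rw [(h.conv hcut).1.ends_eq, hu]; simp [root]⟩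
    · exact ih.2 u hu
  | @mu _ _ _ _ c _ h ih =>
    refine ⟨fun l hl => ih.1 l (by simpa using hl), ?_⟩
    rintro u (hu | hu)
    · simp only [Set.mem_singleton_iff, Mark.axm.injEq] at hu
      exact ⟨.ctx, by rw [(h.conv hcut).1.ends_eq, hu]; simp⟩
    · exact ih.2 u hu
  | @comu _ _ _ _ c _ h ih =>
    refine ⟨fun l hl => ih.1 l (by simpa using hl), ?_⟩
    rintro u (hu | hu)
    · simp only [Set.mem_singleton_iff, Mark.axm.injEq] at hu
      exact ⟨.val, by rw [(h.conv hcut).1.ends_eq, hu]; simp⟩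
    · exact ih.2 u hu
  | @frac l _ _ _ _ _ hl ht _ ih =>
    constructor
    · rintro l' (hl' | hl')
      · simp only [Set.mem_singleton_iff, Mark.link.injEq] at hl'
        subst hl'
        rw [item_of_not_isTensor ht]; simp
      · simp [ih.1 l' hl']
    · rintro u (hu | hu)
      · simp at hu
      · obtain ⟨s, hs⟩ := ih.2 u hu
        exact ⟨s, by simp [hs]⟩

/-- The graph of a computation that visits the whole net contains every vertex and every link. -/
theorem Trav.wire_mem (hcut : P.CutFree) {t : Tm V .val}
    (h : Trav bias d pair .val d t Δ G W) (hl : ∀ l ∈ P.links, Mark.link l ∈ W)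
    (hu : ∀ u, P.IsCommand d u ∨ P.IsMu d u → Mark.axm u ∈ W) (x : V) : wire x x ∈ G := by
  have hconv := (h.conv hcut).1
  obtain ⟨h1, h2⟩ := h.visited hcut
  have key : ∃ s, (x, s) ∈ ends G := by
    -- A vertex on a link enters with that link. An isolated vertex other than `d` is a value above
    -- a context, hence a command link, and has been visited. The vertex `d` itself is the root.
    by_cases hH : P.IsHyp x
    · by_cases hC : P.IsConcl x
      · by_cases hxd : x = d
        · exact ⟨.ctx, by rw [hconv.ends_eq, hxd]; simp [root]⟩
        · exact h2 x (hu x (.inl ⟨.inl ⟨hH, rfl⟩, .inl ⟨hC, .inr ⟨hxd, rfl⟩⟩⟩))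
      · simp only [IsConcl, not_forall, not_not] at hC
        obtain ⟨l, hl', hx⟩ := hC
        exact ⟨.ctx, Multiset.mem_of_le hconv.good.le
          (mem_ports.2 ⟨_, h1 l (hl l hl'), ((l.mem_ports_item x).1).2 hx⟩)⟩
    · simp only [IsHyp, not_forall, not_not] at hH
      obtain ⟨l, hl', hx⟩ := hH
      exact ⟨.val, Multiset.mem_of_le hconv.good.le
        (mem_ports.2 ⟨_, h1 l (hl l hl'), ((l.mem_ports_item x).2).2 hx⟩)⟩
  obtain ⟨s, hs⟩ := key
  obtain ⟨N, hN, hx⟩ := mem_ends.1 hs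
  obtain ⟨y, rfl⟩ := eq_wireS_of_mem_ends hx
  rcases h.mem _ hN with ⟨z, hz⟩ | ⟨l, -, hz⟩
  · rw [← wireS_self s] at hz
    obtain ⟨rfl, rfl⟩ := wireS_inj hz
    rwa [wireS_self] at hN
  · exfalso
    cases s <;> exact l.item_ne_wire _ _ hz.symm

theorem Trav.rel (hcut : P.CutFree) (h : Trav bias d pair k v t Δ G W)
    (hl : ∀ l ∈ P.links, Mark.link l ∈ W) (hw : ∀ x, wire x x ∈ G) : Rel P.toAPS G := by
  have hgood := (h.conv hcut).1.good
  intro l'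
  constructor
  · rintro ⟨l, hl', rfl⟩
    exact ⟨l.item, (h.visited hcut).1 l (hl l hl'), l.img_item hw⟩
  · rintro ⟨N, hN, hi⟩
    rcases h.mem N hN with ⟨x, rfl⟩ | ⟨l, hl', rfl⟩
    · exact absurd rfl (hi.ne_wire _ _)
    · exact ⟨l, hl', (l.img_item hw).unique_link hgood hi⟩

theorem Trav.mem_label_iff (hcut : P.CutFree) {t : Tm V .val}
    (h : Trav bias d pair .val d t Δ G W)
    (hl : ∀ l ∈ P.links, Mark.link l ∈ W) (hw : ∀ x, wire x x ∈ G) (x : V) (s : Srt) :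
    (x, s) ∈ Δ ↔ (P.IsHyp x ∧ s = .val) ∨ (P.IsConcl x ∧ x ≠ d ∧ s = .ctx) := by
  have hconv := (h.conv hcut).1
  have hnd := hconv.nodup
  rw [hconv.ends_eq] at hnd
  have hvis := (h.visited hcut).1
  have hall : (x, s) ∈ ports G + Δ + root .val d := by
    rw [← hconv.ends_eq]
    exact mem_ends.2 ⟨_, hw x, by cases s <;> simp [Item.ends]⟩
  have hport : (x, s) ∈ ports G ↔ (¬ P.IsHyp x ∧ s = .val) ∨ (¬ P.IsConcl x ∧ s = .ctx) := by
    constructor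
    · intro hx
      obtain ⟨N, hN, hx⟩ := mem_ports.1 hx
      rcases h.mem N hN with ⟨y, rfl⟩ | ⟨l, hl', rfl⟩
      · simp [Item.ports] at hx
      · cases s with
        | val => exact .inl ⟨fun hH => hH l hl' ((l.mem_ports_item x).2.1 hx), rfl⟩
        | ctx => exact .inr ⟨fun hC => hC l hl' ((l.mem_ports_item x).1.1 hx), rfl⟩
    · rintro (⟨hx, rfl⟩ | ⟨hx, rfl⟩)
      · simp only [IsHyp, not_forall, not_not] at hx
        obtain ⟨l, hl', hx⟩ := hx
        exact mem_ports.2 ⟨_, hvis l (hl l hl'), ((l.mem_ports_item x).2).2 hx⟩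
      · simp only [IsConcl, not_forall, not_not] at hx
        obtain ⟨l, hl', hx⟩ := hx
        exact mem_ports.2 ⟨_, hvis l (hl l hl'), ((l.mem_ports_item x).1).2 hx⟩
  have h1 : (x, s) ∈ Δ → (x, s) ∉ ports G := fun hx hp =>
    not_mem_of_nodup_add (Multiset.nodup_add.1 hnd).1 hp hx
  have h2 : (x, s) ∈ Δ → (x, s) ∉ root .val d := fun hx =>
    not_mem_of_nodup_add hnd (Multiset.mem_add.2 (.inr hx))
  have h3 : (x, s) ∈ root .val d ↔ x = d ∧ s = .ctx := by simp [root]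
  rw [Multiset.mem_add, Multiset.mem_add, hport, h3] at hall
  rw [hport] at h1
  rw [h3] at h2
  cases s <;> simp at * <;> tauto

end ProofStructure

/-! ### Labels of the derived sequent, and the theorem -/

theorem Rep.names_of_inters {form : V → Form Atom} {s : Srt} {v : V} {q : V}
    {X : Str V Atom s} {G G' : Multiset (Item V)} (h : Rep form X q G')
    (hi : Inters (G' + {wireS s q v}) G) :
    ports G + (X.names : Multiset (V × Srt)) + {(v, s.op)} = ends G := by
  rw [add_comm (ports G), hi.ends_eq, hi.ports_eq, ends_add, ports_add, ends_singleton, ports_singleton, ends_wireS,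
    ports_wireS, add_zero, h.names_eq, add_assoc]

end LG

theorem mainTheorem2 {Atom V : Type*} [Finite V] (bias : Atom → LG.Pol)
    (P : LG.ProofStructure Atom V) (hnet : P.IsProofNet) (hcut : P.CutFree)
    (d : V) (hd : P.IsConcl d) (hbias : P.RespectsBias bias d)
    (pair : {u // P.IsCommand d u} ≃ {u // P.IsMu d u})
    (v : LG.Tm V .val) (hv : P.Calculated bias d pair v) :
    ∃ X : LG.Str V Atom .val,
      LG.FLG bias (.val X v (P.form d)) ∧
      X.leaves.Nodup ∧
      ∀ (x : V) (s : LG.Srt) (A : LG.Form Atom), (x, s, A) ∈ X.leaves ↔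
        A = P.form x ∧ ((P.IsHyp x ∧ s = .val) ∨ (P.IsConcl x ∧ x ≠ d ∧ s = .ctx)) := by
  obtain ⟨W, hcalc, hlinks, haxm⟩ := hv
  obtain ⟨T, hsteps, htree⟩ := hnet
  obtain ⟨Δ, G, htrav, -⟩ := hcalc.trav hd hbias (.inl rfl)
  have hwire := htrav.wire_mem hcut hlinks haxm
  obtain ⟨H, hconv, hrel⟩ := LG.Conv.steps hsteps (htrav.conv hcut).1 (htrav.rel hcut hlinks hwire)
  obtain ⟨X, q, H', hrep, hinters, hflg⟩ := hconv.der (hrel.no_cot hconv.good htree.1)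
  -- Both sides are what remains of the ends of `H` once the ports and the root are removed. On the
  -- left this uses that pending interactions change neither ends nor ports.
  have hnames : (X.names : Multiset (V × LG.Srt)) = Δ := by
    have h1 := LG.Rep.names_of_inters hrep hinters
    rw [hconv.ends_eq] at h1
    exact Multiset.add_right_inj.1 (Multiset.add_left_inj.1 h1)
  have hmem : ∀ x s, (x, s) ∈ X.names ↔
      (P.IsHyp x ∧ s = .val) ∨ (P.IsConcl x ∧ x ≠ d ∧ s = .ctx) := by
    intro x s
    rw [← htrav.mem_label_iff hcut hlinks hwire, ← hnames, Multiset.mem_coe]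
  refine ⟨X, hflg, ?_, fun x s A => ?_⟩
  · have h1 := hconv.nodup
    rw [hconv.ends_eq, ← hnames] at h1
    exact List.Nodup.of_map _
      (Multiset.coe_nodup.1 (Multiset.nodup_add.1 (Multiset.nodup_add.1 h1).1).2.1)
  · rw [← hmem]
    constructor
    · intro h
      exact ⟨hrep.form_eq _ h, List.mem_map.2 ⟨_, h, rfl⟩⟩
    · rintro ⟨rfl, h⟩
      obtain ⟨⟨x', s', A⟩, hx, e⟩ := List.mem_map.1 h
      simp only [Prod.mk.injEq] at e
      obtain ⟨rfl, rfl⟩ := e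
      have := hrep.form_eq _ hx
      simp only at this
      rwa [← this]
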